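/- Let $d\geq 4$ be an integer with $d \equiv 0 \pmod 4$, let $\widehat f(y)=\int_{\mathbb R^d} f(x)e^{-2\pi i\langle x,y\rangle}\,dx$, and regard a radial function also as a function of the radius $r=|x|$. Then there are $n\in\mathbb N$ and radial Schwartz functions $f,f_+,f_-:\mathbb R^d\to\mathbb R$, with $f_+\neq 0$ and $f_-\neq 0$, such that: 1. $f=f_++f_-$ and $\widehat{f_\pm}=\pm(-i)^{-d/2}f_\pm$, hence $\widehat f=(-i)^{-d/2}(f_+-f_-)$; 2. $f(\sqrt{2n})=0$ and $f'(\sqrt{2n})\neq 0$; 3. $f(\sqrt{2m})=f'(\sqrt{2m})=0$ for all integers $m>n$; 4. the values $f(\sqrt{2m})$, $0\le m<n$, are explicitly computable from the coefficients of the modular forms from which $f$ is built, in the following sense. For $z$ in the upper half-plane let $q=e^{2\pi i z}$; let $E_2,E_4,E_6$ be the normalized Eisenstein series, $\Delta=(E_4^3-E_6^2)/1728$, $V=\theta_2^4$ and $W=\theta_4^4$ with $\theta_2(z)=\sum_{k\in\mathbb Z}e^{\pi i (k+1/2)^2z}$, $\theta_4(z)=\sum_{k\in\mathbb Z}(-1)^ke^{\pi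 i k^2z}$; and write $(g|_kT)(z)=g(z+1)$, $(g|_kS)(z)=z^{-k}g(-1/z)$. There are polynomials $A,B,C,R\in\mathbb Q[X,Y]$ with $C\neq 0$, such that $A(E_4,E_6)$, $B(E_4,E_6)$, $C(E_4,E_6)$ and $R(V,W)$ are isobaric of weights $12n-\frac d2+4$, $12n-\frac d2+2$, $12n-\frac d2$ and $12n-\frac d2+2$ respectively ($E_4$, $E_6$, $V$, $W$ having weights $4,6,2,2$), such that $$\varphi=\frac{A(E_4,E_6)+B(E_4,E_6)E_2+C(E_4,E_6)E_2^2}{\Delta^n},\qquad \psi=\frac{R(V,W)}{\Delta^n}$$ satisfy, with $k=2-\frac d2$, $\varphi(z)\to0$ as $\mathrm{Im}\,z\to\infty$, $\ \psi=\psi|_kT+\psi|_kS$, and $(\psi|_kS)(z)\to 0$ as $\mathrm{Im}\,z\to\infty$, such that for all $|x|>\sqrt{2n}$, with absolutely convergent integrals, $$f_+(x)=\tfrac{2\pi}{3}\sin^2\!\big(\tfrac{\pi|x|^2}{2}\big)\int_0^\infty\varphi(i/t)\,(it)^{\frac d2-2}e^{-\pi|x|^2t}\,dt,\qquad f_-(x)=\sin^2\!\big(\tfrac{\pi|x|^2}{2}\big)\int_0^\infty\psi(it)\,e^{-\pi|x|^2t}\,dt,$$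 and such that for every $0\le m<n$ the value $f(\sqrt{2m})$ is the rational number equal to the coefficient of $q^{-m}$ in the $q$-expansion of $\big(B(E_4,E_6)+2\,C(E_4,E_6)E_2\big)/\Delta^n$. -/

import Mathlib

open UpperHalfPlane ModularForm
open scoped FourierTransform SchwartzMap MatrixGroups

noncomputable section

namespace ModularSchwartz

/-- A function on `ℝ^d` is radial if its value depends only on the Euclidean norm. -/
def IsRadial {d : ℕ} (f : EuclideanSpace ℝ (Fin d) → ℝ) : Prop :=
  ∀ x y, ‖x‖ = ‖y‖ → f x = f y

/-- The Jacobi theta function `θ₂(z) = ∑ exp(π i (n + 1/2)² z)`. -/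
def theta2 (z : ℍ) : ℂ :=
  ∑' n : ℤ, Complex.exp (Real.pi * Complex.I * ((n : ℂ) + 1 / 2) ^ 2 * (z : ℂ))

/-- The Jacobi theta function `θ₄(z) = ∑ (-1)ⁿ exp(π i n² z)`. -/
def theta4 (z : ℍ) : ℂ :=
  ∑' n : ℤ, (-1 : ℂ) ^ n * Complex.exp (Real.pi * Complex.I * (n : ℂ) ^ 2 * (z : ℂ))

/-- The function `V = θ₂⁴`, a modular form of weight 2 on `Γ(2)`. -/
def thetaV (z : ℍ) : ℂ := theta2 z ^ 4

/-- The function `W = θ₄⁴`, a modular form of weight 2 on `Γ(2)`. -/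
def thetaW (z : ℍ) : ℂ := theta4 z ^ 4

/-- `P` is isobaric of weight `w` when its two variables have weights `4` and `6`, so that
`P(E₄, E₆)` is a modular form of weight `w` on `SL₂(ℤ)` (`P = 0` if `w < 0`). -/
def IsLevelOneWeight (P : MvPolynomial (Fin 2) ℚ) (w : ℤ) : Prop :=
  P.IsWeightedHomogeneous (![4, 6] : Fin 2 → ℤ) w

/-- `R` is isobaric of weight `w` when both of its variables have weight `2`, so that
`R(V, W)` is a modular form of weight `w` on `Γ(2)` (`R = 0` if `w < 0`). -/
def IsLevelTwoWeight (R : MvPolynomial (Fin 2) ℚ) (w : ℤ) : Prop :=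
  R.IsWeightedHomogeneous (![2, 2] : Fin 2 → ℤ) w

/-- The function `P(E₄, E₆)` on the upper half-plane. -/
def levelOne (P : MvPolynomial (Fin 2) ℚ) (z : ℍ) : ℂ :=
  MvPolynomial.aeval ![E₄ z, E₆ z] P

/-- The weakly holomorphic quasimodular form
`(A(E₄, E₆) + B(E₄, E₆) E₂ + C(E₄, E₆) E₂²) / Δⁿ` on `SL₂(ℤ)`. -/
def phi (n : ℕ) (A B C : MvPolynomial (Fin 2) ℚ) (z : ℍ) : ℂ :=
  (levelOne A z + levelOne B z * EisensteinSeries.E2 z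
    + levelOne C z * EisensteinSeries.E2 z ^ 2) / discriminant z ^ n

/-- The weakly holomorphic modular form `R(V, W) / Δⁿ` on `Γ(2)`. -/
def psi (n : ℕ) (R : MvPolynomial (Fin 2) ℚ) (z : ℍ) : ℂ :=
  MvPolynomial.aeval ![thetaV z, thetaW z] R / discriminant z ^ n

/-- The power series `1 + c ∑_{m ≥ 1} σ_k(m) q^m` with rational coefficients. -/
def eisensteinQ (c : ℚ) (k : ℕ) : PowerSeries ℚ :=
  PowerSeries.mk fun m => if m = 0 then 1 else c * (ArithmeticFunction.sigma k m : ℚ)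

/-- The `q`-expansion of `E₂`. -/
def E2q : PowerSeries ℚ := eisensteinQ (-24) 1

/-- The `q`-expansion of `E₄`. -/
def E4q : PowerSeries ℚ := eisensteinQ 240 3

/-- The `q`-expansion of `E₆`. -/
def E6q : PowerSeries ℚ := eisensteinQ (-504) 5

/-- The `q`-expansion of `Δ = (E₄³ - E₆²) / 1728`. -/
def deltaq : PowerSeries ℚ := PowerSeries.C (1 / 1728 : ℚ) * (E4q ^ 3 - E6q ^ 2)

/-- The `q`-expansion, a Laurent series with rational coefficients, of
`(B(E₄, E₆) + 2 C(E₄, E₆) E₂) / Δⁿ`. -/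
def valueSeries (n : ℕ) (B C : MvPolynomial (Fin 2) ℚ) : LaurentSeries ℚ :=
  HahnSeries.ofPowerSeries ℤ ℚ
      (MvPolynomial.aeval ![E4q, E6q] B + 2 * MvPolynomial.aeval ![E4q, E6q] C * E2q)
    / HahnSeries.ofPowerSeries ℤ ℚ deltaq ^ n

/-- The integrand of `∫₀^∞ φ(i/t) (it)^{d/2-2} e^{-π r² t} dt`; here `i/t = -1/(it)`. -/
def plusIntegrand (d : ℕ) (φ : ℍ → ℂ) (r t : ℝ) : ℂ :=
  φ (ofComplex (Complex.I / t)) * (Complex.I * t) ^ (d / 2 - 2) * Real.exp (-Real.pi * r ^ 2 * t)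

/-- The integrand of `∫₀^∞ ψ(it) e^{-π r² t} dt`. -/
def minusIntegrand (ψ : ℍ → ℂ) (r t : ℝ) : ℂ :=
  ψ (ofComplex (Complex.I * t)) * Real.exp (-Real.pi * r ^ 2 * t)

end ModularSchwartz

end

/-! The method is Viazovska's. Put s = |x|² and κ = d/2 - 2. Let g on the upper half-plane be given
by g(z) = ε z^κ h(-1/z), where ε = ±1, h(z + 1) = ε h(z), h decays at i∞, and g(z + 1) + g(z - 1) -
2g(z) = 2h(z) (`ModularKernel`). Since -4 sin²(πs/2) = e^{πis} + e^{-πis} - 2, multiplying the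
Laplace transform ∫ g(it) e^{-πst} dt by sin²(πs/2) amounts to shifting its contour by ±1. Moving
the contours rewrites the product as a superposition of Gaussians e^{πisz} along paths from i to 1,
-1, 0 and i∞ (`profile`, `ModularKernel.profile_eq_laplace`). The weights decay rapidly along these
paths, so the result is a Schwartz function for all x. The Fourier transform sends e^{πi|x|²z} to
(i/z)^{d/2} e^{πi|y|²(-1/z)}, and z ↦ -1/z exchanges the paths to 1 and -1 and those to 0 and i∞.
This gives an eigenfunction with eigenvalue ε i^{d/2} (`ModularKernel.exists_eigenfunction`).

Values are read off at i∞. If g(it) is the sum of the terms (a_m t + b_m) e^{2πmt}, m ≤ n, up to a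
decaying error, its Laplace transform is a sum of a_m/(π(s - 2m))² + b_m/(π(s - 2m)) and a function
holomorphic near s ≥ 0. The factor sin² cancels the poles. At s = 2m the profile has value a_m/4
and, when a_m = 0, derivative πb_m/4; for m > n it has a double zero
(`ModularKernel.profile_two_mul`, `ModularKernel.hasDerivAt_profile_two_mul`).

For f₊ take h = φ, with B = 0. The transformation law of E₂ makes z^κ φ(-1/z) quadratic in z with
periodic coefficients, and its linear coefficient is a multiple of 2CE₂/Δⁿ; this produces the
values. For f₋ take g = ψ and h = -ψ|S. Then all a_m vanish, so f₋ is zero at every √(2m), but b_n =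
R(0, 1) ≠ 0 makes the zero at √(2n) simple. Since C is chosen divisible by Δ, f₊ contributes nothing
there. The forms exist because linear systems with more unknowns than equations have nonzero
solutions (`exists_levelOne_pair`, `exists_levelTwo`); the level two system determines n. -/

noncomputable section

namespace ModularSchwartz

open Set Filter Topology MeasureTheory

/-! ### Schwartz functions of the squared norm. -/

section RadialSchwartz

variable {E : Type*} [NormedAddCommGroup E] [InnerProductSpace ℝ E]

/-- The first derivative is 2⟨y, ·⟩, the second is constant and the others vanish. The bound is an
i-th power because `norm_iteratedFDeriv_comp_le'` asks for geometric growth in i. -/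
lemma norm_iteratedFDeriv_norm_sq_le (x : E) (i : ℕ) (hi : 1 ≤ i) :
    ‖iteratedFDeriv ℝ i (fun y : E => ‖y‖ ^ 2) x‖ ≤ (2 * (1 + ‖x‖)) ^ i := by
  have hx : 0 ≤ ‖x‖ := norm_nonneg x
  have hf : fderiv ℝ (fun y : E => ‖y‖ ^ 2) = fun y => (2 • innerSL ℝ : E →L[ℝ] E →L[ℝ] ℝ) y := by
    ext y : 1
    rw [fderiv_norm_sq_apply]
    simp
  have h2 : ‖(2 • innerSL ℝ : E →L[ℝ] E →L[ℝ] ℝ)‖ ≤ 2 := by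
    refine ContinuousLinearMap.opNorm_le_bound _ (by norm_num) fun y => ?_
    simp only [_root_.smul_apply]
    calc ‖2 • innerSL ℝ y‖ ≤ 2 * ‖innerSL ℝ y‖ := by
          simpa using norm_nsmul_le (n := 2) (a := innerSL ℝ y)
      _ = 2 * ‖y‖ := by rw [innerSL_apply_norm]
  obtain ⟨j, rfl⟩ := Nat.exists_eq_add_of_le' hi
  rw [← norm_iteratedFDeriv_fderiv, hf]
  rcases j with _ | j
  · simp only [norm_iteratedFDeriv_zero]
    calc _ ≤ 2 * ‖x‖ := (ContinuousLinearMap.le_opNorm _ _).trans (by gcongr)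
      _ ≤ _ := by rw [zero_add, pow_one]; linarith
  · rw [← norm_iteratedFDeriv_fderiv]
    have : fderiv ℝ (fun y => (2 • innerSL ℝ : E →L[ℝ] E →L[ℝ] ℝ) y) =
        fun _ => (2 • innerSL ℝ : E →L[ℝ] E →L[ℝ] ℝ) := by
      ext y : 1
      exact ContinuousLinearMap.fderiv _
    rw [this]
    rcases j with _ | j
    · simp only [norm_iteratedFDeriv_zero]
      refine h2.trans ?_
      simp only [zero_add, Nat.reduceAdd]
      nlinarith
    · rw [iteratedFDeriv_const_of_ne (by omega)]
      simp only [Pi.zero_apply, norm_zero]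
      positivity

lemma iteratedDerivWithin_Ioi_eq {V : Type*} [NormedAddCommGroup V] [NormedSpace ℝ V] {δ : ℝ}
    {D : ℕ → ℝ → V} (hD : ∀ j, ∀ s, -δ < s → HasDerivAt (D j) (D (j + 1) s) s) (j : ℕ) :
    ∀ s, -δ < s → iteratedDerivWithin j (D 0) (Ioi (-δ)) s = D j s := by
  induction j with
  | zero => intro s _; simp
  | succ j ih =>
    intro s hs
    rw [iteratedDerivWithin_succ, derivWithin_of_isOpen isOpen_Ioi hs]
    have : iteratedDerivWithin j (D 0) (Ioi (-δ)) =ᶠ[𝓝 s] D j := by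
      filter_upwards [Ioi_mem_nhds hs] with t ht using ih t ht
    rw [this.deriv_eq, (hD j s hs).deriv]

/-- A smooth function of the squared norm whose derivatives decay rapidly is Schwartz. -/
theorem exists_schwartzMap_comp_norm_sq {V : Type*} [NormedAddCommGroup V] [NormedSpace ℝ V]
    {δ : ℝ} (hδ : 0 < δ) {D : ℕ → ℝ → V}
    (hD : ∀ j, ∀ s, -δ < s → HasDerivAt (D j) (D (j + 1) s) s)
    (hdec : ∀ j N : ℕ, ∃ C, ∀ s, 0 ≤ s → (1 + s) ^ N * ‖D j s‖ ≤ C) :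
    ∃ f : 𝓢(E, V), ∀ x, f x = D 0 (‖x‖ ^ 2) := by
  have hu : UniqueDiffOn ℝ (Ioi (-δ)) := isOpen_Ioi.uniqueDiffOn
  have hit := iteratedDerivWithin_Ioi_eq hD
  have hsm : ContDiffOn ℝ (⊤ : ℕ∞) (D 0) (Ioi (-δ)) := by
    refine contDiffOn_of_differentiableOn_deriv fun m _ s hs => ?_
    exact ((hD m s hs).differentiableAt.differentiableWithinAt).congr
      (fun t ht => hit m t ht) (hit m s hs)
  have hns : ContDiff ℝ (⊤ : ℕ∞) (fun x : E => ‖x‖ ^ 2) := contDiff_norm_sq ℝ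
  -- The interval starts at -δ rather than 0 so that the squared norm takes its values in an open
  -- set on which the profile is smooth.
  have hr : range (fun x : E => ‖x‖ ^ 2) ⊆ Ioi (-δ) := by
    rintro _ ⟨x, rfl⟩
    have : 0 ≤ ‖x‖ ^ 2 := by positivity
    simp only [mem_Ioi]; linarith
  refine ⟨⟨fun x => D 0 (‖x‖ ^ 2), ?_, ?_⟩, fun x => rfl⟩
  · rw [← contDiffOn_univ]
    exact hsm.comp hns.contDiffOn fun x _ => hr ⟨x, rfl⟩
  · intro k n
    choose C hC using hdec
    -- The exponent k + n pays for ‖x‖ᵏ and for the n factors of size 2(1 + ‖x‖) coming from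
    -- derivatives of ‖x‖².
    set K := ∑ j ∈ Finset.range (n + 1), |C j (k + n)| with hK
    refine ⟨n.factorial * K * 4 ^ n * 2 ^ k, fun x => ?_⟩
    have hx : 0 ≤ ‖x‖ := norm_nonneg x
    have hb : ∀ i, i ≤ n → ‖iteratedFDerivWithin ℝ i (D 0) (Ioi (-δ)) (‖x‖ ^ 2)‖ ≤
        K / (1 + ‖x‖ ^ 2) ^ (k + n) := by
      intro i hi
      rw [norm_iteratedFDerivWithin_eq_norm_iteratedDerivWithin, hit i _ (hr ⟨x, rfl⟩),
        le_div_iff₀ (by positivity), mul_comm]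
      refine (hC i (k + n) _ (by positivity)).trans ((le_abs_self _).trans ?_)
      exact Finset.single_le_sum (f := fun j => |C j (k + n)|) (fun _ _ => abs_nonneg _)
        (Finset.mem_range.2 (by omega))
    have := norm_iteratedFDeriv_comp_le' hr hu hsm hns (n := n)
      (by exact_mod_cast le_top) x hb
      (fun i h1 _ => norm_iteratedFDeriv_norm_sq_le x i h1)
    have hK0 : 0 ≤ K := Finset.sum_nonneg fun _ _ => abs_nonneg _
    have h1 : (1 + ‖x‖) ≤ 2 * (1 + ‖x‖ ^ 2) := by nlinarith [sq_nonneg (‖x‖ - 1)]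
    have h2 : ‖x‖ ≤ 2 * (1 + ‖x‖ ^ 2) := by linarith
    calc ‖x‖ ^ k * ‖iteratedFDeriv ℝ n (fun x => D 0 (‖x‖ ^ 2)) x‖
        ≤ (2 * (1 + ‖x‖ ^ 2)) ^ k * (n.factorial * (K / (1 + ‖x‖ ^ 2) ^ (k + n)) *
            (2 * (2 * (1 + ‖x‖ ^ 2))) ^ n) := by
          refine mul_le_mul (by gcongr) (this.trans ?_) (norm_nonneg _) (by positivity)
          gcongr
      _ = n.factorial * K * 4 ^ n * 2 ^ k := by
          have : (1 + ‖x‖ ^ 2) ≠ 0 := by positivity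
          rw [pow_add, mul_pow, mul_pow, mul_pow]
          field_simp
          rw [← pow_mul, mul_comm n 2, pow_mul]; norm_num

end RadialSchwartz

/-! ### Superpositions of Gaussians and their Fourier transforms. -/

section GaussianMixture

/-- The superposition `∫ w(v) exp(π i s z(v)) dμ(v)`. -/
def gaussMix (μ : Measure ℝ) (w z : ℝ → ℂ) (s : ℂ) : ℂ :=
  ∫ v, w v * Complex.exp (Real.pi * Complex.I * s * z v) ∂μ

/-- The weight `w` along the path `z` in the strip `|Re z| ≤ 1` of the upper half-plane decays
faster than any power of `1 + |z| + 1 / Im z`, and exponentially as `Im z → ∞`. -/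
structure RapidWeight (δ : ℝ) (μ : Measure ℝ) (w z : ℝ → ℂ) : Prop where
  meas_w : AEStronglyMeasurable w μ
  meas_z : AEStronglyMeasurable z μ
  re_le : ∀ᵐ v ∂μ, |(z v).re| ≤ 1
  im_pos : ∀ᵐ v ∂μ, 0 < (z v).im
  int : ∀ N : ℕ, Integrable (fun v => ‖w v‖ * (1 + ‖z v‖ + (z v).im⁻¹) ^ N *
    Real.exp (Real.pi * δ * (z v).im)) μ

lemma norm_exp_pi_mul_I (s z : ℂ) : ‖Complex.exp (Real.pi * Complex.I * s * z)‖ =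
    Real.exp (-(Real.pi * (s.re * z.im + s.im * z.re))) := by
  rw [Complex.norm_exp]
  congr 1
  simp
  ring

lemma norm_exp_pi_mul_I_le {δ : ℝ} {s z : ℂ} (hs : -δ ≤ s.re) (hz : 0 < z.im)
    (hz' : |z.re| ≤ 1) : ‖Complex.exp (Real.pi * Complex.I * s * z)‖ ≤
      Real.exp (Real.pi * |s.im|) * Real.exp (Real.pi * δ * z.im) := by
  rw [norm_exp_pi_mul_I, ← Real.exp_add, Real.exp_le_exp]
  have h1 : -(s.im * z.re) ≤ |s.im| := by
    calc -(s.im * z.re) ≤ |s.im * z.re| := neg_le_abs _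
      _ = |s.im| * |z.re| := abs_mul _ _
      _ ≤ |s.im| * 1 := by gcongr
      _ = |s.im| := mul_one _
  have h2 : -(s.re * z.im) ≤ δ * z.im := by nlinarith
  have := Real.pi_pos
  nlinarith

/-- Differentiation under the integral sign. Only one power of ‖z‖ and no power of 1/Im z is
required, so that the lemma also serves `decayingPart`, whose weight need not vanish at 0. -/
lemma hasDerivAt_gaussMix {δ : ℝ} {μ : Measure ℝ} {w z : ℝ → ℂ}
    (hw : AEStronglyMeasurable w μ) (hz : AEStronglyMeasurable z μ)
    (hre : ∀ᵐ v ∂μ, |(z v).re| ≤ 1) (him : ∀ᵐ v ∂μ, 0 < (z v).im)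
    (hint : Integrable (fun v => ‖w v‖ * (1 + ‖z v‖) * Real.exp (Real.pi * δ * (z v).im)) μ)
    {s : ℂ} (hs : -δ < s.re) :
    HasDerivAt (gaussMix μ w z) (gaussMix μ (fun v => w v * (Real.pi * Complex.I * z v)) z s) s := by
  have hmeas : ∀ t : ℂ, AEStronglyMeasurable
      (fun v => w v * Complex.exp (Real.pi * Complex.I * t * z v)) μ := fun t =>
    hw.mul (Complex.continuous_exp.comp_aestronglyMeasurable
      (aestronglyMeasurable_const.mul hz))
  set U : Set ℂ := {t | -δ < t.re} ∩ {t | |t.im| < |s.im| + 1} with hU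
  have hUo : U ∈ 𝓝 s := by
    refine (IsOpen.inter ?_ ?_).mem_nhds ⟨hs, by simp⟩
    · exact isOpen_lt continuous_const Complex.continuous_re
    · exact isOpen_lt (continuous_abs.comp Complex.continuous_im) continuous_const
  have key := hasDerivAt_integral_of_dominated_loc_of_deriv_le (𝕜 := ℂ) (μ := μ) (x₀ := s)
    (F := fun t v => w v * Complex.exp (Real.pi * Complex.I * t * z v))
    (F' := fun t v => w v * (Real.pi * Complex.I * z v) *
      Complex.exp (Real.pi * Complex.I * t * z v))
    (bound := fun v => Real.pi * Real.exp (Real.pi * (|s.im| + 1)) *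
      (‖w v‖ * (1 + ‖z v‖) * Real.exp (Real.pi * δ * (z v).im))) hUo
    (Eventually.of_forall hmeas) ?_ ?_ ?_ (hint.const_mul _) ?_
  · exact key.2
  · refine Integrable.mono' (hint.const_mul (Real.exp (Real.pi * |s.im|))) (hmeas s) ?_
    filter_upwards [hre, him] with v h1 h2
    rw [norm_mul]
    calc _ ≤ ‖w v‖ * (Real.exp (Real.pi * |s.im|) * Real.exp (Real.pi * δ * (z v).im)) := by
          gcongr
          exact norm_exp_pi_mul_I_le hs.le h2 h1
      _ = Real.exp (Real.pi * |s.im|) * (‖w v‖ * 1 * Real.exp (Real.pi * δ * (z v).im)) := by ring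
      _ ≤ _ := by
          gcongr
          linarith [norm_nonneg (z v)]
  · exact (hw.mul (aestronglyMeasurable_const.mul hz)).mul
      (Complex.continuous_exp.comp_aestronglyMeasurable (aestronglyMeasurable_const.mul hz))
  · filter_upwards [hre, him] with v h1 h2 t ht
    rw [norm_mul, norm_mul]
    have h3 : ‖(Real.pi * Complex.I * z v : ℂ)‖ ≤ Real.pi * (1 + ‖z v‖) := by
      rw [norm_mul, norm_mul, Complex.norm_I, mul_one, Complex.norm_real, Real.norm_eq_abs,
        abs_of_pos Real.pi_pos]
      have := Real.pi_pos
      gcongr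
      linarith
    have h4 : Real.exp (Real.pi * |t.im|) ≤ Real.exp (Real.pi * (|s.im| + 1)) := by
      have := Real.pi_pos
      gcongr
      exact ht.2.le
    calc _ ≤ ‖w v‖ * (Real.pi * (1 + ‖z v‖)) *
          (Real.exp (Real.pi * |t.im|) * Real.exp (Real.pi * δ * (z v).im)) := by
          gcongr
          exact norm_exp_pi_mul_I_le (le_of_lt ht.1) h2 h1
      _ ≤ ‖w v‖ * (Real.pi * (1 + ‖z v‖)) *
          (Real.exp (Real.pi * (|s.im| + 1)) * Real.exp (Real.pi * δ * (z v).im)) := by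
          have := Real.pi_pos
          gcongr
      _ = _ := by ring
  · refine Eventually.of_forall fun v t _ => ?_
    have h := (((hasDerivAt_id t).const_mul (Real.pi * Complex.I)).mul_const (z v)).cexp.const_mul
      (w v)
    refine h.congr_deriv ?_
    simp only [id, mul_one]
    ring

namespace RapidWeight

variable {δ : ℝ} {μ : Measure ℝ} {w z : ℝ → ℂ}

lemma mul_path (h : RapidWeight δ μ w z) :
    RapidWeight δ μ (fun v => w v * (Real.pi * Complex.I * z v)) z where
  meas_w := h.meas_w.mul (aestronglyMeasurable_const.mul h.meas_z)
  meas_z := h.meas_z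
  re_le := h.re_le
  im_pos := h.im_pos
  int N := by
    refine Integrable.mono' ((h.int (N + 1)).const_mul Real.pi) ?_ ?_
    · refine ((h.meas_w.mul (aestronglyMeasurable_const.mul h.meas_z)).norm.mul ?_).mul ?_
      · have := (Complex.measurable_im.comp_aemeasurable h.meas_z.aemeasurable).inv
        exact (((h.meas_z.norm.aemeasurable.const_add 1).add this).pow_const N).aestronglyMeasurable
      · exact (Real.measurable_exp.comp_aemeasurable
          ((Complex.measurable_im.comp_aemeasurable h.meas_z.aemeasurable).const_mul
            (Real.pi * δ))).aestronglyMeasurable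
    · filter_upwards [h.im_pos] with v hv
      have h1 : 0 < (z v).im⁻¹ := inv_pos.2 hv
      have h2 := norm_nonneg (z v)
      have h3 := Real.pi_pos
      rw [Real.norm_of_nonneg (by positivity), norm_mul, norm_mul, norm_mul, Complex.norm_I,
        mul_one, Complex.norm_real, Real.norm_eq_abs, abs_of_pos Real.pi_pos, pow_succ]
      have h4 : ‖z v‖ ≤ 1 + ‖z v‖ + (z v).im⁻¹ := by linarith
      calc _ = Real.pi * (‖w v‖ * ((1 + ‖z v‖ + (z v).im⁻¹) ^ N * ‖z v‖) *
            Real.exp (Real.pi * δ * (z v).im)) := by ring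
        _ ≤ _ := by gcongr

lemma integrable_weak (h : RapidWeight δ μ w z) :
    Integrable (fun v => ‖w v‖ * (1 + ‖z v‖) * Real.exp (Real.pi * δ * (z v).im)) μ := by
  refine Integrable.mono' (h.int 1) ?_ ?_
  · refine (h.meas_w.norm.mul (h.meas_z.norm.const_add 1)).mul ?_
    exact (Real.measurable_exp.comp_aemeasurable
      ((Complex.measurable_im.comp_aemeasurable h.meas_z.aemeasurable).const_mul
        (Real.pi * δ))).aestronglyMeasurable
  · filter_upwards [h.im_pos] with v hv
    have h1 : 0 < (z v).im⁻¹ := inv_pos.2 hv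
    have h2 := norm_nonneg (z v)
    rw [Real.norm_of_nonneg (by positivity), pow_one]
    have : 1 + ‖z v‖ ≤ 1 + ‖z v‖ + (z v).im⁻¹ := by linarith
    gcongr

lemma hasDerivAt (h : RapidWeight δ μ w z) {s : ℂ} (hs : -δ < s.re) :
    HasDerivAt (gaussMix μ w z) (gaussMix μ (fun v => w v * (Real.pi * Complex.I * z v)) z s) s :=
  hasDerivAt_gaussMix h.meas_w h.meas_z h.re_le h.im_pos h.integrable_weak hs

lemma iterate (h : RapidWeight δ μ w z) (j : ℕ) :
    RapidWeight δ μ (fun v => w v * (Real.pi * Complex.I * z v) ^ j) z := by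
  induction j with
  | zero => simpa using h
  | succ j ih => simpa only [pow_succ, mul_assoc] using ih.mul_path

/-- From 1 + s ≤ (1 + 1/y)(1 + sy) and xᴺ ≤ N! eˣ. Powers of s are traded for powers of 1/y, and
these are controlled by the term `(z v).im⁻¹` in `RapidWeight`. -/
lemma one_add_pow_mul_exp_le {s y : ℝ} (hs : 0 ≤ s) (hy : 0 < y) (N : ℕ) :
    (1 + s) ^ N * Real.exp (-(Real.pi * (s * y))) ≤
      N.factorial * Real.exp 1 * (1 + y⁻¹) ^ N := by
  have hy' : 0 < y⁻¹ := inv_pos.2 hy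
  have h1 : (1 + s) ≤ (1 + y⁻¹) * (1 + s * y) := by
    have : (1 + y⁻¹) * (1 + s * y) = 1 + s + y⁻¹ + s * y := by field_simp; ring
    nlinarith [mul_nonneg hs hy.le]
  have h2 : (1 + s * y) ^ N ≤ N.factorial * Real.exp (1 + s * y) := by
    have := Real.pow_div_factorial_le_exp (1 + s * y) (by positivity) N
    rw [div_le_iff₀ (by positivity)] at this
    linarith
  have h3 : Real.exp (-(Real.pi * (s * y))) ≤ Real.exp (-(s * y)) := by
    rw [Real.exp_le_exp]
    have : s * y ≤ Real.pi * (s * y) := by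
      nlinarith [mul_nonneg hs hy.le, Real.pi_gt_three]
    linarith
  calc _ ≤ ((1 + y⁻¹) * (1 + s * y)) ^ N * Real.exp (-(s * y)) := by gcongr
    _ ≤ (1 + y⁻¹) ^ N * (N.factorial * Real.exp (1 + s * y)) * Real.exp (-(s * y)) := by
        rw [mul_pow]; gcongr
    _ = N.factorial * Real.exp 1 * (1 + y⁻¹) ^ N * (Real.exp (s * y) * Real.exp (-(s * y))) := by
        rw [Real.exp_add]; ring
    _ = _ := by rw [← Real.exp_add]; simp

lemma exists_decay (hδ : 0 < δ) (h : RapidWeight δ μ w z) (N : ℕ) :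
    ∃ C, ∀ s : ℝ, 0 ≤ s → (1 + s) ^ N * ‖gaussMix μ w z s‖ ≤ C := by
  refine ⟨∫ v, N.factorial * Real.exp 1 * (‖w v‖ * (1 + ‖z v‖ + (z v).im⁻¹) ^ N *
    Real.exp (Real.pi * δ * (z v).im)) ∂μ, fun s hs => ?_⟩
  have h0 : (1 + s) ^ N * ‖gaussMix μ w z s‖ = ‖∫ v, ((1 + s : ℝ) : ℂ) ^ N *
      (w v * Complex.exp (Real.pi * Complex.I * s * z v)) ∂μ‖ := by
    rw [integral_const_mul, norm_mul, norm_pow, Complex.norm_real,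
      Real.norm_of_nonneg (by positivity)]
    rfl
  rw [h0]
  refine norm_integral_le_of_norm_le ((h.int N).const_mul _) ?_
  filter_upwards [h.im_pos] with v hv
  have h1 : 0 < (z v).im⁻¹ := inv_pos.2 hv
  have h2 := norm_nonneg (z v)
  rw [norm_mul, norm_mul, norm_pow, Complex.norm_real, Real.norm_of_nonneg (by positivity),
    norm_exp_pi_mul_I]
  simp only [Complex.ofReal_re, Complex.ofReal_im, zero_mul, add_zero]
  calc _ = ‖w v‖ * ((1 + s) ^ N * Real.exp (-(Real.pi * (s * (z v).im)))) := by ring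
    _ ≤ ‖w v‖ * (N.factorial * Real.exp 1 * (1 + ((z v).im)⁻¹) ^ N) :=
        mul_le_mul_of_nonneg_left (one_add_pow_mul_exp_le hs hv N) (norm_nonneg _)
    _ ≤ ‖w v‖ * (N.factorial * Real.exp 1 * (1 + ‖z v‖ + ((z v).im)⁻¹) ^ N) := by
        gcongr
        linarith
    _ = N.factorial * Real.exp 1 * (‖w v‖ * (1 + ‖z v‖ + ((z v).im)⁻¹) ^ N * 1) := by ring
    _ ≤ _ := by
        gcongr
        rw [← Real.exp_zero]
        have := Real.pi_pos
        gcongr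
        positivity

/-- A rapidly decaying superposition of Gaussians is a Schwartz function. -/
theorem exists_schwartzMap {E : Type*} [NormedAddCommGroup E] [InnerProductSpace ℝ E]
    (hδ : 0 < δ) (h : RapidWeight δ μ w z) :
    ∃ f : 𝓢(E, ℂ), ∀ x, f x = gaussMix μ w z ((‖x‖ ^ 2 : ℝ) : ℂ) := by
  have hD : ∀ (j : ℕ) (s : ℝ), -δ < s → HasDerivAt
      (fun t : ℝ => gaussMix μ (fun v => w v * (Real.pi * Complex.I * z v) ^ j) z t)
      (gaussMix μ (fun v => w v * (Real.pi * Complex.I * z v) ^ (j + 1)) z s) s := by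
    intro j s hs
    have := ((h.iterate j).hasDerivAt (s := (s : ℂ)) (by simpa using hs)).comp_ofReal
    simpa only [pow_succ, mul_assoc] using this
  obtain ⟨f, hf⟩ := exists_schwartzMap_comp_norm_sq (E := E) (δ := δ) hδ
    (D := fun j (s : ℝ) => gaussMix μ (fun v => w v * (Real.pi * Complex.I * z v) ^ j) z s)
    hD (fun j N => (h.iterate j).exists_decay hδ N)
  exact ⟨f, fun x => by simpa using hf x⟩

end RapidWeight

lemma integrable_exp_neg_mul_norm_sq {V : Type*} [NormedAddCommGroup V] [InnerProductSpace ℝ V]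
    [FiniteDimensional ℝ V] [MeasurableSpace V] [BorelSpace V] {b : ℝ} (hb : 0 < b) :
    Integrable (fun v : V => Real.exp (-b * ‖v‖ ^ 2)) := by
  have := (GaussianFourier.integrable_cexp_neg_mul_sq_norm_add (V := V) (b := b)
    (by simpa using hb) 0 0).norm
  refine this.congr (Eventually.of_forall fun v => ?_)
  simp only [Complex.norm_exp]
  congr 1
  simp [← Complex.ofReal_pow]

/-- The Fourier transform of a superposition of Gaussians, in even dimension. -/
theorem RapidWeight.fourier_gaussMix {E : Type*} [NormedAddCommGroup E] [InnerProductSpace ℝ E]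
    [FiniteDimensional ℝ E] [MeasurableSpace E] [BorelSpace E]
    {δ : ℝ} {μ : Measure ℝ} [SFinite μ] {w z : ℝ → ℂ}
    {k : ℕ} (hd : Module.finrank ℝ E = 2 * k) (hδ : 0 < δ) (h : RapidWeight δ μ w z) (y : E) :
    𝓕 (fun x : E => gaussMix μ w z ((‖x‖ ^ 2 : ℝ) : ℂ)) y =
      gaussMix μ (fun v => w v * (Complex.I / z v) ^ k) (fun v => -1 / z v)
        ((‖y‖ ^ 2 : ℝ) : ℂ) := by
  rw [Real.fourier_eq']
  have hnorm : ∀ (x : E) (v : ℝ), ‖w v * Complex.exp (Real.pi * Complex.I *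
      ((‖x‖ ^ 2 : ℝ) : ℂ) * z v)‖ = ‖w v‖ * Real.exp (-(Real.pi * (z v).im) * ‖x‖ ^ 2) := by
    intro x v
    rw [norm_mul, norm_exp_pi_mul_I]
    simp only [Complex.ofReal_re, Complex.ofReal_im, zero_mul, add_zero]
    congr 2; ring
  have hint : Integrable (Function.uncurry fun (x : E) (v : ℝ) =>
      Complex.exp (((-2 * Real.pi * inner ℝ x y : ℝ) : ℂ) * Complex.I) *
      (w v * Complex.exp (Real.pi * Complex.I * ((‖x‖ ^ 2 : ℝ) : ℂ) * z v)))
      (volume.prod μ) := by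
    have hm : AEStronglyMeasurable (Function.uncurry fun (x : E) (v : ℝ) =>
        Complex.exp (((-2 * Real.pi * inner ℝ x y : ℝ) : ℂ) * Complex.I) *
        (w v * Complex.exp (Real.pi * Complex.I * ((‖x‖ ^ 2 : ℝ) : ℂ) * z v)))
        ((volume : Measure E).prod μ) := by
      refine AEStronglyMeasurable.mul ?_ (AEStronglyMeasurable.mul ?_ ?_)
      · refine Continuous.aestronglyMeasurable ?_
        fun_prop
      · exact h.meas_w.comp_snd
      · refine Complex.continuous_exp.comp_aestronglyMeasurable (AEStronglyMeasurable.mul ?_ ?_)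
        · refine Continuous.aestronglyMeasurable ?_
          fun_prop
        · exact h.meas_z.comp_snd
    rw [integrable_prod_iff' hm]
    have hn : ∀ (x : E) (v : ℝ), ‖Complex.exp (((-2 * Real.pi * inner ℝ x y : ℝ) : ℂ) * Complex.I) *
        (w v * Complex.exp (Real.pi * Complex.I * ((‖x‖ ^ 2 : ℝ) : ℂ) * z v))‖ =
        ‖w v‖ * Real.exp (-(Real.pi * (z v).im) * ‖x‖ ^ 2) := by
      intro x v
      rw [norm_mul, Complex.norm_exp_ofReal_mul_I, one_mul, hnorm]
    constructor
    · filter_upwards [h.im_pos] with v hv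
      have hp : 0 < Real.pi * (z v).im := mul_pos Real.pi_pos hv
      refine Integrable.mono' ((integrable_exp_neg_mul_norm_sq (V := E) hp).const_mul ‖w v‖) ?_ ?_
      · refine Continuous.aestronglyMeasurable ?_
        simp only [Function.uncurry]
        fun_prop
      · refine Eventually.of_forall fun x => ?_
        exact (hn x v).le
    -- In dimension 2k the Gaussian has integral (Im z)⁻ᵏ, which the k-th condition of `RapidWeight`
    -- absorbs.
    · refine (h.int k).mono' ?_ ?_
      · exact (hm.norm.prod_swap).integral_prod_right'
      · filter_upwards [h.im_pos] with v hv
        have hp : 0 < Real.pi * (z v).im := mul_pos Real.pi_pos hv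
        simp only [Function.uncurry_apply_pair, hn]
        rw [integral_const_mul, GaussianFourier.integral_rexp_neg_mul_sq_norm hp, hd]
        have h1 : ((2 * k : ℕ) : ℝ) / 2 = k := by push_cast; ring
        have h2 : Real.pi / (Real.pi * (z v).im) = (z v).im⁻¹ := by
          field_simp [Real.pi_ne_zero]
        have h3 : 0 < (z v).im⁻¹ := inv_pos.2 hv
        rw [h1, Real.rpow_natCast, h2, Real.norm_of_nonneg (by positivity)]
        have h4 : 1 ≤ Real.exp (Real.pi * δ * (z v).im) := Real.one_le_exp (by positivity)
        calc ‖w v‖ * (z v).im⁻¹ ^ k = ‖w v‖ * (z v).im⁻¹ ^ k * 1 := by ring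
          _ ≤ _ := by
            gcongr
            linarith [norm_nonneg (z v)]
  have hswap := integral_integral_swap hint
  calc _ = ∫ x : E, ∫ v, Complex.exp (((-2 * Real.pi * inner ℝ x y : ℝ) : ℂ) * Complex.I) *
      (w v * Complex.exp (Real.pi * Complex.I * ((‖x‖ ^ 2 : ℝ) : ℂ) * z v)) ∂μ := by
        simp only [gaussMix, smul_eq_mul, integral_const_mul]
    _ = _ := hswap
    _ = _ := by
        refine integral_congr_ae ?_
        filter_upwards [h.im_pos] with v hv
        have hz0 : z v ≠ 0 := fun h0 => by simp [h0] at hv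
        have hb : 0 < (-(Real.pi * Complex.I * z v)).re := by
          simp
          exact mul_pos Real.pi_pos hv
        have hg := fourier_gaussian_innerProductSpace (V := E) hb y
        rw [Real.fourier_eq', hd] at hg
        have e1 : (((2 * k : ℕ) : ℂ) / 2) = (k : ℂ) := by push_cast; ring
        rw [e1, Complex.cpow_natCast] at hg
        have e2 : (Real.pi : ℂ) / -(Real.pi * Complex.I * z v) = Complex.I / z v := by
          have : (Real.pi : ℂ) ≠ 0 := by exact_mod_cast Real.pi_ne_zero
          rw [div_eq_div_iff (by simp [this, hz0]) hz0]
          linear_combination (Real.pi : ℂ) * z v * Complex.I_sq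
        rw [e2] at hg
        have e3 : (-(Real.pi : ℂ) ^ 2 * (‖y‖ : ℂ) ^ 2 / -(Real.pi * Complex.I * z v)) =
            Real.pi * Complex.I * ((‖y‖ ^ 2 : ℝ) : ℂ) * (-1 / z v) := by
          have : (Real.pi : ℂ) ≠ 0 := by exact_mod_cast Real.pi_ne_zero
          push_cast
          field_simp
          linear_combination (‖y‖ : ℂ) ^ 2 * Complex.I_sq
        rw [e3] at hg
        rw [mul_assoc, ← hg, ← integral_const_mul]
        congr 1
        ext x
        simp only [smul_eq_mul]
        push_cast
        have e4 : -(-(↑Real.pi * Complex.I * z v)) * (‖x‖ : ℂ) ^ 2 =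
          ↑Real.pi * Complex.I * (‖x‖ : ℂ) ^ 2 * z v := by ring
        rw [e4]
        ring

end GaussianMixture

/-! ### Primitives on the upper half-plane and their limits at i∞. -/

section Contour

/-- A holomorphic function on the upper half-plane has a primitive. -/
lemma exists_primitive_im_pos {p : ℂ → ℂ} (hp : DifferentiableOn ℂ p {z | 0 < z.im}) :
    ∃ P : ℂ → ℂ, ∀ z, 0 < z.im → HasDerivAt P (p z) z := by
  have hopen : IsOpen {z : ℂ | 0 < z.im} := isOpen_lt continuous_const Complex.continuous_im
  have hconv : Convex ℝ {z : ℂ | 0 < z.im} := convex_halfSpace_im_gt 0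
  set T : ℂ →L[ℂ] (ℂ →L[ℂ] ℂ) := ContinuousLinearMap.smulRightL ℂ ℂ ℂ (1 : ℂ →L[ℂ] ℂ)
  have hω : ∀ z ∈ {z : ℂ | 0 < z.im}, HasFDerivAt (fun z => T (p z))
      ((T.comp (ContinuousLinearMap.smulRight (1 : ℂ →L[ℂ] ℂ) (deriv p z))).restrictScalars ℝ)
      z := by
    intro z hz
    have h1 := (hp.differentiableAt (hopen.mem_nhds hz)).hasDerivAt.hasFDerivAt
    exact (T.hasFDerivAt.comp z h1).restrictScalars ℝ
  -- The derivative of the form p(z) dz is p'(z)xy, which is symmetric in x and y, so the form is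
  -- exact on the convex half-plane.
  obtain ⟨P, hP⟩ := hconv.exists_forall_hasFDerivAt_of_fderiv_symmetric (𝕜 := ℂ) hopen
    (ω := fun z => T (p z)) (fun z hz => (hω z hz).differentiableAt.differentiableWithinAt)
    (fun z hz x y => by
      rw [(hω z hz).fderiv]
      simp [T]
      ring)
  refine ⟨P, fun z hz => ?_⟩
  have := (hP z hz).hasDerivAt
  simpa [T] using this

/-- Exponential decay of `p` at `i∞` in the strip `|Re z| ≤ 1`. -/
def StripDecay (c : ℝ) (p : ℂ → ℂ) : Prop :=
  ∃ C Y : ℝ, ∀ z : ℂ, |z.re| ≤ 1 → Y ≤ z.im → ‖p z‖ ≤ C * Real.exp (-c * z.im)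

/-- Compactness of [v₀, Y] extends the decay above height Y to the whole ray, with one constant. -/
lemma StripDecay.exists_bound {c : ℝ} {p : ℂ → ℂ} (hdec : StripDecay c p)
    (hp : ContinuousOn p {z | 0 < z.im}) {a v₀ : ℝ} (ha : |a| ≤ 1) (hv₀ : 0 < v₀) :
    ∃ C, 0 ≤ C ∧ ∀ v : ℝ, v₀ ≤ v → ‖p (a + v * Complex.I)‖ ≤ C * Real.exp (-c * v) := by
  obtain ⟨C, Y, hC⟩ := hdec
  have hcont : ContinuousOn (fun v : ℝ => p (a + v * Complex.I) * Real.exp (c * v))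
      (Icc v₀ Y) := by
    refine ContinuousOn.mul (hp.comp (by fun_prop) ?_) (by fun_prop)
    intro v hv
    have : 0 < v := hv₀.trans_le hv.1
    simpa using this
  obtain ⟨B, hB⟩ := isCompact_Icc.exists_bound_of_continuousOn hcont
  refine ⟨max (max B C) 0, le_max_right _ _, fun v hv => ?_⟩
  have hexp : Real.exp (c * v) * Real.exp (-c * v) = 1 := by rw [← Real.exp_add]; simp
  by_cases h : v ≤ Y
  · have := hB v ⟨hv, h⟩
    rw [norm_mul, Complex.norm_real, Real.norm_of_nonneg (Real.exp_pos _).le] at this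
    calc ‖p (a + v * Complex.I)‖ = ‖p (a + v * Complex.I)‖ * Real.exp (c * v) *
          Real.exp (-c * v) := by rw [mul_assoc, hexp, mul_one]
      _ ≤ B * Real.exp (-c * v) := by gcongr
      _ ≤ _ := by gcongr; exact (le_max_left _ _).trans (le_max_left _ _)
  · have := hC (a + v * Complex.I) (by simpa using ha) (by simpa using (not_le.1 h).le)
    refine this.trans ?_
    simp only [Complex.add_im, Complex.ofReal_im, Complex.mul_im, Complex.ofReal_re,
      Complex.I_im, mul_one, Complex.I_re, mul_zero, add_zero, zero_add]
    gcongr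
    exact (le_max_right _ _).trans (le_max_left _ _)

lemma continuousOn_vertical {p : ℂ → ℂ} (hp : ContinuousOn p {z | 0 < z.im}) (a : ℝ) :
    ContinuousOn (fun v : ℝ => p (a + v * Complex.I)) (Ioi 0) := by
  refine hp.comp (by fun_prop) ?_
  intro v hv
  simpa using hv

lemma StripDecay.integrableOn {c : ℝ} (hc : 0 < c) {p : ℂ → ℂ} (hdec : StripDecay c p)
    (hp : ContinuousOn p {z | 0 < z.im}) {a v₀ : ℝ} (ha : |a| ≤ 1) (hv₀ : 0 < v₀) :
    IntegrableOn (fun v : ℝ => p (a + v * Complex.I)) (Ioi v₀) := by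
  obtain ⟨C, -, hC⟩ := hdec.exists_bound hp ha hv₀
  refine Integrable.mono' ((exp_neg_integrableOn_Ioi v₀ hc).const_mul C) ?_ ?_
  · exact ((continuousOn_vertical hp a).mono (Ioi_subset_Ioi hv₀.le)).aestronglyMeasurable
      measurableSet_Ioi
  · filter_upwards [ae_restrict_mem measurableSet_Ioi] with v hv using hC v (le_of_lt hv)

/-- A primitive of a function decaying exponentially at `i∞` has a limit along vertical lines,
independent of the line. -/
lemma StripDecay.exists_limit {c : ℝ} (hc : 0 < c) {P p : ℂ → ℂ} (hdec : StripDecay c p)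
    (hp : ContinuousOn p {z | 0 < z.im}) (hP : ∀ z, 0 < z.im → HasDerivAt P (p z) z) :
    ∃ L, ∀ a : ℝ, |a| ≤ 1 →
      Tendsto (fun v : ℝ => P (a + v * Complex.I)) atTop (𝓝 L) ∧
      ∀ v₀ : ℝ, 0 < v₀ → ∫ v in Ioi v₀, Complex.I * p (a + v * Complex.I) =
        L - P (a + v₀ * Complex.I) := by
  have hd : ∀ a v : ℝ, 0 < v → HasDerivAt (fun v : ℝ => P (a + v * Complex.I))
      (Complex.I * p (a + v * Complex.I)) v := by
    intro a v hv
    have h1 : HasDerivAt (fun t : ℂ => (a : ℂ) + t * Complex.I) Complex.I (v : ℂ) := by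
      simpa using ((hasDerivAt_id (v : ℂ)).mul_const Complex.I).const_add (a : ℂ)
    have h2 : 0 < ((a : ℂ) + v * Complex.I).im := by simpa using hv
    have := ((hP _ h2).comp (v : ℂ) h1).comp_ofReal
    simpa [mul_comm, Function.comp_def] using this
  have h0 : |(0 : ℝ)| ≤ 1 := by simp
  have hi : ∀ a : ℝ, |a| ≤ 1 → ∀ v₀ : ℝ, 0 < v₀ →
      IntegrableOn (fun v : ℝ => Complex.I * p (a + v * Complex.I)) (Ioi v₀) := fun a ha v₀ hv₀ =>
    (hdec.integrableOn hc hp ha hv₀).const_mul _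
  have hlim := tendsto_limUnder_of_hasDerivAt_of_integrableOn_Ioi
    (fun v hv => hd 0 v (zero_lt_one.trans hv)) (hi 0 h0 1 one_pos)
  refine ⟨limUnder atTop fun v : ℝ => P ((0 : ℝ) + v * Complex.I), fun a ha => ?_⟩
  have ht : Tendsto (fun v : ℝ => P (a + v * Complex.I)) atTop
      (𝓝 (limUnder atTop fun v : ℝ => P ((0 : ℝ) + v * Complex.I))) := by
    obtain ⟨C, Y, hC⟩ := hdec
    -- At height v the points of the two lines are joined by a horizontal segment of length at most
    -- 1 on which |p| ≤ C e^{-cv}. By the mean value inequality both lines have the same limit.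
    have hz : Tendsto (fun v : ℝ => P (a + v * Complex.I) - P ((0 : ℝ) + v * Complex.I)) atTop
        (𝓝 0) := by
      have hb : Tendsto (fun v : ℝ => C * Real.exp (-c * v)) atTop (𝓝 0) := by
        have : Tendsto (fun v : ℝ => Real.exp (-c * v)) atTop (𝓝 0) :=
          Real.tendsto_exp_atBot.comp
            ((tendsto_const_mul_atBot_of_neg (neg_lt_zero.2 hc)).2 tendsto_id)
        simpa using this.const_mul C
      refine squeeze_zero_norm' ?_ hb
      filter_upwards [eventually_ge_atTop Y, eventually_gt_atTop 0] with v hv hv0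
      set s : Set ℂ := {z | |z.re| ≤ 1 ∧ z.im = v} with hs
      have hsc : Convex ℝ s := by
        have h1 : s = (Complex.reCLM ⁻¹' Icc (-1) 1) ∩ (Complex.imCLM ⁻¹' {v}) := by
          ext z; simp [hs, abs_le]
        rw [h1]
        exact ((convex_Icc _ _).is_linear_preimage Complex.reCLM.isLinear).inter
          ((convex_singleton _).is_linear_preimage Complex.imCLM.isLinear)
      have hbd := hsc.norm_image_sub_le_of_norm_hasDerivWithin_le (𝕜 := ℂ) (f := P) (f' := p)
        (C := C * Real.exp (-c * v)) (x := (0 : ℝ) + v * Complex.I) (y := a + v * Complex.I)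
        (fun z hz => (hP z (by rw [hz.2]; exact hv0)).hasDerivWithinAt)
        (fun z hz => by
          have := hC z hz.1 (by rw [hz.2]; exact hv)
          rwa [hz.2] at this) (by simp [hs]) (by simpa [hs] using ha)
      refine hbd.trans ?_
      have hC0 : 0 ≤ C * Real.exp (-c * v) := by
        have := hC (a + v * Complex.I) (by simpa using ha) (by simpa using hv)
        simpa using (norm_nonneg _).trans this
      have : ‖(a + v * Complex.I : ℂ) - ((0 : ℝ) + v * Complex.I)‖ ≤ 1 := by
        simpa using ha
      calc _ ≤ C * Real.exp (-c * v) * 1 := by gcongr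
        _ = _ := mul_one _
    simpa using hz.add hlim
  exact ⟨ht, fun v₀ hv₀ => integral_Ioi_of_hasDerivAt_of_tendsto'
    (fun v hv => hd a v (hv₀.trans_le hv)) (hi a ha v₀ hv₀) ht⟩

end Contour

/-! ### Eigenfunctions of the Fourier transform from contour integrals. -/

section Eigenfunction

/-- The data from which an eigenfunction of the Fourier transform in dimension `2 (κ + 2)` is
built: `g` and `h` are exchanged up to the sign `ε` by the inversion `z ↦ -1/z` in weight `-κ`,
`h` is the half second difference of `g`, is (anti)periodic and decays at `i∞`. -/
structure ModularKernel (κ : ℕ) (ε : ℂ) (c : ℝ) (h g : ℂ → ℂ) : Prop where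
  even : Even κ
  sq : ε ^ 2 = 1
  pos : 0 < c
  hol : DifferentiableOn ℂ h {z | 0 < z.im}
  per : ∀ z, 0 < z.im → h (z + 1) = ε * h z
  decay : StripDecay c h
  eq_inv : ∀ z, 0 < z.im → g z = ε * z ^ κ * h (-1 / z)
  diff_two : ∀ z, 0 < z.im → g (z + 1) + g (z - 1) - 2 * g z = 2 * h z

/-- The weight along the arcs. -/
def arcWeight (κ : ℕ) (ε : ℂ) (h : ℂ → ℂ) (a v : ℝ) : ℂ :=
  Complex.I * ε * h (a + v * Complex.I) / (a + v * Complex.I) ^ (κ + 2)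

/-- The radial profile, as a function of `|x|²`, of the eigenfunction built from `h`. -/
def profile (κ : ℕ) (ε : ℂ) (h : ℂ → ℂ) (s : ℂ) : ℂ :=
  Complex.I / 4 *
    -- The four paths start at i and end at 1, -1, 0 and i∞. The first three are images of vertical
    -- half-lines under u ↦ b - 1/u; there the weight is g(-1/u) du/u², written through h.
    (-gaussMix (volume.restrict (Ioi (1 / 2))) (arcWeight κ ε h (1 / 2))
        (fun v => 1 - 1 / (((1 / 2 : ℝ) : ℂ) + v * Complex.I)) s
      - gaussMix (volume.restrict (Ioi (1 / 2))) (arcWeight κ ε h (-(1 / 2)))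
        (fun v => -1 - 1 / (((-(1 / 2) : ℝ) : ℂ) + v * Complex.I)) s
      + 2 * gaussMix (volume.restrict (Ioi 1)) (arcWeight κ ε h 0)
        (fun v => -1 / (((0 : ℝ) : ℂ) + v * Complex.I)) s
      + 2 * gaussMix (volume.restrict (Ioi 1))
        (fun v => Complex.I * h (((0 : ℝ) : ℂ) + v * Complex.I))
        (fun v => ((0 : ℝ) : ℂ) + v * Complex.I) s)

/-- With δ = c/(2π) the factor exp(πδ Im z) is at most e^{c(v+1)/2}. Half of the decay e^{-cv}
remains and beats the powers of v. -/
lemma rapidWeight_of_bound {v₀ c C K : ℝ} {w z : ℝ → ℂ} (hc : 0 < c)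
    (hw : ContinuousOn w (Ioi v₀)) (hz : ContinuousOn z (Ioi v₀))
    (hC : ∀ v, v₀ < v → ‖w v‖ ≤ C * Real.exp (-c * v))
    (hK : ∀ v, v₀ < v → |(z v).re| ≤ 1 ∧ 0 < (z v).im ∧ (z v).im ≤ v + 1 ∧
      1 + ‖z v‖ + (z v).im⁻¹ ≤ K * v) :
    RapidWeight (c / (2 * Real.pi)) (volume.restrict (Ioi v₀)) w z where
  meas_w := hw.aestronglyMeasurable measurableSet_Ioi
  meas_z := hz.aestronglyMeasurable measurableSet_Ioi
  re_le := by filter_upwards [ae_restrict_mem measurableSet_Ioi] with v hv using (hK v hv).1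
  im_pos := by filter_upwards [ae_restrict_mem measurableSet_Ioi] with v hv using (hK v hv).2.1
  int N := by
    have hint : IntegrableOn (fun v : ℝ => v ^ N * Real.exp (-(c / 2) * v)) (Ioi v₀) := by
      refine integrable_of_isBigO_exp_neg (b := c / 4) (by positivity) (by fun_prop) ?_
      have := (isLittleO_pow_exp_pos_mul_atTop N (b := c / 4) (by positivity)).isBigO.mul
        (Asymptotics.isBigO_refl (fun v : ℝ => Real.exp (-(c / 2) * v)) atTop)
      refine this.congr_right fun v => ?_
      rw [← Real.exp_add]
      congr 1; ring
    refine Integrable.mono' (hint.const_mul (C * K ^ N * Real.exp (c / 2))) ?_ ?_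
    · refine ContinuousOn.aestronglyMeasurable ?_ measurableSet_Ioi
      have him : ContinuousOn (fun v => (z v).im) (Ioi v₀) :=
        Complex.continuous_im.comp_continuousOn hz
      refine (hw.norm.mul (((continuousOn_const.add hz.norm).add
        (him.inv₀ fun v hv => (hK v hv).2.1.ne')).pow N)).mul
        (Real.continuous_exp.comp_continuousOn (continuousOn_const.mul him))
    · filter_upwards [ae_restrict_mem measurableSet_Ioi] with v hv
      obtain ⟨-, h1, h2, h3⟩ := hK v hv
      have h4 : 0 < (z v).im⁻¹ := inv_pos.2 h1
      have h5 := norm_nonneg (z v)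
      have h6 := hC v hv
      have hCp : 0 ≤ C * Real.exp (-c * v) := (norm_nonneg _).trans h6
      rw [Real.norm_of_nonneg (by positivity)]
      have h7 : Real.exp (Real.pi * (c / (2 * Real.pi)) * (z v).im) ≤
          Real.exp (c / 2 * (v + 1)) := by
        have : Real.pi * (c / (2 * Real.pi)) = c / 2 := by field_simp
        rw [this]
        gcongr
      have h8 : 0 ≤ K * v := le_trans (by positivity) h3
      calc _ ≤ (C * Real.exp (-c * v)) * (K * v) ^ N * Real.exp (c / 2 * (v + 1)) := by gcongr
        _ = C * K ^ N * v ^ N * (Real.exp (-c * v) * Real.exp (c / 2 * (v + 1))) := by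
            rw [mul_pow]; ring
        _ = C * K ^ N * v ^ N * (Real.exp (c / 2) * Real.exp (-(c / 2) * v)) := by
            rw [← Real.exp_add, ← Real.exp_add]; congr 2; ring
        _ = _ := by ring

namespace ModularKernel

variable {κ : ℕ} {ε : ℂ} {c : ℝ} {h g : ℂ → ℂ}

lemma norm_eps (H : ModularKernel κ ε c h g) : ‖ε‖ = 1 := by
  have := congrArg norm H.sq
  rw [norm_pow, norm_one] at this
  exact (pow_eq_one_iff_of_nonneg (norm_nonneg _) two_ne_zero).1 this

lemma exists_arcWeight_bound (H : ModularKernel κ ε c h g) {a v₀ : ℝ} (ha : |a| ≤ 1)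
    (hv₀ : 0 < v₀) : ∃ C, ∀ v, v₀ < v → ‖arcWeight κ ε h a v‖ ≤ C * Real.exp (-c * v) := by
  obtain ⟨C, hC0, hC⟩ := H.decay.exists_bound H.hol.continuousOn ha hv₀
  refine ⟨C / v₀ ^ (κ + 2), fun v hv => ?_⟩
  have hn : v₀ ≤ ‖(a + v * Complex.I : ℂ)‖ := by
    refine hv.le.trans ((le_abs_self v).trans ?_)
    simpa using Complex.abs_im_le_norm (a + v * Complex.I : ℂ)
  rw [arcWeight, norm_div, norm_mul, norm_mul, Complex.norm_I, H.norm_eps, norm_pow, one_mul,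
    one_mul, div_mul_eq_mul_div]
  gcongr
  exact hC v hv.le

lemma add_mul_I_ne_zero {a v : ℝ} (hv : 0 < v) : (a + v * Complex.I : ℂ) ≠ 0 := by
  intro h0
  have := congrArg Complex.im h0
  simp at this
  exact hv.ne' this

lemma continuousOn_arcWeight (H : ModularKernel κ ε c h g) (a : ℝ) :
    ContinuousOn (arcWeight κ ε h a) (Ioi 0) := by
  refine ((continuousOn_const.mul (continuousOn_vertical H.hol.continuousOn a))).div
    (by fun_prop) fun v hv => pow_ne_zero _ (add_mul_I_ne_zero hv)

lemma neg_inv_im {a v : ℝ} : (-1 / (a + v * Complex.I : ℂ)).im = v / (a ^ 2 + v ^ 2) := by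
  simp [Complex.normSq_apply, pow_two, neg_div]

lemma neg_inv_re {a v : ℝ} : (-1 / (a + v * Complex.I : ℂ)).re = -a / (a ^ 2 + v ^ 2) := by
  simp [Complex.div_re, Complex.normSq_apply, pow_two]

/-- Inversion gives Im z ≤ 2 and 1/Im z ≤ 2v, so the last sum is at most 4 + 2v; as v ≥ 1/2, the
constant 16 is more than enough. -/
lemma path_bound {v₀ : ℝ} (hv₀ : 0 < v₀) {a b v : ℝ} (hv : v₀ < v) (ha : |a| ≤ v₀)
    (hav : 1 / 2 ≤ a ^ 2 + v ^ 2)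
    {z : ℂ} (hz : z = b + -1 / (a + v * Complex.I)) (hre : |z.re| ≤ 1) (h1 : 1 / 2 ≤ v) :
    |z.re| ≤ 1 ∧ 0 < z.im ∧ z.im ≤ v + 1 ∧ 1 + ‖z‖ + z.im⁻¹ ≤ 16 * v := by
  have hvp : 0 < v := hv₀.trans hv
  have him : z.im = v / (a ^ 2 + v ^ 2) := by rw [hz, Complex.add_im, neg_inv_im]; simp
  have hpos : 0 < a ^ 2 + v ^ 2 := by linarith
  have hav2 : a ^ 2 ≤ v ^ 2 := by
    rw [← sq_abs a]; gcongr; linarith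
  have h3 : z.im ≤ 2 := by
    rw [him, div_le_iff₀ hpos]
    nlinarith [sq_nonneg (v - 1 / 2)]
  have him0 : 0 < z.im := by rw [him]; positivity
  have h2 : z.im ≤ v + 1 := by
    rw [him, div_le_iff₀ hpos]
    nlinarith
  have h4 : z.im⁻¹ ≤ 2 * v := by
    rw [him, inv_div, div_le_iff₀ hvp]
    nlinarith
  refine ⟨hre, him0, h2, ?_⟩
  have h5 : ‖z‖ ≤ 1 + 2 := by
    refine (Complex.norm_le_abs_re_add_abs_im z).trans ?_
    rw [abs_of_pos him0]
    linarith
  linarith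

lemma rapidWeight_arc (H : ModularKernel κ ε c h g) {a v₀ b : ℝ} (ha : |a| ≤ v₀) (ha1 : |a| ≤ 1)
    (hv₀ : 0 < v₀) (h2 : 1 / 2 ≤ v₀) (hav : 1 / 2 ≤ a ^ 2 + v₀ ^ 2)
    (hre : ∀ v, v₀ < v → |(b + -1 / (a + v * Complex.I) : ℂ).re| ≤ 1) :
    RapidWeight (c / (2 * Real.pi)) (volume.restrict (Ioi v₀)) (arcWeight κ ε h a)
      (fun v => b + -1 / (a + v * Complex.I)) := by
  obtain ⟨C, hC⟩ := H.exists_arcWeight_bound ha1 hv₀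
  refine rapidWeight_of_bound (K := 16) H.pos
    ((H.continuousOn_arcWeight a).mono (Ioi_subset_Ioi hv₀.le)) ?_ hC fun v hv => ?_
  · exact continuousOn_const.add (continuousOn_const.div (by fun_prop)
      fun v hv => add_mul_I_ne_zero (hv₀.trans hv))
  · refine path_bound hv₀ hv ha (hav.trans ?_) rfl (hre v hv) (h2.trans (le_of_lt hv))
    have : v₀ < v := hv
    gcongr

lemma rapidWeight_one (H : ModularKernel κ ε c h g) :
    RapidWeight (c / (2 * Real.pi)) (volume.restrict (Ioi (1 / 2))) (arcWeight κ ε h (1 / 2))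
      (fun v => 1 - 1 / (((1 / 2 : ℝ) : ℂ) + v * Complex.I)) := by
  have := H.rapidWeight_arc (a := 1 / 2) (v₀ := 1 / 2) (b := 1) (by norm_num [abs_of_pos])
    (by norm_num [abs_of_pos]) (by norm_num) le_rfl (by norm_num) fun v hv => ?_
  · convert this using 2 with v
    push_cast
    ring
  · rw [Complex.add_re, neg_inv_re, Complex.ofReal_re]
    have h0 : (1 / 2 : ℝ) < v := hv
    have hp : (0 : ℝ) < (1 / 2) ^ 2 + v ^ 2 := by positivity
    rw [abs_le]
    constructor
    · have : -1 ≤ -(1 / 2) / ((1 / 2) ^ 2 + v ^ 2) := by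
        rw [le_div_iff₀ hp]; nlinarith
      linarith
    · have : -(1 / 2) / ((1 / 2) ^ 2 + v ^ 2) ≤ 0 := div_nonpos_of_nonpos_of_nonneg
        (by norm_num) hp.le
      linarith

lemma rapidWeight_two (H : ModularKernel κ ε c h g) :
    RapidWeight (c / (2 * Real.pi)) (volume.restrict (Ioi (1 / 2))) (arcWeight κ ε h (-(1 / 2)))
      (fun v => -1 - 1 / (((-(1 / 2) : ℝ) : ℂ) + v * Complex.I)) := by
  have := H.rapidWeight_arc (a := -(1 / 2)) (v₀ := 1 / 2) (b := -1)
    (by rw [abs_neg]; norm_num [abs_of_pos])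
    (by rw [abs_neg]; norm_num [abs_of_pos]) (by norm_num) le_rfl (by norm_num) fun v hv => ?_
  · convert this using 2 with v
    push_cast
    ring
  · rw [Complex.add_re, neg_inv_re, Complex.ofReal_re]
    have h0 : (1 / 2 : ℝ) < v := hv
    have hp : (0 : ℝ) < (-(1 / 2)) ^ 2 + v ^ 2 := by positivity
    rw [abs_le]
    constructor
    · have : 0 ≤ -(-(1 / 2)) / ((-(1 / 2)) ^ 2 + v ^ 2) := by
        rw [neg_neg]; positivity
      linarith
    · have : -(-(1 / 2)) / ((-(1 / 2)) ^ 2 + v ^ 2) ≤ 1 := by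
        rw [div_le_iff₀ hp]; nlinarith
      linarith

lemma rapidWeight_three (H : ModularKernel κ ε c h g) :
    RapidWeight (c / (2 * Real.pi)) (volume.restrict (Ioi 1)) (arcWeight κ ε h 0)
      (fun v => -1 / (((0 : ℝ) : ℂ) + v * Complex.I)) := by
  have := H.rapidWeight_arc (a := 0) (v₀ := 1) (b := 0) (by simp) (by simp) (by norm_num)
    (by norm_num) (by norm_num) fun v hv => ?_
  · convert this using 2 with v
    simp
  · rw [Complex.add_re, neg_inv_re, Complex.ofReal_re]
    simp

lemma rapidWeight_four (H : ModularKernel κ ε c h g) :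
    RapidWeight (c / (2 * Real.pi)) (volume.restrict (Ioi 1))
      (fun v => Complex.I * h (((0 : ℝ) : ℂ) + v * Complex.I))
      (fun v => ((0 : ℝ) : ℂ) + v * Complex.I) := by
  obtain ⟨C, -, hC⟩ := H.decay.exists_bound H.hol.continuousOn (a := 0) (v₀ := 1) (by simp) one_pos
  refine rapidWeight_of_bound (C := C) (K := 3) H.pos
    (continuousOn_const.mul ((continuousOn_vertical H.hol.continuousOn 0).mono
      (Ioi_subset_Ioi zero_le_one))) (by fun_prop) (fun v hv => ?_) fun v hv => ?_
  · rw [norm_mul, Complex.norm_I, one_mul]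
    exact hC v hv.le
  · have hv0 : 0 < v := zero_lt_one.trans hv
    have : v⁻¹ ≤ 1 := inv_le_one_of_one_le₀ hv.le
    simp [abs_of_pos hv0]
    refine ⟨hv0, ?_⟩
    linarith

/-- The profile is holomorphic in a half-plane containing `0`. -/
lemma differentiableOn_profile (H : ModularKernel κ ε c h g) :
    DifferentiableOn ℂ (profile κ ε h) {s | -(c / (2 * Real.pi)) < s.re} := by
  intro s hs
  have d1 := (H.rapidWeight_one.hasDerivAt hs).differentiableAt
  have d2 := (H.rapidWeight_two.hasDerivAt hs).differentiableAt
  have d3 := (H.rapidWeight_three.hasDerivAt hs).differentiableAt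
  have d4 := (H.rapidWeight_four.hasDerivAt hs).differentiableAt
  exact (((((d1.neg).sub d2).add (d3.const_mul 2)).add (d4.const_mul 2)).const_mul
    (Complex.I / 4)).differentiableWithinAt

lemma inv_two_pi_pos (H : ModularKernel κ ε c h g) : 0 < c / (2 * Real.pi) :=
  div_pos H.pos (by positivity)

lemma gaussMix_congr {μ : Measure ℝ} {w z w' z' : ℝ → ℂ} (h : ∀ᵐ v ∂μ, w v = w' v ∧ z v = z' v)
    (s : ℂ) : gaussMix μ w z s = gaussMix μ w' z' s := by
  refine integral_congr_ae ?_
  filter_upwards [h] with v hv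
  rw [hv.1, hv.2]

lemma gaussMix_const_mul {μ : Measure ℝ} {w z : ℝ → ℂ} (C s : ℂ) :
    gaussMix μ (fun v => C * w v) z s = C * gaussMix μ w z s := by
  simp only [gaussMix, mul_assoc, integral_const_mul]

/-- The eigenfunction of the Fourier transform built from a modular kernel. -/
theorem exists_eigenfunction {E : Type*} [NormedAddCommGroup E] [InnerProductSpace ℝ E]
    [FiniteDimensional ℝ E] [MeasurableSpace E] [BorelSpace E]
    (H : ModularKernel κ ε c h g) (hE : Module.finrank ℝ E = 2 * (κ + 2)) :
    ∃ f : 𝓢(E, ℂ), (∀ x, f x = profile κ ε h ((‖x‖ ^ 2 : ℝ) : ℂ)) ∧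
      ∀ y, 𝓕 (f : E → ℂ) y = ε * Complex.I ^ (κ + 2) * f y := by
  have hδ := H.inv_two_pi_pos
  obtain ⟨f₁, h₁⟩ := H.rapidWeight_one.exists_schwartzMap (E := E) hδ
  obtain ⟨f₂, h₂⟩ := H.rapidWeight_two.exists_schwartzMap (E := E) hδ
  obtain ⟨f₃, h₃⟩ := H.rapidWeight_three.exists_schwartzMap (E := E) hδ
  obtain ⟨f₄, h₄⟩ := H.rapidWeight_four.exists_schwartzMap (E := E) hδ
  have hk : Even (κ + 2) := H.even.add even_two
  have hε : ε * ε = 1 := by rw [← pow_two]; exact H.sq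
  -- With Re u = -1/2 the points of the path to 1 are z = u/(u + 1), and -1/z = -1 - 1/u runs along
  -- the path to -1. The weights match because h(u + 1) = ε h(u).
  have F₁ : 𝓕 f₁ = (ε * Complex.I ^ (κ + 2)) • f₂ := by
    ext y
    rw [SchwartzMap.fourier_coe, show (f₁ : E → ℂ) = _ from funext h₁,
      H.rapidWeight_one.fourier_gaussMix hE hδ, _root_.smul_apply, h₂, smul_eq_mul,
      ← gaussMix_const_mul]
    refine gaussMix_congr ?_ _
    filter_upwards [ae_restrict_mem measurableSet_Ioi] with v hv
    have hv0 : 0 < v := lt_trans (by norm_num) hv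
    have n1 := add_mul_I_ne_zero (a := 1 / 2) hv0
    have n2 := add_mul_I_ne_zero (a := -(1 / 2)) hv0
    have e1 : (((1 / 2 : ℝ) : ℂ) + v * Complex.I) = ((-(1 / 2) : ℝ) : ℂ) + v * Complex.I + 1 := by
      push_cast; ring
    rw [arcWeight, arcWeight, e1, H.per _ (by simpa using hv0)]
    rw [e1] at n1
    set u : ℂ := ((-(1 / 2) : ℝ) : ℂ) + v * Complex.I
    have e2 : 1 - 1 / (u + 1) = u / (u + 1) := by field_simp; ring
    rw [e2]
    constructor
    · rw [div_div_eq_mul_div, div_pow, mul_pow]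
      field_simp
    · field_simp
      ring
  have F₂ : 𝓕 f₂ = (ε * Complex.I ^ (κ + 2)) • f₁ := by
    ext y
    rw [SchwartzMap.fourier_coe, show (f₂ : E → ℂ) = _ from funext h₂,
      H.rapidWeight_two.fourier_gaussMix hE hδ, _root_.smul_apply, h₁, smul_eq_mul,
      ← gaussMix_const_mul]
    refine gaussMix_congr ?_ _
    filter_upwards [ae_restrict_mem measurableSet_Ioi] with v hv
    have hv0 : 0 < v := lt_trans (by norm_num) hv
    have n1 := add_mul_I_ne_zero (a := 1 / 2) hv0
    have n2 := add_mul_I_ne_zero (a := -(1 / 2)) hv0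
    have e1 : (((1 / 2 : ℝ) : ℂ) + v * Complex.I) = ((-(1 / 2) : ℝ) : ℂ) + v * Complex.I + 1 := by
      push_cast; ring
    rw [arcWeight, arcWeight, e1, H.per _ (by simpa using hv0)]
    rw [e1] at n1
    set u : ℂ := ((-(1 / 2) : ℝ) : ℂ) + v * Complex.I
    have e2 : -1 - 1 / u = -((u + 1) / u) := by field_simp; ring
    rw [e2]
    constructor
    · rw [div_neg, hk.neg_pow, div_div_eq_mul_div, div_pow, mul_pow]
      field_simp
      linear_combination (-ε * h u) * hε
    · field_simp
      ring
  -- Inversion exchanges the segment from i to 0 with the ray from i to i∞.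
  have F₃ : 𝓕 f₃ = (ε * Complex.I ^ (κ + 2)) • f₄ := by
    ext y
    rw [SchwartzMap.fourier_coe, show (f₃ : E → ℂ) = _ from funext h₃,
      H.rapidWeight_three.fourier_gaussMix hE hδ, _root_.smul_apply, h₄, smul_eq_mul,
      ← gaussMix_const_mul]
    refine gaussMix_congr ?_ _
    filter_upwards [ae_restrict_mem measurableSet_Ioi] with v hv
    have n1 := add_mul_I_ne_zero (a := 0) (lt_trans zero_lt_one hv)
    rw [arcWeight]
    set u : ℂ := ((0 : ℝ) : ℂ) + v * Complex.I
    constructor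
    · rw [neg_div, div_neg, hk.neg_pow, div_div_eq_mul_div, div_one, mul_pow]
      field_simp
    · field_simp
  have F₄ : 𝓕 f₄ = (ε * Complex.I ^ (κ + 2)) • f₃ := by
    ext y
    rw [SchwartzMap.fourier_coe, show (f₄ : E → ℂ) = _ from funext h₄,
      H.rapidWeight_four.fourier_gaussMix hE hδ, _root_.smul_apply, h₃, smul_eq_mul,
      ← gaussMix_const_mul]
    refine gaussMix_congr ?_ _
    filter_upwards [ae_restrict_mem measurableSet_Ioi] with v hv
    have n1 := add_mul_I_ne_zero (a := 0) (lt_trans zero_lt_one hv)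
    rw [arcWeight]
    set u : ℂ := ((0 : ℝ) : ℂ) + v * Complex.I
    refine ⟨?_, rfl⟩
    rw [div_pow]
    field_simp
    linear_combination (-h u) * hε
  refine ⟨(Complex.I / 4) • (-f₁ + -f₂ + (2 : ℂ) • f₃ + (2 : ℂ) • f₄), fun x => ?_, fun y => ?_⟩
  · simp [h₁, h₂, h₃, h₄, profile]
    ring
  · rw [← SchwartzMap.fourier_coe]
    simp only [FourierTransform.fourier_add, FourierTransform.fourier_smul,
      FourierTransform.fourier_neg, F₁, F₂, F₃, F₄]
    simp
    ring

end ModularKernel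

end Eigenfunction

/-! ### The Laplace representation of the profile. -/

section ContourShift

namespace ModularKernel

variable {κ : ℕ} {ε : ℂ} {c : ℝ} {h g : ℂ → ℂ}

lemma neg_inv_im_pos {z : ℂ} (hz : 0 < z.im) : 0 < (-1 / z).im := by
  have := neg_inv_im (a := z.re) (v := z.im)
  rw [Complex.re_add_im] at this
  rw [this]
  positivity

lemma ne_zero_of_im_pos {z : ℂ} (hz : 0 < z.im) : z ≠ 0 := fun h0 => by simp [h0] at hz

lemma apply_neg_inv (H : ModularKernel κ ε c h g) {u : ℂ} (hu : 0 < u.im) :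
    g (-1 / u) = ε * h u / u ^ κ := by
  have h0 := ne_zero_of_im_pos hu
  rw [H.eq_inv _ (neg_inv_im_pos hu), neg_div, H.even.neg_pow]
  have : -1 / -(1 / u) = u := by field_simp
  rw [this, div_pow, one_pow]
  ring

lemma differentiableOn (H : ModularKernel κ ε c h g) : DifferentiableOn ℂ g {z | 0 < z.im} := by
  have : DifferentiableOn ℂ (fun z => ε * z ^ κ * h (-1 / z)) {z | 0 < z.im} := by
    refine DifferentiableOn.mul (by fun_prop) (H.hol.comp ?_ fun z hz => neg_inv_im_pos hz)
    exact (differentiableOn_const _).div differentiableOn_id fun z hz => ne_zero_of_im_pos hz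
  exact this.congr fun z hz => H.eq_inv z hz

lemma arcWeight_eq (H : ModularKernel κ ε c h g) (a : ℝ) {v : ℝ} (hv : 0 < v) :
    arcWeight κ ε h a v =
      Complex.I * (g (-1 / (a + v * Complex.I)) / (a + v * Complex.I) ^ 2) := by
  have h0 := add_mul_I_ne_zero (a := a) hv
  rw [H.apply_neg_inv (by simpa using hv), arcWeight, pow_add]
  field_simp

/-- Here g(it) = ε (it)^κ h(i/t), and i/t has imaginary part at least 1, where h is bounded. -/
lemma exists_bound_near_zero (H : ModularKernel κ ε c h g) :
    ∃ C, ∀ t : ℝ, t ∈ Ioc 0 1 → ‖g (t * Complex.I)‖ ≤ C := by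
  obtain ⟨C, hC0, hC⟩ := H.decay.exists_bound H.hol.continuousOn (a := 0) (v₀ := 1)
    (by simp) one_pos
  refine ⟨C, fun t ht => ?_⟩
  have hti : 1 ≤ t⁻¹ := (one_le_inv₀ ht.1).2 ht.2
  have h1 := hC t⁻¹ hti
  have h2 : (-1 / (t * Complex.I) : ℂ) = ((0 : ℝ) : ℂ) + (t⁻¹ : ℝ) * Complex.I := by
    have : (t : ℂ) ≠ 0 := by exact_mod_cast ht.1.ne'
    push_cast
    field_simp
    simp
  rw [H.eq_inv _ (by simpa using ht.1), h2, norm_mul, norm_mul, H.norm_eps, one_mul, norm_pow,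
    norm_mul, Complex.norm_I, mul_one, Complex.norm_real, Real.norm_of_nonneg ht.1.le]
  have h3 : t ^ κ ≤ 1 := pow_le_one₀ ht.1.le ht.2
  have h5 : Real.exp (-c * t⁻¹) ≤ 1 := by
    rw [Real.exp_le_one_iff]
    have := mul_pos H.pos (inv_pos.2 ht.1)
    linarith
  calc _ ≤ 1 * (C * Real.exp (-c * t⁻¹)) := by
        have := ht.1
        gcongr
    _ ≤ 1 * (C * 1) := by gcongr
    _ = C := by ring

/-- The profile as a Laplace transform along the imaginary axis. -/
theorem profile_eq_laplace (H : ModularKernel κ ε c h g) {s c' : ℝ} (hs : 0 ≤ s) (hc' : 0 < c')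
    (hg : StripDecay c' fun z => g z * Complex.exp (Real.pi * Complex.I * s * z)) :
    IntegrableOn (fun t : ℝ => g (t * Complex.I) * Real.exp (-Real.pi * s * t)) (Ioi 0) ∧
    profile κ ε h s = Complex.sin (Real.pi * s / 2) ^ 2 *
      ∫ t in Ioi (0 : ℝ), g (t * Complex.I) * Real.exp (-Real.pi * s * t) := by
  set G : ℂ → ℂ := fun z => g z * Complex.exp (Real.pi * Complex.I * s * z) with hG
  have hGd : DifferentiableOn ℂ G {z | 0 < z.im} := H.differentiableOn.mul (by fun_prop)
  have hGc := hGd.continuousOn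
  obtain ⟨P, hP⟩ := exists_primitive_im_pos hGd
  obtain ⟨L, hL⟩ := hg.exists_limit hc' hGc hP
  -- The coordinate u = -1/z moves the endpoint 0 to i∞; q is the integrand G(z) dz in this
  -- coordinate, with primitive P(-1/u).
  set q : ℂ → ℂ := fun u => G (-1 / u) / u ^ 2 with hq
  have hqc : ContinuousOn q {z | 0 < z.im} := by
    refine ContinuousOn.div (hGc.comp ?_ fun z hz => neg_inv_im_pos hz) (by fun_prop)
      fun z hz => pow_ne_zero _ (ne_zero_of_im_pos hz)
    exact continuousOn_const.div continuousOn_id fun z hz => ne_zero_of_im_pos hz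
  have hQ : ∀ z, 0 < z.im → HasDerivAt (fun u => P (-1 / u)) (q z) z := by
    intro z hz
    have h0 := ne_zero_of_im_pos hz
    have h1 : HasDerivAt (fun u : ℂ => -1 / u) (1 / z ^ 2) z := by
      have := (hasDerivAt_inv h0).neg
      refine (this.congr_of_eventuallyEq (Eventually.of_forall fun u => ?_)).congr_deriv ?_
      · simp [neg_div]
      · simp
    have := (hP _ (neg_inv_im_pos hz)).comp z h1
    refine this.congr_deriv ?_
    simp [q, div_eq_mul_inv]
  have hqd : StripDecay c q := by
    obtain ⟨C, Y, hC⟩ := H.decay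
    refine ⟨C, max Y 1, fun z hz hz' => ?_⟩
    have him : 1 ≤ z.im := (le_max_right _ _).trans hz'
    have hpos : 0 < z.im := zero_lt_one.trans_le him
    refine le_trans ?_ (hC z hz ((le_max_left _ _).trans hz'))
    have hn : 1 ≤ ‖z‖ := him.trans ((le_abs_self _).trans (Complex.abs_im_le_norm z))
    have he : ‖Complex.exp (Real.pi * Complex.I * s * (-1 / z))‖ ≤ 1 := by
      rw [norm_exp_pi_mul_I, ← Real.exp_zero]
      simp only [Complex.ofReal_re, Complex.ofReal_im, zero_mul, add_zero, Real.exp_zero]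
      rw [Real.exp_le_one_iff]
      have := neg_inv_im_pos hpos
      have := Real.pi_pos
      have : 0 ≤ Real.pi * (s * (-1 / z).im) := by positivity
      linarith
    simp only [hq, hG]
    rw [H.apply_neg_inv hpos, norm_div, norm_mul, norm_div, norm_mul, H.norm_eps, norm_pow,
      norm_pow, one_mul]
    have a1 : 1 ≤ ‖z‖ ^ κ := one_le_pow₀ hn
    have a2 : 1 ≤ ‖z‖ ^ 2 := one_le_pow₀ hn
    calc ‖h z‖ / ‖z‖ ^ κ * ‖Complex.exp (Real.pi * Complex.I * s * (-1 / z))‖ / ‖z‖ ^ 2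
        ≤ ‖h z‖ / ‖z‖ ^ κ * ‖Complex.exp (Real.pi * Complex.I * s * (-1 / z))‖ :=
          div_le_self (by positivity) a2
      _ ≤ ‖h z‖ / ‖z‖ ^ κ * 1 := by gcongr
      _ ≤ ‖h z‖ := by rw [mul_one]; exact div_le_self (by positivity) a1
  -- The limit L₀ does not depend on the vertical line in u, so it serves all three arcs, which up
  -- to translation are images of different vertical lines.
  obtain ⟨L₀, hL₀⟩ := hqd.exists_limit H.pos hqc hQ
  have hI : ∀ t : ℝ, 0 < t → G (t * Complex.I) =
      g (t * Complex.I) * Real.exp (-Real.pi * s * t) := by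
    intro t _
    simp only [hG]
    rw [show (Real.pi * Complex.I * s * (t * Complex.I) : ℂ) = ((-Real.pi * s * t : ℝ) : ℂ) by
      push_cast; linear_combination (Real.pi * s * t : ℂ) * Complex.I_sq]
    rw [Complex.ofReal_exp]
  -- integrability on the imaginary axis
  have hGint : IntegrableOn (fun t : ℝ => G (t * Complex.I)) (Ioi 0) := by
    rw [← Ioc_union_Ioi_eq_Ioi zero_le_one]
    refine IntegrableOn.union ?_ ?_
    · obtain ⟨C, hC⟩ := H.exists_bound_near_zero
      refine Integrable.mono' (integrableOn_const (C := C) (by simp)) ?_ ?_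
      · have := continuousOn_vertical hGc 0
        simp only [Complex.ofReal_zero, zero_add] at this
        exact (this.mono Ioc_subset_Ioi_self).aestronglyMeasurable measurableSet_Ioc
      · filter_upwards [ae_restrict_mem measurableSet_Ioc] with t ht
        have h4 : Real.exp (-Real.pi * s * t) ≤ 1 := by
          rw [Real.exp_le_one_iff]
          have : 0 ≤ Real.pi * s * t := mul_nonneg (mul_nonneg Real.pi_pos.le hs) ht.1.le
          linarith
        rw [hI t ht.1, norm_mul, Complex.norm_real, Real.norm_of_nonneg (Real.exp_pos _).le]
        calc _ ≤ ‖g (t * Complex.I)‖ * 1 := by gcongr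
          _ ≤ C := by rw [mul_one]; exact hC t ht
    · have := hg.integrableOn hc' hGc (a := 0) (v₀ := 1) (by simp) one_pos
      simpa using this
  have hJ : ∫ t in Ioi (0 : ℝ), Complex.I * G (t * Complex.I) = L - L₀ := by
    -- This is P on the imaginary axis, given its limit L₀ at 0 so as to be continuous from the
    -- right there.
    set F : ℝ → ℂ := fun t => if t ≤ 0 then L₀ else P (t * Complex.I) with hF
    have e0 : F 0 = L₀ := by simp [hF]
    rw [← e0]
    have hev : ∀ t : ℝ, 0 < t → F t = P (t * Complex.I) := fun t ht => by
      simp [hF, not_le.2 ht]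
    refine integral_Ioi_of_hasDerivAt_of_tendsto ?_ (fun t ht => ?_) (hGint.const_mul _) ?_
    · rw [← continuousWithinAt_Ioi_iff_Ici, ContinuousWithinAt, e0]
      have h1 := (hL₀ 0 (by simp)).1.comp tendsto_inv_nhdsGT_zero
      refine h1.congr' ?_
      filter_upwards [self_mem_nhdsWithin] with t ht
      have ht0 : (0 : ℝ) < t := ht
      rw [hev t ht0]
      simp only [Function.comp_apply]
      congr 1
      have : (t : ℂ) ≠ 0 := by exact_mod_cast ht0.ne'
      push_cast
      field_simp
      simp
    · have ht0 : (0 : ℝ) < t := ht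
      have h1 : HasDerivAt (fun u : ℂ => u * Complex.I) Complex.I (t : ℂ) := by
        simpa using (hasDerivAt_id (t : ℂ)).mul_const Complex.I
      have h2 : 0 < ((t : ℂ) * Complex.I).im := by simpa using ht0
      have h3 := ((hP _ h2).comp (t : ℂ) h1).comp_ofReal
      have h4 : HasDerivAt (fun u : ℝ => P (u * Complex.I)) (Complex.I * G (t * Complex.I)) t := by
        simpa [mul_comm, Function.comp_def] using h3
      refine h4.congr_of_eventuallyEq ?_
      filter_upwards [Ioi_mem_nhds ht0] with u hu using hev u hu
    · refine ((hL 0 (by simp)).1).congr' ?_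
      filter_upwards [eventually_gt_atTop 0] with t ht
      rw [hev t ht]
      simp
  set A : ℂ := Complex.exp (Real.pi * Complex.I * s) with hA
  set B : ℂ := Complex.exp (-(Real.pi * Complex.I * s)) with hB
  have hAB : A * B = 1 := by rw [hA, hB, ← Complex.exp_add]; simp
  -- the arcs
  have harc : ∀ a b v₀ : ℝ, |a| ≤ 1 → 0 < v₀ →
      gaussMix (volume.restrict (Ioi v₀)) (arcWeight κ ε h a)
        (fun v => b + -1 / ((a : ℂ) + v * Complex.I)) s =
      Complex.exp (Real.pi * Complex.I * s * b) *
        (L₀ - P (-1 / ((a : ℂ) + v₀ * Complex.I))) := by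
    intro a b v₀ ha hv₀
    rw [← (hL₀ a ha).2 v₀ hv₀, ← integral_const_mul, gaussMix]
    refine setIntegral_congr_fun measurableSet_Ioi fun v hv => ?_
    simp only [hq, hG]
    rw [H.arcWeight_eq a (hv₀.trans hv), mul_add, Complex.exp_add]
    ring
  have g1 : gaussMix (volume.restrict (Ioi (1 / 2))) (arcWeight κ ε h (1 / 2))
        (fun v => 1 - 1 / (((1 / 2 : ℝ) : ℂ) + v * Complex.I)) s = A * (L₀ - P (-1 + Complex.I)) := by
    have := harc (1 / 2) 1 (1 / 2) (by norm_num [abs_of_pos]) (by norm_num)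
    rw [show (-1 / (((1 / 2 : ℝ) : ℂ) + ((1 / 2 : ℝ) : ℂ) * Complex.I)) = -1 + Complex.I by
      have := add_mul_I_ne_zero (a := 1 / 2) (v := 1 / 2) (by norm_num)
      rw [div_eq_iff this]
      push_cast
      linear_combination (-1 / 2 : ℂ) * Complex.I_sq] at this
    rw [Complex.ofReal_one, mul_one] at this
    rw [← this]
    exact gaussMix_congr (Eventually.of_forall fun v => ⟨rfl, by ring⟩) _
  have g2 : gaussMix (volume.restrict (Ioi (1 / 2))) (arcWeight κ ε h (-(1 / 2)))
        (fun v => -1 - 1 / (((-(1 / 2) : ℝ) : ℂ) + v * Complex.I)) s =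
        B * (L₀ - P (1 + Complex.I)) := by
    have := harc (-(1 / 2)) (-1) (1 / 2) (by rw [abs_neg]; norm_num [abs_of_pos]) (by norm_num)
    rw [show (-1 / (((-(1 / 2) : ℝ) : ℂ) + ((1 / 2 : ℝ) : ℂ) * Complex.I)) = 1 + Complex.I by
      have := add_mul_I_ne_zero (a := -(1 / 2)) (v := 1 / 2) (by norm_num)
      rw [div_eq_iff this]
      push_cast
      linear_combination (-1 / 2 : ℂ) * Complex.I_sq] at this
    rw [show (Real.pi * Complex.I * s * ((-1 : ℝ) : ℂ) : ℂ) = -(Real.pi * Complex.I * s) by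
      push_cast; ring] at this
    rw [← this]
    exact gaussMix_congr (Eventually.of_forall fun v => ⟨rfl, by push_cast; ring⟩) _
  have g3 : gaussMix (volume.restrict (Ioi 1)) (arcWeight κ ε h 0)
        (fun v => -1 / (((0 : ℝ) : ℂ) + v * Complex.I)) s = L₀ - P Complex.I := by
    have := harc 0 0 1 (by simp) (by norm_num)
    rw [show (-1 / (((0 : ℝ) : ℂ) + ((1 : ℝ) : ℂ) * Complex.I)) = Complex.I by simp] at this
    rw [show (Real.pi * Complex.I * s * ((0 : ℝ) : ℂ) : ℂ) = 0 by
      push_cast; ring, Complex.exp_zero, one_mul] at this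
    rw [← this]
    exact gaussMix_congr (Eventually.of_forall fun v => ⟨rfl, by push_cast; ring⟩) _
  -- On the ray to i∞, 2h is the second difference of g. The shift by ±1 moves the ray to Re z = ±1
  -- and brings out the factor e^{∓πis}.
  have g4 : 2 * gaussMix (volume.restrict (Ioi 1))
        (fun v => Complex.I * h (((0 : ℝ) : ℂ) + v * Complex.I))
        (fun v => ((0 : ℝ) : ℂ) + v * Complex.I) s =
        B * (L - P (1 + Complex.I)) + A * (L - P (-1 + Complex.I)) - 2 * (L - P Complex.I) := by
    have i1 := (hL 1 (by simp)).2 1 one_pos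
    have i2 := (hL (-1) (by simp)).2 1 one_pos
    have i3 := (hL 0 (by simp)).2 1 one_pos
    have j1 := ((hg.integrableOn hc' hGc (a := 1) (v₀ := 1) (by simp) one_pos).const_mul
      Complex.I).const_mul B
    have j2 := ((hg.integrableOn hc' hGc (a := -1) (v₀ := 1) (by simp) one_pos).const_mul
      Complex.I).const_mul A
    have j3 := ((hg.integrableOn hc' hGc (a := 0) (v₀ := 1) (by simp) one_pos).const_mul
      Complex.I).const_mul 2
    simp only [Complex.ofReal_one, one_mul, Complex.ofReal_neg] at i1 i2 i3
    rw [show ((0 : ℝ) : ℂ) + Complex.I = Complex.I by simp] at i3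
    rw [← i1, ← i2, ← i3, ← integral_const_mul, ← integral_const_mul, ← integral_const_mul,
      gaussMix, ← integral_const_mul]
    simp only [Complex.ofReal_one, Complex.ofReal_neg] at j1 j2
    have j12 : Integrable (fun v : ℝ => B * (Complex.I * G (1 + v * Complex.I)) +
        A * (Complex.I * G (-1 + v * Complex.I))) (volume.restrict (Ioi 1)) := j1.add j2
    rw [← integral_add j1 j2, ← integral_sub j12 j3]
    refine setIntegral_congr_fun measurableSet_Ioi fun v hv => ?_
    have hv0 : (0 : ℝ) < v := zero_lt_one.trans hv
    simp only [hG, Complex.ofReal_zero, zero_add]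
    have hd := H.diff_two (v * Complex.I) (by simpa using hv0)
    set u : ℂ := v * Complex.I
    rw [show (Real.pi * Complex.I * s * (1 + u) : ℂ) = Real.pi * Complex.I * s +
      Real.pi * Complex.I * s * u by ring, show (Real.pi * Complex.I * s * (-1 + u) : ℂ) =
      -(Real.pi * Complex.I * s) + Real.pi * Complex.I * s * u by ring, Complex.exp_add,
      Complex.exp_add, ← hA, ← hB, add_comm 1 u, show -1 + u = u - 1 by ring]
    linear_combination (-Complex.I * Complex.exp (Real.pi * Complex.I * s * u)) * hd -
      (Complex.I * (g (u + 1) + g (u - 1)) * Complex.exp (Real.pi * Complex.I * s * u)) * hAB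
  refine ⟨(integrableOn_congr_fun (fun t ht => hI t ht) measurableSet_Ioi).1 hGint, ?_⟩
  have hJ' : Complex.I * ∫ t in Ioi (0 : ℝ), g (t * Complex.I) * Real.exp (-Real.pi * s * t) =
      L - L₀ := by
    rw [← hJ, ← integral_const_mul]
    refine setIntegral_congr_fun measurableSet_Ioi fun t ht => ?_
    rw [hI t ht]
  have hsin : Complex.sin (Real.pi * s / 2) ^ 2 = (2 - A - B) / 4 := by
    have e1 : A = Complex.exp (Real.pi * s / 2 * Complex.I) ^ 2 := by
      rw [← Complex.exp_nat_mul, hA]; congr 1; push_cast; ring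
    have e2 : B = Complex.exp (-(Real.pi * s / 2) * Complex.I) ^ 2 := by
      rw [← Complex.exp_nat_mul, hB]; congr 1; push_cast; ring
    have e3 : Complex.exp (Real.pi * s / 2 * Complex.I) *
        Complex.exp (-(Real.pi * s / 2) * Complex.I) = 1 := by
      rw [← Complex.exp_add]; simp
    rw [Complex.sin, e1, e2, div_pow, mul_pow, Complex.I_sq]
    linear_combination (1 / 2 : ℂ) * e3
  -- The values of P at i and ±1 + i cancel. What remains is (A + B - 2)(L - L₀), and A + B - 2 = -4
  -- sin²(πs/2).
  rw [profile, g1, g2, g3, g4, hsin]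
  linear_combination (-(Complex.I / 4) * (A + B - 2)) * hJ' + (1 / 4 * (A + B - 2) *
    ∫ t in Ioi (0 : ℝ), g (t * Complex.I) * Real.exp (-Real.pi * s * t)) * Complex.I_sq

end ModularKernel

end ContourShift

/-! ### Principal parts at i∞ and their Laplace transforms. -/

section Values

lemma StripDecay.mono {c c' : ℝ} {p : ℂ → ℂ} (hp : StripDecay c p) (h : c' ≤ c) :
    StripDecay c' p := by
  obtain ⟨C, Y, hC⟩ := hp
  refine ⟨C, max Y 0, fun z hz hz' => (hC z hz ((le_max_left _ _).trans hz')).trans ?_⟩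
  have h0 : 0 ≤ z.im := (le_max_right _ _).trans hz'
  have hC0 : 0 ≤ C := by
    have := (norm_nonneg _).trans (hC z hz ((le_max_left _ _).trans hz'))
    exact nonneg_of_mul_nonneg_left this (Real.exp_pos _)
  gcongr

lemma StripDecay.add {c : ℝ} {p q : ℂ → ℂ} (hp : StripDecay c p) (hq : StripDecay c q) :
    StripDecay c (fun z => p z + q z) := by
  obtain ⟨C, Y, hC⟩ := hp
  obtain ⟨C', Y', hC'⟩ := hq
  refine ⟨C + C', max Y Y', fun z hz hz' => (norm_add_le _ _).trans ?_⟩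
  rw [add_mul]
  exact add_le_add (hC z hz ((le_max_left _ _).trans hz')) (hC' z hz ((le_max_right _ _).trans hz'))

lemma StripDecay.sum {c : ℝ} {p : ℕ → ℂ → ℂ} (s : Finset ℕ) (hp : ∀ m ∈ s, StripDecay c (p m)) :
    StripDecay c (fun z => ∑ m ∈ s, p m z) := by
  classical
  induction s using Finset.induction_on with
  | empty => exact ⟨0, 0, fun z _ _ => by simp⟩
  | insert m s hm ih =>
    simp only [Finset.sum_insert hm]
    exact (hp m (Finset.mem_insert_self _ _)).add
      (ih fun j hj => hp j (Finset.mem_insert_of_mem hj))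

/-- The principal part at `i∞`. -/
def principalPart (n : ℕ) (a b : ℕ → ℂ) (z : ℂ) : ℂ :=
  ∑ m ∈ Finset.range (n + 1), (a m * (-Complex.I * z) + b m) *
    Complex.exp (-(2 * Real.pi * Complex.I * m * z))

lemma principalPart_mul_I (n : ℕ) (a b : ℕ → ℂ) (t : ℝ) :
    principalPart n a b (t * Complex.I) =
      ∑ m ∈ Finset.range (n + 1), (a m * t + b m) * Real.exp (2 * Real.pi * m * t) := by
  refine Finset.sum_congr rfl fun m _ => ?_
  rw [Complex.ofReal_exp, show -Complex.I * ((t : ℂ) * Complex.I) = t by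
    linear_combination (-t : ℂ) * Complex.I_sq]
  congr 2
  push_cast
  linear_combination (-2 * Real.pi * m * t : ℂ) * Complex.I_sq

/-- For s > 2n the factor e^{πisz} outweighs the largest exponential e^{2πn Im z} of the principal
part. Half of the gap, c' = π(s - 2n)/2, is kept as decay and the other half absorbs the factor
linear in z. -/
lemma stripDecay_growth {n : ℕ} {a b : ℕ → ℂ} {c s : ℝ} {g : ℂ → ℂ} (hc : 0 < c)
    (hg : StripDecay c fun z => g z - principalPart n a b z) (hs : 2 * n < s) :
    ∃ c', 0 < c' ∧ StripDecay c' fun z => g z * Complex.exp (Real.pi * Complex.I * s * z) := by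
  have hπ := Real.pi_pos
  set c' : ℝ := Real.pi * (s - 2 * n) / 2 with hc'
  have hc0 : 0 < c' := by
    have : 0 < s - 2 * n := by linarith
    positivity
  have hs0 : 0 < s := lt_of_le_of_lt (by positivity) hs
  refine ⟨c', hc0, ?_⟩
  have e : (fun z => g z * Complex.exp (Real.pi * Complex.I * s * z)) = fun z =>
      (g z - principalPart n a b z) * Complex.exp (Real.pi * Complex.I * s * z) +
      ∑ m ∈ Finset.range (n + 1), (a m * (-Complex.I * z) + b m) *
        Complex.exp (-(2 * Real.pi * Complex.I * m * z)) *
        Complex.exp (Real.pi * Complex.I * s * z) := by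
    ext z
    rw [← Finset.sum_mul, ← principalPart]
    ring
  rw [e]
  have hns : ∀ z : ℂ, ‖Complex.exp (Real.pi * Complex.I * s * z)‖ =
      Real.exp (-(Real.pi * s * z.im)) := by
    intro z
    rw [norm_exp_pi_mul_I]
    simp [mul_assoc]
  refine StripDecay.add ?_ (StripDecay.sum _ fun m hm => ?_)
  · obtain ⟨C, Y, hC⟩ := hg
    refine ⟨C, max Y 0, fun z hz hz' => ?_⟩
    have h0 : 0 ≤ z.im := (le_max_right _ _).trans hz'
    have h1 := hC z hz ((le_max_left _ _).trans hz')
    have hC0 : 0 ≤ C := nonneg_of_mul_nonneg_left ((norm_nonneg _).trans h1) (Real.exp_pos _)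
    rw [norm_mul, hns]
    calc _ ≤ C * Real.exp (-c * z.im) * Real.exp (-(Real.pi * s * z.im)) := by gcongr
      _ ≤ C * 1 * Real.exp (-(c' * z.im)) := by
        have hle : c' ≤ Real.pi * s := by
          have : (0 : ℝ) ≤ n := Nat.cast_nonneg n
          rw [hc']; nlinarith
        gcongr
        rw [Real.exp_le_one_iff]
        nlinarith
      _ = _ := by rw [mul_one, neg_mul]
  · have hmn : (m : ℝ) ≤ n := by
      exact_mod_cast Nat.lt_succ_iff.1 (Finset.mem_range.1 hm)
    refine ⟨(‖a m‖ + ‖b m‖) * (2 + c'⁻¹), 0, fun z hz h0 => ?_⟩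
    have hz1 : ‖z‖ ≤ 1 + z.im := by
      refine (Complex.norm_le_abs_re_add_abs_im z).trans ?_
      rw [abs_of_nonneg h0]; linarith
    have h1 : 1 + z.im ≤ (2 + c'⁻¹) * Real.exp (c' * z.im) := by
      have := Real.add_one_le_exp (c' * z.im)
      have h2 : z.im = c'⁻¹ * (c' * z.im) := by field_simp
      have h3 : 0 < c'⁻¹ := inv_pos.2 hc0
      have h4 : 0 ≤ c' * z.im := by positivity
      calc 1 + z.im = 1 + c'⁻¹ * (c' * z.im) := by rw [← h2]
        _ ≤ Real.exp (c' * z.im) + c'⁻¹ * Real.exp (c' * z.im) := by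
            gcongr <;> linarith
        _ ≤ _ := by nlinarith [Real.exp_pos (c' * z.im)]
    have h2 : ‖a m * (-Complex.I * z) + b m‖ ≤ (‖a m‖ + ‖b m‖) * (1 + z.im) := by
      refine (norm_add_le _ _).trans ?_
      rw [norm_mul, norm_mul, norm_neg, Complex.norm_I, one_mul]
      nlinarith [norm_nonneg (a m), norm_nonneg (b m), mul_nonneg (norm_nonneg (b m)) h0,
        mul_le_mul_of_nonneg_left hz1 (norm_nonneg (a m))]
    have h3 : ‖Complex.exp (-(2 * Real.pi * Complex.I * m * z))‖ =
        Real.exp (2 * Real.pi * m * z.im) := by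
      rw [Complex.norm_exp]; congr 1; simp
    rw [norm_mul, norm_mul, hns, h3, mul_assoc, ← Real.exp_add]
    calc _ ≤ (‖a m‖ + ‖b m‖) * ((2 + c'⁻¹) * Real.exp (c' * z.im)) *
          Real.exp (-(2 * c') * z.im) := by
          have : 2 * Real.pi * m * z.im + -(Real.pi * s * z.im) ≤ -(2 * c') * z.im := by
            have : 2 * Real.pi * m * z.im ≤ 2 * Real.pi * n * z.im := by gcongr
            rw [hc']; linarith
          gcongr
          exact h2.trans (by gcongr)
      _ = (‖a m‖ + ‖b m‖) * (2 + c'⁻¹) * (Real.exp (c' * z.im) * Real.exp (-(2 * c') * z.im)) := by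
          ring
      _ = _ := by rw [← Real.exp_add]; congr 2; ring

/-- The entire function `sin (π x / 2) / (π x / 2)`. -/
def halfSinc (x : ℂ) : ℂ := dslope (fun x => Complex.sin (Real.pi * x / 2)) 0 x * (2 / Real.pi)

lemma hasDerivAt_sin_half (x : ℂ) : HasDerivAt (fun x => Complex.sin (Real.pi * x / 2))
    (Complex.cos (Real.pi * x / 2) * (Real.pi / 2)) x := by
  have := (((hasDerivAt_id x).const_mul (Real.pi : ℂ)).div_const 2).csin
  simpa using this

lemma differentiable_halfSinc : Differentiable ℂ halfSinc := by
  refine Differentiable.mul_const ?_ _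
  rw [← differentiableOn_univ, Complex.differentiableOn_dslope univ_mem]
  exact fun x _ => (hasDerivAt_sin_half x).differentiableAt.differentiableWithinAt

lemma pi_ne_zero' : (Real.pi : ℂ) ≠ 0 := by exact_mod_cast Real.pi_ne_zero

lemma halfSinc_zero : halfSinc 0 = 1 := by
  rw [halfSinc, dslope_same, (hasDerivAt_sin_half 0).deriv]
  have := pi_ne_zero'
  simp

lemma halfSinc_of_ne {x : ℂ} (hx : x ≠ 0) :
    halfSinc x = Complex.sin (Real.pi * x / 2) / (Real.pi * x / 2) := by
  rw [halfSinc, dslope_of_ne _ hx, slope_def_field]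
  have := pi_ne_zero'
  simp
  field_simp

lemma sin_half_sub (s : ℂ) (m : ℕ) :
    Complex.sin (Real.pi * (s - 2 * m) / 2) ^ 2 = Complex.sin (Real.pi * s / 2) ^ 2 := by
  rw [show (Real.pi * (s - 2 * m) / 2 : ℂ) = Real.pi * s / 2 - m * Real.pi by ring,
    Complex.sin_sub, Complex.sin_nat_mul_pi, mul_zero, sub_zero, mul_pow]
  have h := Complex.sin_sq_add_cos_sq (m * Real.pi)
  rw [Complex.sin_nat_mul_pi] at h
  linear_combination Complex.sin (Real.pi * s / 2) ^ 2 * h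

lemma halfSinc_even {m M : ℕ} (h : m ≠ M) : halfSinc (2 * M - 2 * m : ℂ) = 0 := by
  have h0 : (2 * M - 2 * m : ℂ) ≠ 0 := by
    intro h1
    have : (M : ℂ) = m := by linear_combination h1 / 2
    exact h (by exact_mod_cast this.symm)
  rw [halfSinc_of_ne h0, div_eq_zero_iff]
  left
  have := sin_half_sub (2 * M) m
  rw [show (Real.pi * (2 * M) / 2 : ℂ) = M * Real.pi by ring, Complex.sin_nat_mul_pi] at this
  simpa using this

/-- The contribution of one term of the principal part to the profile. -/
def polarTerm (a b : ℂ) (m : ℕ) (s : ℂ) : ℂ :=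
  a / 4 * halfSinc (s - 2 * m) ^ 2 + b * (Real.pi / 4) * ((s - 2 * m) * halfSinc (s - 2 * m) ^ 2)

lemma differentiable_polarTerm (a b : ℂ) (m : ℕ) : Differentiable ℂ (polarTerm a b m) := by
  have h1 : Differentiable ℂ fun s : ℂ => s - 2 * (m : ℂ) := by fun_prop
  have h2 := (differentiable_halfSinc.comp h1).pow 2
  exact (h2.const_mul _).add ((h1.mul h2).const_mul _)

/-- The bracket is, for real s > 2m, the Laplace transform of (at + b) e^{2πmt}. The factor sin²
cancels its pole at s = 2m, and `polarTerm` is the resulting entire function. -/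
lemma polarTerm_eq (a b : ℂ) (m : ℕ) {s : ℂ} (hs : s - 2 * m ≠ 0) :
    polarTerm a b m s = Complex.sin (Real.pi * s / 2) ^ 2 *
      (a / (Real.pi * (s - 2 * m)) ^ 2 + b / (Real.pi * (s - 2 * m))) := by
  have := pi_ne_zero'
  rw [polarTerm, halfSinc_of_ne hs, div_pow, sin_half_sub]
  field_simp
  ring

lemma hasDerivAt_polarTerm (a b : ℂ) (m : ℕ) (s : ℂ) :
    HasDerivAt (polarTerm a b m)
      (a / 4 * (2 * halfSinc (s - 2 * m) * deriv halfSinc (s - 2 * m)) + b * (Real.pi / 4) *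
        (halfSinc (s - 2 * m) ^ 2 + (s - 2 * m) *
          (2 * halfSinc (s - 2 * m) * deriv halfSinc (s - 2 * m)))) s := by
  have h1 : HasDerivAt (fun s : ℂ => s - 2 * (m : ℂ)) 1 s := (hasDerivAt_id s).sub_const _
  have h2 := ((differentiable_halfSinc (s - 2 * m)).hasDerivAt.comp s h1).pow 2
  refine ((h2.const_mul (a / 4)).add ((h1.mul h2).const_mul (b * (Real.pi / 4)))).congr_deriv ?_
  simp

lemma integral_exp_and_mul_exp {r : ℝ} (hr : 0 < r) (a b : ℂ) :
    IntegrableOn (fun t : ℝ => (a * t + b) * Real.exp (-r * t)) (Ioi 0) ∧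
    ∫ t in Ioi (0 : ℝ), (a * t + b) * Real.exp (-r * t) = a / (r : ℂ) ^ 2 + b / r := by
  have hi0 : IntegrableOn (fun t : ℝ => Real.exp (-r * t)) (Ioi 0) := exp_neg_integrableOn_Ioi 0 hr
  have hi1 : IntegrableOn (fun t : ℝ => t * Real.exp (-r * t)) (Ioi 0) := by
    refine integrable_of_isBigO_exp_neg (b := r / 2) (by positivity) (by fun_prop) ?_
    have := (isLittleO_pow_exp_pos_mul_atTop 1 (b := r / 2) (by positivity)).isBigO.mul
      (Asymptotics.isBigO_refl (fun v : ℝ => Real.exp (-r * v)) atTop)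
    refine (this.congr_right fun v => ?_).congr_left fun v => by rw [pow_one]
    rw [← Real.exp_add]
    congr 1; ring
  have v0 : ∫ t in Ioi (0 : ℝ), Real.exp (-r * t) = 1 / r := by
    have := Real.integral_rpow_mul_exp_neg_mul_Ioi (a := 1) one_pos hr
    simpa using this
  have v1 : ∫ t in Ioi (0 : ℝ), t * Real.exp (-r * t) = 1 / r ^ 2 := by
    have := Real.integral_rpow_mul_exp_neg_mul_Ioi (a := 2) two_pos hr
    rw [Real.Gamma_two, mul_one] at this
    norm_num at this
    simpa using this
  have e : (fun t : ℝ => (a * t + b) * (Real.exp (-r * t) : ℂ)) = fun t =>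
      a * ((t * Real.exp (-r * t) : ℝ) : ℂ) + b * ((Real.exp (-r * t) : ℝ) : ℂ) := by
    ext t; push_cast; ring
  rw [e]
  have j1 : IntegrableOn (fun t : ℝ => a * ((t * Real.exp (-r * t) : ℝ) : ℂ)) (Ioi 0) :=
    Integrable.const_mul (Integrable.ofReal (𝕜 := ℂ) hi1) a
  have j0 : IntegrableOn (fun t : ℝ => b * ((Real.exp (-r * t) : ℝ) : ℂ)) (Ioi 0) :=
    Integrable.const_mul (Integrable.ofReal (𝕜 := ℂ) hi0) b
  refine ⟨j1.add j0, ?_⟩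
  rw [integral_add j1 j0, integral_const_mul, integral_const_mul, integral_complex_ofReal,
    integral_complex_ofReal, v0, v1]
  push_cast
  ring

end Values

/-! ### Analytic continuation of the profile and its values at even integers. -/

section ProfileValues

/-- Two holomorphic functions on a right half-plane which agree on a real ray are equal. -/
lemma eqOn_of_eq_on_ray {F G : ℂ → ℂ} {σ s₀ : ℝ} (hσ : σ ≤ s₀)
    (hF : DifferentiableOn ℂ F {s | σ < s.re}) (hG : DifferentiableOn ℂ G {s | σ < s.re})
    (h : ∀ s : ℝ, s₀ < s → F s = G s) : EqOn F G {s | σ < s.re} := by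
  have hopen : IsOpen {s : ℂ | σ < s.re} := isOpen_lt continuous_const Complex.continuous_re
  have hconv : Convex ℝ {s : ℂ | σ < s.re} := convex_halfSpace_re_gt σ
  refine (hF.analyticOnNhd hopen).eqOn_of_preconnected_of_frequently_eq (hG.analyticOnNhd hopen)
    hconv.isPreconnected (z₀ := ((s₀ + 1 : ℝ) : ℂ)) ?_ ?_
  · simp only [mem_ofPred_eq, Complex.ofReal_re]; linarith
  · have ht : Tendsto (fun x : ℝ => (x : ℂ)) (𝓝[>] (s₀ + 1)) (𝓝[≠] ((s₀ + 1 : ℝ) : ℂ)) := by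
      refine tendsto_nhdsWithin_iff.2 ⟨?_, ?_⟩
      · exact (Complex.continuous_ofReal.tendsto _).mono_left nhdsWithin_le_nhds
      · filter_upwards [self_mem_nhdsWithin] with x hx
        rw [mem_compl_iff, mem_singleton_iff, Complex.ofReal_inj]
        exact (ne_of_gt hx)
    refine ht.frequently (Eventually.frequently ?_)
    filter_upwards [self_mem_nhdsWithin] with x hx
    exact h x (by linarith [mem_Ioi.1 hx])

variable {κ n : ℕ} {ε : ℂ} {c : ℝ} {h g : ℂ → ℂ} {a b : ℕ → ℂ}

lemma differentiable_principalPart : Differentiable ℂ (principalPart n a b) := by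
  unfold principalPart
  fun_prop

/-- The Laplace transform of the part of `g` which is small at `i∞`. -/
def decayingPart (n : ℕ) (a b : ℕ → ℂ) (g : ℂ → ℂ) (s : ℂ) : ℂ :=
  gaussMix (volume.restrict (Ioi 0))
    (fun t => g (t * Complex.I) - principalPart n a b (t * Complex.I))
    (fun t => t * Complex.I) s

/-- Near t = 0 the integrand is merely bounded, since the principal part need not vanish there. The
negative powers of Im z in `RapidWeight` are therefore not available, and only the domination needed
by `hasDerivAt_gaussMix` is proved. -/
lemma ModularKernel.integrable_decayingPart (H : ModularKernel κ ε c h g)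
    (hg : StripDecay c fun z => g z - principalPart n a b z) :
    IntegrableOn (fun t : ℝ => ‖g (t * Complex.I) - principalPart n a b (t * Complex.I)‖ *
      (1 + ‖(t * Complex.I : ℂ)‖) * Real.exp (Real.pi * (c / (2 * Real.pi)) *
        (t * Complex.I : ℂ).im)) (Ioi 0) := by
  have hc := H.pos
  have hcont : ContinuousOn (fun z => g z - principalPart n a b z) {z | 0 < z.im} :=
    H.differentiableOn.continuousOn.sub differentiable_principalPart.continuous.continuousOn
  have hv := continuousOn_vertical hcont 0
  simp only [Complex.ofReal_zero, zero_add] at hv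
  have hv' : ContinuousOn (fun t : ℝ => ‖g (t * Complex.I) - principalPart n a b (t * Complex.I)‖ *
      (1 + ‖(t * Complex.I : ℂ)‖) * Real.exp (Real.pi * (c / (2 * Real.pi)) *
        (t * Complex.I : ℂ).im)) (Ioi 0) := by
    refine (hv.norm.mul (by fun_prop)).mul (Continuous.continuousOn ?_)
    fun_prop
  have hexp : ∀ t : ℝ, Real.exp (Real.pi * (c / (2 * Real.pi)) * (t * Complex.I : ℂ).im) =
      Real.exp (c / 2 * t) := by
    intro t; congr 1
    have := Real.pi_pos
    rw [show (t * Complex.I : ℂ).im = t by simp]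
    field_simp
  rw [← Ioc_union_Ioi_eq_Ioi zero_le_one]
  refine IntegrableOn.union ?_ ?_
  · obtain ⟨C, hC⟩ := H.exists_bound_near_zero
    obtain ⟨C', hC'⟩ := (isCompact_Icc (a := (0 : ℝ)) (b := 1)).exists_bound_of_continuousOn
      (f := fun t : ℝ => principalPart n a b (t * Complex.I))
      ((differentiable_principalPart.continuous.comp (by fun_prop)).continuousOn)
    refine Integrable.mono' (integrableOn_const (C := (C + C') * 2 * Real.exp (c / 2)) (by simp))
      ((hv'.mono Ioc_subset_Ioi_self).aestronglyMeasurable measurableSet_Ioc) ?_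
    filter_upwards [ae_restrict_mem measurableSet_Ioc] with t ht
    rw [hexp, norm_mul, norm_mul, norm_norm, Real.norm_of_nonneg (Real.exp_pos _).le,
      Real.norm_of_nonneg (by positivity)]
    have h1 := (norm_sub_le _ _).trans (add_le_add (hC t ht) (hC' t ⟨ht.1.le, ht.2⟩))
    have h2 : 1 + ‖(t * Complex.I : ℂ)‖ ≤ 2 := by
      rw [norm_mul, Complex.norm_I, mul_one, Complex.norm_real, Real.norm_of_nonneg ht.1.le]
      linarith [ht.2]
    have h3 : c / 2 * t ≤ c / 2 := by nlinarith [ht.2]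
    have h4 : 0 ≤ C + C' := (norm_nonneg _).trans h1
    gcongr
  · obtain ⟨C, hC0, hC⟩ := hg.exists_bound hcont (a := 0) (by simp) one_pos
    have hi0 : IntegrableOn (fun t : ℝ => Real.exp (-(c / 2) * t)) (Ioi 0) :=
      exp_neg_integrableOn_Ioi 0 (by positivity)
    have hi1 : IntegrableOn (fun t : ℝ => ‖(1 * (t : ℂ) + 1) * (Real.exp (-(c / 2) * t) : ℂ)‖)
        (Ioi 0) := (integral_exp_and_mul_exp (r := c / 2) (by positivity) 1 1).1.norm
    refine Integrable.mono' ((hi1.mono_set (Ioi_subset_Ioi zero_le_one)).const_mul C)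
      ((hv'.mono (Ioi_subset_Ioi zero_le_one)).aestronglyMeasurable measurableSet_Ioi) ?_
    filter_upwards [ae_restrict_mem measurableSet_Ioi] with t ht
    have ht1 : 1 < t := ht
    have ht0 : 0 < t := by linarith
    have h1 := hC t ht1.le
    simp only [Complex.ofReal_zero, zero_add] at h1
    rw [hexp, norm_mul, norm_mul, norm_norm, Real.norm_of_nonneg (Real.exp_pos _).le,
      Real.norm_of_nonneg (by positivity)]
    have h2 : ‖(t * Complex.I : ℂ)‖ = t := by
      rw [norm_mul, Complex.norm_I, mul_one, Complex.norm_real, Real.norm_of_nonneg ht0.le]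
    have h3 : ‖(1 * (t : ℂ) + 1) * (Real.exp (-(c / 2) * t) : ℂ)‖ =
        (1 + t) * Real.exp (-(c / 2) * t) := by
      rw [norm_mul, Complex.norm_real, Real.norm_of_nonneg (Real.exp_pos _).le, one_mul]
      congr 1
      rw [show (t : ℂ) + 1 = ((1 + t : ℝ) : ℂ) by push_cast; ring, Complex.norm_real,
        Real.norm_of_nonneg (by positivity)]
    rw [h2, h3]
    calc _ ≤ C * Real.exp (-c * t) * (1 + t) * Real.exp (c / 2 * t) := by gcongr
      _ = C * ((1 + t) * (Real.exp (-c * t) * Real.exp (c / 2 * t))) := by ring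
      _ = _ := by rw [← Real.exp_add]; congr 3; ring

lemma ModularKernel.aestronglyMeasurable_decayingPart (H : ModularKernel κ ε c h g) :
    AEStronglyMeasurable (fun t : ℝ => g (t * Complex.I) - principalPart n a b (t * Complex.I))
      (volume.restrict (Ioi 0)) := by
  have hcont : ContinuousOn (fun z => g z - principalPart n a b z) {z | 0 < z.im} :=
    H.differentiableOn.continuousOn.sub differentiable_principalPart.continuous.continuousOn
  have hv := continuousOn_vertical hcont 0
  simp only [Complex.ofReal_zero, zero_add] at hv
  exact hv.aestronglyMeasurable measurableSet_Ioi

lemma ModularKernel.differentiableOn_decayingPart (H : ModularKernel κ ε c h g)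
    (hg : StripDecay c fun z => g z - principalPart n a b z) :
    DifferentiableOn ℂ (decayingPart n a b g) {s | -(c / (2 * Real.pi)) < s.re} := by
  intro s hs
  refine (hasDerivAt_gaussMix (H.aestronglyMeasurable_decayingPart (n := n) (a := a) (b := b))
    (by fun_prop) (by simp) ?_ (H.integrable_decayingPart hg)
    hs).differentiableAt.differentiableWithinAt
  filter_upwards [ae_restrict_mem measurableSet_Ioi] with t ht
  simpa using ht

/-- The profile in terms of the principal part of `g`. -/
theorem ModularKernel.profile_eq (H : ModularKernel κ ε c h g)
    (hg : StripDecay c fun z => g z - principalPart n a b z) {s : ℂ}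
    (hs : -(c / (2 * Real.pi)) < s.re) :
    profile κ ε h s = ∑ m ∈ Finset.range (n + 1), polarTerm (a m) (b m) m s +
      Complex.sin (Real.pi * s / 2) ^ 2 * decayingPart n a b g s := by
  have hpos : 0 < c / (2 * Real.pi) := div_pos H.pos (by positivity)
  have hn : -(c / (2 * Real.pi)) ≤ 2 * n := by
    have : (0 : ℝ) ≤ 2 * n := by positivity
    linarith
  -- Both sides are holomorphic for Re s > -c/(2π), so it is enough to compare them for real s > 2n,
  -- where the Laplace representation holds.
  refine eqOn_of_eq_on_ray (G := fun s => ∑ m ∈ Finset.range (n + 1), polarTerm (a m) (b m) m s +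
    Complex.sin (Real.pi * s / 2) ^ 2 * decayingPart n a b g s) hn H.differentiableOn_profile
    ?_ ?_ hs
  · refine DifferentiableOn.add (Differentiable.differentiableOn ?_)
      (DifferentiableOn.mul (Differentiable.differentiableOn ?_) (H.differentiableOn_decayingPart hg))
    · exact Differentiable.fun_sum fun m _ => differentiable_polarTerm _ _ _
    · exact fun x => ((hasDerivAt_sin_half x).pow 2).differentiableAt
  · intro s hs
    have hs0 : 0 ≤ s := le_trans (by positivity) hs.le
    obtain ⟨c', hc', hgc'⟩ := stripDecay_growth H.pos hg hs
    obtain ⟨hint, heq⟩ := profile_eq_laplace H hs0 hc' hgc'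
    have hpolar : ∀ m ∈ Finset.range (n + 1), IntegrableOn (fun t : ℝ => (a m * t + b m) *
        (Real.exp (-(Real.pi * (s - 2 * m)) * t) : ℂ)) (Ioi 0) ∧
        ∫ t in Ioi (0 : ℝ), (a m * t + b m) * (Real.exp (-(Real.pi * (s - 2 * m)) * t) : ℂ) =
          a m / (Real.pi * (s - 2 * m)) ^ 2 + b m / (Real.pi * (s - 2 * m)) := by
      intro m hm
      have hmn : (m : ℝ) ≤ n := by exact_mod_cast Nat.lt_succ_iff.1 (Finset.mem_range.1 hm)
      have := integral_exp_and_mul_exp (r := Real.pi * (s - 2 * m))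
        (mul_pos Real.pi_pos (by linarith)) (a m) (b m)
      push_cast at this ⊢
      exact this
    have hsum := integrable_finsetSum _ fun m hm => (hpolar m hm).1
    have hsplit : ∀ t : ℝ, g (t * Complex.I) * (Real.exp (-Real.pi * s * t) : ℂ) =
        (∑ m ∈ Finset.range (n + 1), (a m * t + b m) *
          (Real.exp (-(Real.pi * (s - 2 * m)) * t) : ℂ)) +
        (g (t * Complex.I) - principalPart n a b (t * Complex.I)) *
          Complex.exp (Real.pi * Complex.I * s * (t * Complex.I)) := by
      intro t
      have e1 : Complex.exp (Real.pi * Complex.I * s * (t * Complex.I)) =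
          (Real.exp (-Real.pi * s * t) : ℂ) := by
        rw [Complex.ofReal_exp]; congr 1; push_cast
        linear_combination (Real.pi * s * t : ℂ) * Complex.I_sq
      have e2 : ∀ m : ℕ, (Real.exp (-(Real.pi * (s - 2 * m)) * t) : ℂ) =
          Real.exp (2 * Real.pi * m * t) * Real.exp (-Real.pi * s * t) := by
        intro m
        rw [← Complex.ofReal_mul, ← Real.exp_add]
        congr 2; ring
      simp_rw [e1, e2, principalPart_mul_I, ← mul_assoc]
      rw [← Finset.sum_mul]
      ring
    have hdec : IntegrableOn (fun t : ℝ =>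
        (g (t * Complex.I) - principalPart n a b (t * Complex.I)) *
          Complex.exp (Real.pi * Complex.I * s * (t * Complex.I))) (Ioi 0) := by
      refine (hint.sub hsum).congr (Eventually.of_forall fun t => ?_)
      simp only [Pi.sub_apply]
      rw [hsplit t]; ring
    rw [heq, integral_congr_ae (Eventually.of_forall hsplit), integral_add hsum hdec,
      integral_finsetSum _ fun m hm => (hpolar m hm).1, mul_add, Finset.mul_sum]
    congr 1
    refine Finset.sum_congr rfl fun m hm => ?_
    rw [(hpolar m hm).2, polarTerm_eq]
    have hmn : (m : ℝ) ≤ n := by exact_mod_cast Nat.lt_succ_iff.1 (Finset.mem_range.1 hm)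
    have : s - 2 * (m : ℝ) ≠ 0 := by linarith
    exact_mod_cast this

lemma sin_half_two_mul (M : ℕ) : Complex.sin (Real.pi * (2 * M) / 2) = 0 := by
  rw [show (Real.pi * (2 * M) / 2 : ℂ) = M * Real.pi by ring, Complex.sin_nat_mul_pi]

lemma ModularKernel.two_mul_mem (H : ModularKernel κ ε c h g) (M : ℕ) :
    -(c / (2 * Real.pi)) < (2 * M : ℂ).re := by
  have hpos : 0 < c / (2 * Real.pi) := div_pos H.pos (by positivity)
  have h2 : (2 * M : ℂ).re = 2 * M := by simp
  have : (0 : ℝ) ≤ 2 * M := by positivity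
  rw [h2]; linarith

/-- `halfSinc` is 1 at 0 and vanishes at the other even integers, so only the polar term with m = M
survives, and sin² removes the decaying part. -/
lemma ModularKernel.profile_two_mul (H : ModularKernel κ ε c h g)
    (hg : StripDecay c fun z => g z - principalPart n a b z) (M : ℕ) :
    profile κ ε h (2 * M) = if M ≤ n then a M / 4 else 0 := by
  rw [H.profile_eq hg (H.two_mul_mem M), sin_half_two_mul, zero_pow two_ne_zero, zero_mul, add_zero]
  have h0 : ∀ m, polarTerm (a m) (b m) m (2 * M) = if m = M then a M / 4 else 0 := by
    intro m
    split_ifs with h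
    · subst h; simp [polarTerm, halfSinc_zero]
    · simp [polarTerm, halfSinc_even h]
  simp_rw [h0, Finset.sum_ite_eq', Finset.mem_range, Nat.lt_succ_iff]

/-- Once a M = 0, the polar term with m = M contributes b M · π/4, and no value of `deriv halfSinc`
at 0 is needed. The other polar terms and the sin² term have double zeros at 2M. -/
lemma ModularKernel.hasDerivAt_profile_two_mul (H : ModularKernel κ ε c h g)
    (hg : StripDecay c fun z => g z - principalPart n a b z) {M : ℕ} (ha : M ≤ n → a M = 0) :
    HasDerivAt (profile κ ε h) (if M ≤ n then b M * (Real.pi / 4) else 0) (2 * M) := by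
  have hopen : IsOpen {s : ℂ | -(c / (2 * Real.pi)) < s.re} :=
    isOpen_lt continuous_const Complex.continuous_re
  have hmem := H.two_mul_mem M
  have hE : profile κ ε h =ᶠ[𝓝 (2 * M : ℂ)] fun s =>
      ∑ m ∈ Finset.range (n + 1), polarTerm (a m) (b m) m s +
      Complex.sin (Real.pi * s / 2) ^ 2 * decayingPart n a b g s := by
    filter_upwards [hopen.mem_nhds hmem] with s hs using H.profile_eq hg hs
  refine HasDerivAt.congr_of_eventuallyEq ?_ hE
  have h0 : ∀ m ∈ Finset.range (n + 1), HasDerivAt (polarTerm (a m) (b m) m)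
      (if m = M then b M * (Real.pi / 4) else 0) (2 * M) := by
    intro m hm
    refine (hasDerivAt_polarTerm (a m) (b m) m (2 * M)).congr_deriv ?_
    split_ifs with h
    · subst h; simp [halfSinc_zero, ha (Nat.lt_succ_iff.1 (Finset.mem_range.1 hm))]
    · simp [halfSinc_even h]
  have h1 := HasDerivAt.fun_sum h0
  have h2 := ((hasDerivAt_sin_half (2 * M)).pow 2).mul
    ((H.differentiableOn_decayingPart hg).differentiableAt (hopen.mem_nhds hmem)).hasDerivAt
  refine (h1.add h2).congr_deriv ?_
  simp_rw [Finset.sum_ite_eq', Finset.mem_range, Nat.lt_succ_iff]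
  simp [sin_half_two_mul]

/-- The profile is real on the reals when `g` is real on the imaginary axis. -/
lemma ModularKernel.profile_real (H : ModularKernel κ ε c h g)
    (hg : StripDecay c fun z => g z - principalPart n a b z)
    (hreal : ∀ t : ℝ, 0 < t → (g (t * Complex.I)).im = 0) {s : ℝ} (hs : 0 ≤ s) :
    (profile κ ε h s).im = 0 := by
  have hpos : 0 < c / (2 * Real.pi) := div_pos H.pos (by positivity)
  have hopen : IsOpen {s : ℂ | -(c / (2 * Real.pi)) < s.re} :=
    isOpen_lt continuous_const Complex.continuous_re
  have hn : -(c / (2 * Real.pi)) ≤ 2 * n := by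
    have : (0 : ℝ) ≤ 2 * n := by positivity
    linarith
  -- Schwarz reflection: the conjugate of the profile at the conjugate point is again holomorphic,
  -- and it agrees with the profile for s > 2n, where the Laplace integral is real.
  have key := eqOn_of_eq_on_ray
    (G := fun s => (starRingEnd ℂ) (profile κ ε h ((starRingEnd ℂ) s))) hn
    H.differentiableOn_profile ?_ ?_
    (show (s : ℂ) ∈ {s : ℂ | -(c / (2 * Real.pi)) < s.re} by
      simp only [mem_ofPred_eq, Complex.ofReal_re]; linarith)
  · simp only [Complex.conj_ofReal] at key
    exact Complex.conj_eq_iff_im.1 key.symm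
  · intro z hz
    have hz' : (starRingEnd ℂ) z ∈ {s : ℂ | -(c / (2 * Real.pi)) < s.re} := by
      simpa using hz
    have := (H.differentiableOn_profile.differentiableAt (hopen.mem_nhds hz')).conj_conj
    rw [Complex.conj_conj] at this
    exact this.differentiableWithinAt
  · intro s hs
    have hs0 : 0 ≤ s := le_trans (by positivity) hs.le
    obtain ⟨c', hc', hgc'⟩ := stripDecay_growth H.pos hg hs
    rw [Complex.conj_ofReal, (profile_eq_laplace H hs0 hc' hgc').2, map_mul, ← integral_conj,
      map_pow, ← Complex.sin_conj]
    congr 1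
    · rw [map_div₀, map_mul, Complex.conj_ofReal, Complex.conj_ofReal, map_ofNat]
    · refine setIntegral_congr_fun measurableSet_Ioi fun t ht => ?_
      simp only [map_mul, Complex.conj_ofReal, Complex.conj_eq_iff_im.2 (hreal t ht)]

end ProfileValues

/-! ### Linear systems, and quasimodular forms of level one. -/

section LinearAlgebra

/-- A homogeneous linear system with more unknowns than equations, the unknowns in two groups. -/
lemma exists_pair_combination (u v : ℕ → ℕ → ℚ) {p q N : ℕ} (h : N < p + q) :
    ∃ α γ : ℕ → ℚ, ((∃ i < p, α i ≠ 0) ∨ ∃ i < q, γ i ≠ 0) ∧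
      ∀ k < N, ∑ i ∈ Finset.range p, α i * u i k + ∑ i ∈ Finset.range q, γ i * v i k = 0 := by
  let L : ((Fin p → ℚ) × (Fin q → ℚ)) →ₗ[ℚ] (Fin N → ℚ) :=
    LinearMap.coprod
      (LinearMap.pi fun k => ∑ i : Fin p, (u i k) • LinearMap.proj i)
      (LinearMap.pi fun k => ∑ i : Fin q, (v i k) • LinearMap.proj i)
  have hL : LinearMap.ker L ≠ ⊥ := by
    apply LinearMap.ker_ne_bot_of_finrank_lt
    simpa [Module.finrank_prod] using h
  obtain ⟨⟨x, y⟩, hxy, hne⟩ := Submodule.exists_mem_ne_zero_of_ne_bot hL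
  refine ⟨fun i => if hi : i < p then x ⟨i, hi⟩ else 0,
    fun i => if hi : i < q then y ⟨i, hi⟩ else 0, ?_, fun k hk => ?_⟩
  · by_contra! hcon
    apply hne
    ext i
    · simpa using hcon.1 i i.2
    · simpa using hcon.2 i i.2
  · have := congrFun (LinearMap.mem_ker.1 hxy) ⟨k, hk⟩
    simp only [L, LinearMap.coprod_apply, Pi.add_apply, LinearMap.pi_apply, LinearMap.sum_apply,
      LinearMap.smul_apply, LinearMap.proj_apply, smul_eq_mul, Pi.zero_apply] at this
    rw [← this, Finset.sum_range, Finset.sum_range]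
    simp [mul_comm]

/-- The order of a combination of power series whose orders are `0, 1, 2, …`. -/
lemma exists_sum_eq_X_pow_mul {J : ℕ} {α : ℕ → ℚ} {U : ℕ → PowerSeries ℚ}
    (hU : ∀ i, PowerSeries.constantCoeff (U i) ≠ 0) (hα : ∃ i < J, α i ≠ 0) :
    ∃ j < J, ∃ T : PowerSeries ℚ, PowerSeries.constantCoeff T ≠ 0 ∧
      ∑ i ∈ Finset.range J, PowerSeries.C (α i) * (PowerSeries.X ^ i * U i) =
        PowerSeries.X ^ j * T := by
  classical
  obtain ⟨hj, hαj⟩ := Nat.find_spec hα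
  have hmin : ∀ i < Nat.find hα, α i = 0 := fun i hi => by
    have := Nat.find_min hα hi
    by_contra h
    exact this ⟨hi.trans hj, h⟩
  set j := Nat.find hα
  obtain ⟨r, hr⟩ : ∃ r, J = j + (r + 1) := ⟨J - j - 1, by omega⟩
  refine ⟨j, hj, ∑ i ∈ Finset.range (r + 1),
    PowerSeries.C (α (j + i)) * (PowerSeries.X ^ i * U (j + i)), ?_, ?_⟩
  · rw [Finset.sum_range_succ']
    simp [hαj, hU]
  · rw [hr, Finset.sum_range_add, Finset.mul_sum,
      Finset.sum_eq_zero fun i hi => by rw [hmin i (Finset.mem_range.1 hi)]; simp, zero_add]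
    refine Finset.sum_congr rfl fun i _ => ?_
    rw [pow_add]; ring

lemma eisensteinQ_eq (c : ℚ) (k : ℕ) : ∃ e : PowerSeries ℚ, PowerSeries.constantCoeff e = c ∧
    eisensteinQ c k = 1 + PowerSeries.X * e := by
  refine ⟨PowerSeries.mk fun m => c * (ArithmeticFunction.sigma k (m + 1) : ℚ), by simp, ?_⟩
  ext m
  cases m with
  | zero => simp [eisensteinQ]
  | succ m => simp [eisensteinQ, PowerSeries.coeff_succ_X_mul, PowerSeries.coeff_one]

lemma constantCoeff_eisensteinQ (c : ℚ) (k : ℕ) :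
    PowerSeries.constantCoeff (eisensteinQ c k) = 1 := by
  simp [eisensteinQ]

/-- The constant term is 1 because 3·240 + 2·504 = 1728. Thus Δ/q is a unit in the power series
ring. -/
lemma exists_deltaq_eq : ∃ δ : PowerSeries ℚ, PowerSeries.constantCoeff δ = 1 ∧
    deltaq = PowerSeries.X * δ := by
  obtain ⟨e4, h4, H4⟩ := eisensteinQ_eq 240 3
  obtain ⟨e6, h6, H6⟩ := eisensteinQ_eq (-504) 5
  refine ⟨PowerSeries.C (1 / 1728 : ℚ) * (3 * e4 + 3 * PowerSeries.X * e4 ^ 2 +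
    PowerSeries.X ^ 2 * e4 ^ 3 - 2 * e6 - PowerSeries.X * e6 ^ 2), ?_, ?_⟩
  · simp [h4, h6, map_ofNat]; norm_num
  · rw [deltaq, E4q, E6q, H4, H6]; ring

/-- `Δ` as a polynomial in `E₄` and `E₆`. -/
def deltaPoly : MvPolynomial (Fin 2) ℚ :=
  MvPolynomial.C (1 / 1728) * (MvPolynomial.X 0 ^ 3 - MvPolynomial.X 1 ^ 2)

lemma aeval_deltaPoly : MvPolynomial.aeval ![E4q, E6q] deltaPoly = deltaq := by
  simp [deltaPoly, deltaq]

lemma isLevelOneWeight_deltaPoly : IsLevelOneWeight deltaPoly 12 := by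
  have h := (MvPolynomial.isWeightedHomogeneous_C (![4, 6] : Fin 2 → ℤ) (1 / 1728 : ℚ)).mul
    (((MvPolynomial.isWeightedHomogeneous_X ℚ (![4, 6] : Fin 2 → ℤ) 0).pow 3).sub
      (n := 12) ((MvPolynomial.isWeightedHomogeneous_X ℚ (![4, 6] : Fin 2 → ℤ) 1).pow 2))
  exact h

/-- The quasimodular forms of depth two: a pair `(A, C)` for which `A + C E₂²` vanishes to high
order at infinity. -/
theorem exists_levelOne_pair {l n : ℕ} (hn : 4 * l + 1 ≤ n) :
    ∃ A C : MvPolynomial (Fin 2) ℚ,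
      IsLevelOneWeight A (12 * n - (2 * l : ℕ) + 4) ∧ IsLevelOneWeight C (12 * n - (2 * l : ℕ)) ∧
      PowerSeries.X ^ (n + 1) ∣ MvPolynomial.aeval ![E4q, E6q] A +
        MvPolynomial.aeval ![E4q, E6q] C * E2q ^ 2 ∧
      ∃ j, 1 ≤ j ∧ j ≤ n ∧ ∃ T : PowerSeries ℚ, PowerSeries.constantCoeff T ≠ 0 ∧
        MvPolynomial.aeval ![E4q, E6q] C = PowerSeries.X ^ j * T := by
  -- The weight of C becomes 12J + 22l: the factor M below carries 22l, and the products E₄^{3(J-i)}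
  -- Δⁱ carry 12J.
  obtain ⟨J, rfl⟩ : ∃ J, n = J + 2 * l := ⟨n - 2 * l, by omega⟩
  obtain ⟨δ, hδ, hδ'⟩ := exists_deltaq_eq
  set M : MvPolynomial (Fin 2) ℚ := MvPolynomial.X 0 ^ (4 * l) * MvPolynomial.X 1 ^ l with hM
  have hMw : IsLevelOneWeight M (22 * l) := by
    have := ((MvPolynomial.isWeightedHomogeneous_X ℚ (![4, 6] : Fin 2 → ℤ) 0).pow (4 * l)).mul
      ((MvPolynomial.isWeightedHomogeneous_X ℚ (![4, 6] : Fin 2 → ℤ) 1).pow l)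
    convert! this using 1
    simp; ring
  set m : PowerSeries ℚ := E4q ^ (4 * l) * E6q ^ l with hm
  have hMm : MvPolynomial.aeval ![E4q, E6q] M = m := by simp [hM, hm]
  have hE4 : PowerSeries.constantCoeff E4q = 1 := constantCoeff_eisensteinQ _ _
  have hE6 : PowerSeries.constantCoeff E6q = 1 := constantCoeff_eisensteinQ _ _
  have hE2 : PowerSeries.constantCoeff E2q = 1 := constantCoeff_eisensteinQ _ _
  have hm1 : PowerSeries.constantCoeff m = 1 := by simp [hm, hE4, hE6]
  have hw : ∀ i ≤ J, IsLevelOneWeight (MvPolynomial.X 0 ^ (3 * (J - i)) * deltaPoly ^ i)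
      (12 * J) := by
    intro i hi
    have := ((MvPolynomial.isWeightedHomogeneous_X ℚ (![4, 6] : Fin 2 → ℤ) 0).pow (3 * (J - i))).mul
      (isLevelOneWeight_deltaPoly.pow i)
    convert! this using 1
    obtain ⟨r, rfl⟩ := Nat.exists_eq_add_of_le hi
    simp; ring
  -- There are 2J + 1 unknowns for the n + 1 = J + 2l + 1 coefficients that must vanish; J > 2l is
  -- the hypothesis on n. The exponents i + 1 in the second family make C divisible by Δ.
  obtain ⟨α, γ, hne, hsol⟩ := exists_pair_combination
    (fun i k => PowerSeries.coeff k (m * E4q * E4q ^ (3 * (J - i)) * deltaq ^ i))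
    (fun i k => PowerSeries.coeff k (m * E2q ^ 2 * E4q ^ (3 * (J - (i + 1))) * deltaq ^ (i + 1)))
    (p := J + 1) (q := J) (N := J + 2 * l + 1) (by omega)
  have hdvd : PowerSeries.X ^ (J + 2 * l + 1) ∣
      ∑ i ∈ Finset.range (J + 1), PowerSeries.C (α i) *
        (m * E4q * E4q ^ (3 * (J - i)) * deltaq ^ i) +
      ∑ i ∈ Finset.range J, PowerSeries.C (γ i) *
        (m * E2q ^ 2 * E4q ^ (3 * (J - (i + 1))) * deltaq ^ (i + 1)) := by
    rw [PowerSeries.X_pow_dvd_iff]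
    intro k hk
    simp only [map_add, map_sum, PowerSeries.coeff_C_mul]
    exact hsol k hk
  -- If every γ i vanished, A alone would be divisible by q^{n+1}, but its order in q is the least i
  -- with α i ≠ 0, which is at most J.
  have hγ : ∃ i < J, γ i ≠ 0 := by
    by_contra! hcon
    rw [Finset.sum_eq_zero (s := Finset.range J) fun i hi => by
      rw [hcon i (Finset.mem_range.1 hi)]; simp, add_zero] at hdvd
    obtain ⟨j, hj, T, hT, hS⟩ := exists_sum_eq_X_pow_mul
      (U := fun i => m * E4q * E4q ^ (3 * (J - i)) * δ ^ i) (fun i => by simp [hm1, hE4, hδ])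
      (hne.resolve_right fun ⟨i, hi, hi'⟩ => hi' (hcon i hi))
    have e : ∀ i, PowerSeries.X ^ i * (m * E4q * E4q ^ (3 * (J - i)) * δ ^ i) =
        m * E4q * E4q ^ (3 * (J - i)) * deltaq ^ i := fun i => by rw [hδ', mul_pow]; ring
    simp only [e] at hS
    rw [hS, PowerSeries.X_pow_dvd_iff] at hdvd
    have := hdvd j (by omega)
    rw [PowerSeries.coeff_X_pow_mul', if_pos le_rfl, Nat.sub_self] at this
    exact hT (by simpa using this)
  obtain ⟨j, hj, T, hT, hS⟩ := exists_sum_eq_X_pow_mul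
    (U := fun i => m * E4q ^ (3 * (J - (i + 1))) * δ ^ (i + 1)) (fun i => by simp [hm1, hE4, hδ])
    hγ
  refine ⟨M * MvPolynomial.X 0 * ∑ i ∈ Finset.range (J + 1), MvPolynomial.C (α i) *
      (MvPolynomial.X 0 ^ (3 * (J - i)) * deltaPoly ^ i),
    M * ∑ i ∈ Finset.range J, MvPolynomial.C (γ i) *
      (MvPolynomial.X 0 ^ (3 * (J - (i + 1))) * deltaPoly ^ (i + 1)), ?_, ?_, ?_,
    j + 1, by omega, by omega, T, hT, ?_⟩
  · have := (hMw.mul (MvPolynomial.isWeightedHomogeneous_X ℚ (![4, 6] : Fin 2 → ℤ) 0)).mul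
      (MvPolynomial.IsWeightedHomogeneous.sum (Finset.range (J + 1)) _ (12 * J : ℤ) fun i hi =>
        (zero_add (12 * J : ℤ)) ▸ (MvPolynomial.isWeightedHomogeneous_C _ (α i)).mul
          (hw i (Nat.lt_succ_iff.1 (Finset.mem_range.1 hi))))
    convert! this using 1
    simp; ring
  · have := hMw.mul
      (MvPolynomial.IsWeightedHomogeneous.sum (Finset.range J) _ (12 * J : ℤ) fun i hi =>
        (zero_add (12 * J : ℤ)) ▸ (MvPolynomial.isWeightedHomogeneous_C _ (γ i)).mul
          (hw (i + 1) (Finset.mem_range.1 hi)))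
    convert! this using 1
    simp; ring
  · convert hdvd using 1
    simp only [map_mul, map_sum, map_pow, hMm, aeval_deltaPoly, MvPolynomial.aeval_X,
      MvPolynomial.aeval_C, PowerSeries.algebraMap_apply, Finset.mul_sum, Finset.sum_mul]
    congr 1 <;> refine Finset.sum_congr rfl fun i _ => ?_ <;> simp <;> ring
  · rw [pow_succ', mul_assoc (PowerSeries.X : PowerSeries ℚ), ← hS]
    simp only [map_mul, map_sum, map_pow, hMm, aeval_deltaPoly, MvPolynomial.aeval_X,
      MvPolynomial.aeval_C, PowerSeries.algebraMap_apply, Finset.mul_sum, hδ']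
    refine Finset.sum_congr rfl fun i _ => ?_
    simp; ring

end LinearAlgebra

/-! ### Level two forms as polynomials in V and W. -/

section LevelTwo

/-- `E₄` as a polynomial in `V` and `W`. -/
def thetaG4 : MvPolynomial (Fin 2) ℚ :=
  MvPolynomial.X 0 ^ 2 + MvPolynomial.X 0 * MvPolynomial.X 1 + MvPolynomial.X 1 ^ 2

/-- The polynomial `2V + W`. -/
def thetaY : MvPolynomial (Fin 2) ℚ := MvPolynomial.C 2 * MvPolynomial.X 0 + MvPolynomial.X 1

/-- `-2 E₆` as a polynomial in `V` and `W`. -/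
def thetaG6 : MvPolynomial (Fin 2) ℚ :=
  thetaY * (MvPolynomial.X 0 - MvPolynomial.X 1) *
    (MvPolynomial.X 0 + MvPolynomial.C 2 * MvPolynomial.X 1)

/-- `256 Δ` as a polynomial in `V` and `W`. -/
def thetaD : MvPolynomial (Fin 2) ℚ :=
  (MvPolynomial.X 0 * MvPolynomial.X 1 * (MvPolynomial.X 0 + MvPolynomial.X 1)) ^ 2

/-- A family of solutions `R` of `R(V, W) = R(-V, V + W) + R(-W, -V)`. -/
def levelTwoFamily (l J : ℕ) (α γ : ℕ → ℚ) : MvPolynomial (Fin 2) ℚ :=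
  MvPolynomial.X 1 * (thetaG4 ^ (10 * l + 1) * thetaG6 ^ l) *
    (thetaG4 ^ 2 * ∑ i ∈ Finset.range (J + 1), MvPolynomial.C (α i) *
        (thetaG4 ^ (3 * (J - i)) * thetaD ^ i) +
      thetaY * thetaG6 * ∑ i ∈ Finset.range (J + 1), MvPolynomial.C (γ i) *
        (thetaG4 ^ (3 * (J - i)) * thetaD ^ i))

lemma isLevelTwoWeight_levelTwoFamily (l J : ℕ) (α γ : ℕ → ℚ) :
    IsLevelTwoWeight (levelTwoFamily l J α γ) (12 * J + 46 * l + 14) := by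
  set w : Fin 2 → ℤ := ![2, 2] with hw
  have h0 : MvPolynomial.IsWeightedHomogeneous w (MvPolynomial.X 0 : MvPolynomial (Fin 2) ℚ) 2 :=
    MvPolynomial.isWeightedHomogeneous_X ℚ w 0
  have h1 : MvPolynomial.IsWeightedHomogeneous w (MvPolynomial.X 1 : MvPolynomial (Fin 2) ℚ) 2 :=
    MvPolynomial.isWeightedHomogeneous_X ℚ w 1
  have hc : ∀ (r : ℚ) {P : MvPolynomial (Fin 2) ℚ} {m : ℤ},
      MvPolynomial.IsWeightedHomogeneous w P m →
      MvPolynomial.IsWeightedHomogeneous w (MvPolynomial.C r * P) m := fun r P m h => by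
    simpa using (MvPolynomial.isWeightedHomogeneous_C w r).mul h
  have h4 : MvPolynomial.IsWeightedHomogeneous w thetaG4 4 :=
    ((h0.pow 2).add (h0.mul h1)).add (h1.pow 2)
  have hY : MvPolynomial.IsWeightedHomogeneous w thetaY 2 := (hc 2 h0).add h1
  have h6 : MvPolynomial.IsWeightedHomogeneous w thetaG6 6 :=
    (hY.mul (h0.sub h1)).mul (h0.add (hc 2 h1))
  have hD : MvPolynomial.IsWeightedHomogeneous w thetaD 12 := ((h0.mul h1).mul (h0.add h1)).pow 2
  have hs : ∀ β : ℕ → ℚ, MvPolynomial.IsWeightedHomogeneous w (∑ i ∈ Finset.range (J + 1),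
      MvPolynomial.C (β i) * (thetaG4 ^ (3 * (J - i)) * thetaD ^ i)) (12 * J : ℤ) := fun β => by
    refine MvPolynomial.IsWeightedHomogeneous.sum _ _ _ fun i hi => hc _ ?_
    obtain ⟨r, hr⟩ := Nat.exists_eq_add_of_le (Nat.lt_succ_iff.1 (Finset.mem_range.1 hi))
    convert! (h4.pow (3 * (J - i))).mul (hD.pow i) using 1
    rw [hr]
    simp; ring
  have hA := (h4.pow 2).mul (hs α)
  have hB := (hY.mul h6).mul (hs γ)
  convert! (h1.mul ((h4.pow (10 * l + 1)).mul (h6.pow l))).mul (hA.add hB) using 1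
  simp; ring

variable (v w : ℂ)

lemma aeval_thetaG4 : MvPolynomial.aeval ![v, w] thetaG4 = v ^ 2 + v * w + w ^ 2 := by
  simp [thetaG4]

lemma aeval_thetaY : MvPolynomial.aeval ![v, w] thetaY = 2 * v + w := by
  simp [thetaY]

lemma aeval_thetaG6 :
    MvPolynomial.aeval ![v, w] thetaG6 = (2 * v + w) * (v - w) * (v + 2 * w) := by
  simp [thetaG6, aeval_thetaY]

lemma aeval_thetaD : MvPolynomial.aeval ![v, w] thetaD = (v * w * (v + w)) ^ 2 := by
  simp [thetaD]

lemma aeval_levelTwoFamily (l J : ℕ) (α γ : ℕ → ℚ) :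
    MvPolynomial.aeval ![v, w] (levelTwoFamily l J α γ) =
      w * ((v ^ 2 + v * w + w ^ 2) ^ (10 * l + 1) *
        ((2 * v + w) * (v - w) * (v + 2 * w)) ^ l) *
      ((v ^ 2 + v * w + w ^ 2) ^ 2 * ∑ i ∈ Finset.range (J + 1), (α i : ℂ) *
        ((v ^ 2 + v * w + w ^ 2) ^ (3 * (J - i)) * ((v * w * (v + w)) ^ 2) ^ i) +
      (2 * v + w) * ((2 * v + w) * (v - w) * (v + 2 * w)) * ∑ i ∈ Finset.range (J + 1), (γ i : ℂ) *
        ((v ^ 2 + v * w + w ^ 2) ^ (3 * (J - i)) * ((v * w * (v + w)) ^ 2) ^ i)) := by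
  simp only [levelTwoFamily, map_mul, map_add, map_sum, map_pow, aeval_thetaG4, aeval_thetaY,
    aeval_thetaG6, aeval_thetaD, MvPolynomial.aeval_X, MvPolynomial.aeval_C, eq_ratCast]
  simp

/-- G₄, G₆ and D are unchanged by both substitutions, so the relation is linear over them. It then
reduces to the two basic solutions W and W(2V + W). -/
lemma aeval_levelTwoFamily_relation (l J : ℕ) (α γ : ℕ → ℚ) :
    MvPolynomial.aeval ![v, w] (levelTwoFamily l J α γ) =
      MvPolynomial.aeval ![-v, v + w] (levelTwoFamily l J α γ) +
      MvPolynomial.aeval ![-w, -v] (levelTwoFamily l J α γ) := by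
  simp only [aeval_levelTwoFamily]
  have e1 : (-v) ^ 2 + -v * (v + w) + (v + w) ^ 2 = v ^ 2 + v * w + w ^ 2 := by ring
  have e2 : (-w) ^ 2 + -w * -v + (-v) ^ 2 = v ^ 2 + v * w + w ^ 2 := by ring
  have e3 : (2 * -v + (v + w)) * (-v - (v + w)) * (-v + 2 * (v + w)) =
    (2 * v + w) * (v - w) * (v + 2 * w) := by ring
  have e4 : (2 * -w + -v) * (-w - -v) * (-w + 2 * -v) = (2 * v + w) * (v - w) * (v + 2 * w) := by
    ring
  have e5 : (-v * (v + w) * (-v + (v + w))) ^ 2 = (v * w * (v + w)) ^ 2 := by ring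
  have e6 : (-w * -v * (-w + -v)) ^ 2 = (v * w * (v + w)) ^ 2 := by ring
  simp only [e1, e2, e3, e4, e5, e6]
  ring

/-- The polynomial governing the order of vanishing of `R(-W, -V)` in `V² / (2W + V)²`. -/
def vanishingPoly (J : ℕ) (α γ : ℕ → ℚ) : Polynomial ℚ :=
  ∑ i ∈ Finset.range (J + 1), α i • ((Polynomial.C (1 / 4) * (1 + 3 * Polynomial.X)) ^ 2 *
      (Polynomial.C (1 / 4) * (1 + 3 * Polynomial.X)) ^ (3 * (J - i)) *
      (Polynomial.C (1 / 16) * (Polynomial.X * (1 - Polynomial.X) ^ 2)) ^ i) +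
  ∑ i ∈ Finset.range (J + 1), γ i • (Polynomial.C (1 / 4) * (1 - 9 * Polynomial.X) *
      (Polynomial.C (1 / 4) * (1 + 3 * Polynomial.X)) ^ (3 * (J - i)) *
      (Polynomial.C (1 / 16) * (Polynomial.X * (1 - Polynomial.X) ^ 2)) ^ i)

lemma aeval_vanishingPoly (J : ℕ) (α γ : ℕ → ℚ) (t : ℂ) :
    Polynomial.aeval t (vanishingPoly J α γ) =
      ((1 + 3 * t) / 4) ^ 2 * ∑ i ∈ Finset.range (J + 1), (α i : ℂ) *
        (((1 + 3 * t) / 4) ^ (3 * (J - i)) * (t * (1 - t) ^ 2 / 16) ^ i) +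
      (1 - 9 * t) / 4 * ∑ i ∈ Finset.range (J + 1), (γ i : ℂ) *
        (((1 + 3 * t) / 4) ^ (3 * (J - i)) * (t * (1 - t) ^ 2 / 16) ^ i) := by
  have h3 : Polynomial.aeval t (3 : Polynomial ℚ) = 3 := map_ofNat _ 3
  have h9 : Polynomial.aeval t (9 : Polynomial ℚ) = 9 := map_ofNat _ 9
  simp only [vanishingPoly, map_add, map_sum, map_smul, map_mul, map_pow, map_sub, map_one,
    Polynomial.aeval_X, Polynomial.aeval_C, h3, h9, eq_ratCast, Finset.mul_sum, Rat.smul_def]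
  congr 1 <;> refine Finset.sum_congr rfl fun i _ => ?_ <;> push_cast <;> ring

/-- In terms of y = 2W + V the invariants are powers of y times polynomials in t = (V/y)². At i∞, V
is of order q^{1/2} and y tends to 2, so the order of vanishing at the cusp can be read from
divisibility by powers of t. -/
lemma aeval_levelTwoFamily_S (l J : ℕ) (α γ : ℕ → ℚ) (h : 2 * w + v ≠ 0) :
    MvPolynomial.aeval ![-w, -v] (levelTwoFamily l J α γ) =
      -v * (((1 + 3 * (v / (2 * w + v)) ^ 2) / 4) ^ (10 * l + 1) *
        (-((1 - 9 * (v / (2 * w + v)) ^ 2) / 4)) ^ l) * (2 * w + v) ^ (23 * l + 6 * J + 6) *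
      Polynomial.aeval ((v / (2 * w + v)) ^ 2) (vanishingPoly J α γ) := by
  set y := 2 * w + v with hy
  set t := (v / y) ^ 2 with ht
  have htv : t * y ^ 2 = v ^ 2 := by rw [ht]; field_simp
  have hw : w = (y - v) / 2 := by rw [hy]; ring
  have e4 : (-w) ^ 2 + -w * -v + (-v) ^ 2 = y ^ 2 * ((1 + 3 * t) / 4) := by
    rw [hw]; linear_combination (-3 / 4 : ℂ) * htv
  have e6 : (2 * -w + -v) * (-w - -v) * (-w + 2 * -v) = y ^ 3 * -((1 - 9 * t) / 4) := by
    rw [hw]; linear_combination (-9 / 4 * y : ℂ) * htv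
  have eD : (-w * -v * (-w + -v)) ^ 2 = y ^ 6 * (t * (1 - t) ^ 2 / 16) := by
    have : y ^ 6 * (t * (1 - t) ^ 2 / 16) = (t * y ^ 2) * (y ^ 2 - t * y ^ 2) ^ 2 / 16 := by ring
    rw [this, htv, hw]; ring
  have eY : 2 * -w + -v = -y := by rw [hy]; ring
  rw [aeval_levelTwoFamily, aeval_vanishingPoly, e4, e6, eD, eY]
  have es : ∀ β : ℕ → ℚ, ∑ i ∈ Finset.range (J + 1), (β i : ℂ) *
      ((y ^ 2 * ((1 + 3 * t) / 4)) ^ (3 * (J - i)) * (y ^ 6 * (t * (1 - t) ^ 2 / 16)) ^ i) =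
      y ^ (6 * J) * ∑ i ∈ Finset.range (J + 1), (β i : ℂ) *
      (((1 + 3 * t) / 4) ^ (3 * (J - i)) * (t * (1 - t) ^ 2 / 16) ^ i) := fun β => by
    rw [Finset.mul_sum]
    refine Finset.sum_congr rfl fun i hi => ?_
    obtain ⟨r, hr⟩ := Nat.exists_eq_add_of_le (Nat.lt_succ_iff.1 (Finset.mem_range.1 hi))
    rw [show J - i = r by omega, hr, mul_pow, mul_pow, ← pow_mul, ← pow_mul]
    ring
  rw [es, es, mul_pow _ _ (10 * l + 1), mul_pow _ _ l, ← pow_mul, ← pow_mul]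
  ring

lemma sum_range_add_of_zero {M : Type*} [AddCommMonoid M] {f : ℕ → M} {j : ℕ}
    (h : ∀ i < j, f i = 0) (r : ℕ) :
    ∑ i ∈ Finset.range (j + r), f i = ∑ i ∈ Finset.range r, f (j + i) := by
  rw [Finset.sum_range_add, Finset.sum_eq_zero fun i hi => h i (Finset.mem_range.1 hi), zero_add]

/-- The weakly holomorphic forms of level two. -/
theorem exists_levelTwo (l : ℕ) :
    ∃ n, 4 * l + 1 ≤ n ∧ ∃ R : MvPolynomial (Fin 2) ℚ,
      IsLevelTwoWeight R (12 * n - (2 * l : ℕ) + 2) ∧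
      (∀ v w : ℂ, MvPolynomial.aeval ![v, w] R =
        MvPolynomial.aeval ![-v, v + w] R + MvPolynomial.aeval ![-w, -v] R) ∧
      MvPolynomial.aeval ![(0 : ℂ), 1] R ≠ 0 ∧
      ∃ K, ∀ v w : ℂ, ‖v‖ ≤ 1 / 4 → ‖w - 1‖ ≤ 1 / 4 →
        ‖MvPolynomial.aeval ![-w, -v] R‖ ≤ K * ‖v‖ ^ (2 * n + 1) := by
  classical
  -- There are 8l + 2 unknowns and 8l + 1 equations.
  obtain ⟨α, γ, hne, hsol⟩ := exists_pair_combination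
    (fun i k => ((Polynomial.C (1 / 4) * (1 + 3 * Polynomial.X)) ^ 2 *
      (Polynomial.C (1 / 4) * (1 + 3 * Polynomial.X)) ^ (3 * (4 * l - i)) *
      (Polynomial.C (1 / 16) * (Polynomial.X * (1 - Polynomial.X) ^ 2)) ^ i : Polynomial ℚ).coeff k)
    (fun i k => (Polynomial.C (1 / 4) * (1 - 9 * Polynomial.X) *
      (Polynomial.C (1 / 4) * (1 + 3 * Polynomial.X)) ^ (3 * (4 * l - i)) *
      (Polynomial.C (1 / 16) * (Polynomial.X * (1 - Polynomial.X) ^ 2)) ^ i : Polynomial ℚ).coeff k)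
    (p := 4 * l + 1) (q := 4 * l + 1) (N := 8 * l + 1) (by omega)
  have hdvd : Polynomial.X ^ (8 * l + 1) ∣ vanishingPoly (4 * l) α γ := by
    rw [Polynomial.X_pow_dvd_iff]
    intro k hk
    simp only [vanishingPoly, Polynomial.coeff_add, Polynomial.finsetSum_coeff,
      Polynomial.coeff_smul, smul_eq_mul]
    exact hsol k hk
  have hne' : ∃ i, i < 4 * l + 1 ∧ (α i ≠ 0 ∨ γ i ≠ 0) := by
    rcases hne with ⟨i, hi, h⟩ | ⟨i, hi, h⟩
    exacts [⟨i, hi, Or.inl h⟩, ⟨i, hi, Or.inr h⟩]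
  -- Let j be the least index with α j or γ j nonzero, and divide by Dʲ. Both 4l and the order 8l +
  -- 1 in t decrease by j, so with J = 4l - j the required order is n = J + 4l + 1, and the new
  -- leading pair is nonzero.
  obtain ⟨hj, hαj⟩ := Nat.find_spec hne'
  have hmin : ∀ i < Nat.find hne', α i = 0 ∧ γ i = 0 := fun i hi => by
    have := Nat.find_min hne' hi
    by_contra h
    exact this ⟨hi.trans hj, by tauto⟩
  set j := Nat.find hne'
  obtain ⟨J, hJ⟩ : ∃ J, 4 * l = j + J := ⟨4 * l - j, by omega⟩
  set α' : ℕ → ℚ := fun i => α (j + i) with hα'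
  set γ' : ℕ → ℚ := fun i => γ (j + i) with hγ'
  have hstrip : vanishingPoly (4 * l) α γ =
      Polynomial.X ^ j * ((Polynomial.C (1 / 16) * (1 - Polynomial.X) ^ 2) ^ j *
        vanishingPoly J α' γ') := by
    have e : Polynomial.X ^ j * (Polynomial.C (1 / 16) * (1 - Polynomial.X) ^ 2) ^ j =
      (Polynomial.C (1 / 16) * (Polynomial.X * (1 - Polynomial.X) ^ 2) : Polynomial ℚ) ^ j := by
      rw [← mul_pow]; ring
    rw [← mul_assoc, e, vanishingPoly, vanishingPoly, hJ, add_assoc j J 1,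
      sum_range_add_of_zero (j := j) (fun i hi => by rw [(hmin i hi).1, zero_smul]) (J + 1),
      sum_range_add_of_zero (j := j) (fun i hi => by rw [(hmin i hi).2, zero_smul]) (J + 1),
      mul_add ((Polynomial.C (1 / 16) * (Polynomial.X * (1 - Polynomial.X) ^ 2) : Polynomial ℚ) ^ j),
      Finset.mul_sum, Finset.mul_sum]
    congr 1 <;> refine Finset.sum_congr rfl fun i _ => ?_ <;>
      rw [Nat.add_sub_add_left, mul_smul_comm, pow_add] <;> congr 1 <;> ring
  have hdvd' : Polynomial.X ^ (J + 4 * l + 1) ∣ vanishingPoly J α' γ' := by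
    have h1 : Polynomial.X ^ (J + 4 * l + 1) ∣
        (Polynomial.C (1 / 16) * (1 - Polynomial.X) ^ 2) ^ j * vanishingPoly J α' γ' := by
      rw [hstrip, show 8 * l + 1 = j + (J + 4 * l + 1) by omega, pow_add] at hdvd
      exact (mul_dvd_mul_iff_left (pow_ne_zero _ Polynomial.X_ne_zero)).1 hdvd
    refine IsCoprime.dvd_of_dvd_mul_left ?_ h1
    refine IsCoprime.pow (IsCoprime.mul_right ?_ (IsCoprime.pow_right ?_))
    · exact ⟨0, Polynomial.C 16, by rw [← Polynomial.C_mul]; norm_num⟩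
    · exact ⟨1, 1, by ring⟩
  obtain ⟨Q, hQ⟩ := hdvd'
  -- Vanishing at t = 0 forces this relation. At (V, W) = (0, 1) the last factor of R is α' 0 - 2 γ'
  -- 0 = -6 γ' 0, so the relation also yields R(0, 1) ≠ 0.
  have h0 : α' 0 = -4 * γ' 0 := by
    have := congrArg (Polynomial.aeval (0 : ℂ)) hQ
    rw [aeval_vanishingPoly, Finset.sum_range_succ', Finset.sum_range_succ'] at this
    simp [pow_succ] at this
    have h4 : (((4 : ℂ) ^ (3 * J))⁻¹) ≠ 0 := inv_ne_zero (pow_ne_zero _ (by norm_num))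
    have h5 : ((α' 0 : ℂ) + 4 * γ' 0) * (((4 : ℂ) ^ (3 * J))⁻¹) = 0 := by
      linear_combination 16 * this
    have h6 := (mul_eq_zero.1 h5).resolve_right h4
    have h7 : α' 0 + 4 * γ' 0 = 0 := by exact_mod_cast h6
    linarith
  have hγ0 : γ' 0 ≠ 0 := by
    intro h
    rw [h, mul_zero] at h0
    exact hαj.elim (fun h' => h' h0) (fun h' => h' h)
  refine ⟨J + 4 * l + 1, by omega, levelTwoFamily l J α' γ', ?_,
    fun v w => aeval_levelTwoFamily_relation v w l J α' γ', ?_, ?_⟩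
  · convert! isLevelTwoWeight_levelTwoFamily l J α' γ' using 1
    push_cast; ring
  · rw [aeval_levelTwoFamily, Finset.sum_range_succ', Finset.sum_range_succ']
    simp [pow_succ]
    rw [h0]
    push_cast
    intro h
    have h1 : (γ' 0 : ℂ) = 0 := by linear_combination -h / 6
    exact hγ0 (by exact_mod_cast h1)
  · have hcont : Continuous fun t : ℂ => (((1 + 3 * t) / 4) ^ (10 * l + 1) *
        (-((1 - 9 * t) / 4)) ^ l) * Polynomial.aeval t Q :=
      Continuous.mul (by fun_prop) (Polynomial.continuous_aeval Q)
    obtain ⟨K, hK⟩ := (isCompact_closedBall (0 : ℂ) 1).exists_bound_of_continuousOn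
      hcont.continuousOn
    -- In this range 1 ≤ |2w + v| ≤ 3, hence |t| ≤ |v|². The exponent 2n + 1 comes from tⁿ and the
    -- extra factor v.
    refine ⟨K * 3 ^ (23 * l + 6 * J + 6), fun v w hv hw => ?_⟩
    set N := J + 4 * l + 1 with hN
    have hv3 : ‖2 * w + v‖ ≤ 3 := by
      calc ‖2 * w + v‖ = ‖2 * (w - 1) + 2 + v‖ := by congr 1; ring
        _ ≤ ‖2 * (w - 1)‖ + ‖(2 : ℂ)‖ + ‖v‖ := norm_add₃_le
        _ ≤ 3 := by rw [norm_mul, Complex.norm_ofNat]; linarith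
    have hv1 : 1 ≤ ‖2 * w + v‖ := by
      have : ‖(2 : ℂ)‖ ≤ ‖2 * w + v‖ + ‖2 * (w - 1)‖ + ‖v‖ := by
        calc ‖(2 : ℂ)‖ = ‖(2 * w + v) - 2 * (w - 1) - v‖ := by congr 1; ring
          _ ≤ ‖(2 * w + v) - 2 * (w - 1)‖ + ‖v‖ := norm_sub_le _ _
          _ ≤ _ := by gcongr; exact norm_sub_le _ _
      rw [norm_mul, Complex.norm_ofNat] at this
      linarith
    have hne0 : 2 * w + v ≠ 0 := by
      rw [← norm_pos_iff]; linarith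
    have hquot : ‖v / (2 * w + v)‖ ≤ ‖v‖ := by
      rw [norm_div]; exact div_le_self (norm_nonneg _) hv1
    have ht1 : (v / (2 * w + v)) ^ 2 ∈ Metric.closedBall (0 : ℂ) 1 := by
      rw [mem_closedBall_zero_iff, norm_pow]
      exact pow_le_one₀ (norm_nonneg _) (by linarith)
    have hKt := hK _ ht1
    have hK0 : 0 ≤ K := (norm_nonneg _).trans hKt
    rw [aeval_levelTwoFamily_S v w l J α' γ' hne0, hQ, map_mul, map_pow, Polynomial.aeval_X]
    set t := (v / (2 * w + v)) ^ 2 with ht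
    have htn : ‖t‖ ≤ ‖v‖ ^ 2 := by
      rw [ht, norm_pow]; gcongr
    calc _ = ‖v‖ * ‖(((1 + 3 * t) / 4) ^ (10 * l + 1) *
        (-((1 - 9 * t) / 4)) ^ l) * Polynomial.aeval t Q‖ *
          ‖2 * w + v‖ ^ (23 * l + 6 * J + 6) * ‖t‖ ^ N := by
          simp only [norm_mul, norm_pow, norm_neg]; ring
      _ ≤ ‖v‖ * K * 3 ^ (23 * l + 6 * J + 6) * (‖v‖ ^ 2) ^ N := by gcongr
      _ = _ := by ring

end LevelTwo

/-! ### Expansions in q with rational coefficients. -/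

section QSeries

/-- `f` is the sum of the power series `P` in `q = exp(2πiz)`. -/
def HasQSeries (f : ℍ → ℂ) (P : PowerSeries ℚ) : Prop :=
  ∀ z : ℍ, HasSum (fun m => ((PowerSeries.coeff m P : ℚ) : ℂ) *
    Complex.exp (2 * Real.pi * Complex.I * z) ^ m) (f z)

variable {f g : ℍ → ℂ} {P Q : PowerSeries ℚ}

lemma HasQSeries.add (hf : HasQSeries f P) (hg : HasQSeries g Q) :
    HasQSeries (fun z => f z + g z) (P + Q) := fun z => by
  refine ((hf z).add (hg z)).congr_fun ?_
  intro m; push_cast [map_add]; ring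

lemma hasQSeries_C (r : ℚ) : HasQSeries (fun _ => (r : ℂ)) (PowerSeries.C r) := fun z => by
  convert! hasSum_ite_eq 0 (r : ℂ) using 1
  ext m
  rw [PowerSeries.coeff_C]
  split_ifs with h <;> simp [h]

lemma HasQSeries.mul (hf : HasQSeries f P) (hg : HasQSeries g Q) :
    HasQSeries (fun z => f z * g z) (P * Q) := fun z => by
  have h1 := (hf z).summable.norm
  have h2 := (hg z).summable.norm
  have h3 := (summable_norm_sum_mul_antidiagonal_of_summable_norm h1 h2).of_norm.hasSum
  rw [← tsum_mul_tsum_eq_tsum_sum_antidiagonal_of_summable_norm h1 h2, (hf z).tsum_eq,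
    (hg z).tsum_eq] at h3
  refine h3.congr_fun fun m => ?_
  rw [PowerSeries.coeff_mul]
  push_cast
  rw [Finset.sum_mul]
  refine Finset.sum_congr rfl fun x hx => ?_
  rw [← Finset.HasAntidiagonal.mem_antidiagonal.1 hx, pow_add]
  ring

lemma hasQSeries_X : HasQSeries (fun z => Complex.exp (2 * Real.pi * Complex.I * z))
    PowerSeries.X := fun z => by
  convert! hasSum_ite_eq 1 (Complex.exp (2 * Real.pi * Complex.I * z)) using 1
  ext m
  rw [PowerSeries.coeff_X]
  split_ifs with h <;> simp [h]

lemma HasQSeries.pow (hf : HasQSeries f P) (n : ℕ) : HasQSeries (fun z => f z ^ n) (P ^ n) := by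
  induction n with
  | zero => simpa using hasQSeries_C 1
  | succ n ih => simpa only [pow_succ] using ih.mul hf

lemma HasQSeries.sum {ι : Type*} (s : Finset ι) {f : ι → ℍ → ℂ} {P : ι → PowerSeries ℚ}
    (h : ∀ i, HasQSeries (f i) (P i)) :
    HasQSeries (fun z => ∑ i ∈ s, f i z) (∑ i ∈ s, P i) := by
  classical
  induction s using Finset.induction_on with
  | empty => simpa using hasQSeries_C 0
  | insert i s hi ih => simpa only [Finset.sum_insert hi] using (h i).add ih

lemma HasQSeries.const_mul (hf : HasQSeries f P) (r : ℚ) :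
    HasQSeries (fun z => r * f z) (PowerSeries.C r * P) := (hasQSeries_C r).mul hf

lemma HasQSeries.sub (hf : HasQSeries f P) (hg : HasQSeries g Q) :
    HasQSeries (fun z => f z - g z) (P - Q) := by
  convert! hf.add (hg.const_mul (-1)) using 1
  · ext z; push_cast; ring
  · rw [map_neg, map_one]; ring

lemma HasQSeries.unique (hf : HasQSeries f P) {z w : ℍ}
    (h : Complex.exp (2 * Real.pi * Complex.I * z) = Complex.exp (2 * Real.pi * Complex.I * w)) :
    f z = f w := by
  have := hf z
  rw [h] at this
  exact this.unique (hf w)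

/-- On the imaginary axis q is real, and the coefficients are rational. -/
lemma HasQSeries.im_eq_zero (hf : HasQSeries f P) {z : ℍ} (hz : z.re = 0) : (f z).im = 0 := by
  have hq : Complex.exp (2 * Real.pi * Complex.I * z) =
      ((Real.exp (-(2 * Real.pi * z.im)) : ℝ) : ℂ) := by
    rw [Complex.ofReal_exp]
    congr 1
    have : (z : ℂ) = z.im * Complex.I := by
      apply Complex.ext <;> simp [hz]
    rw [this]
    push_cast
    linear_combination (2 * Real.pi * z.im : ℂ) * Complex.I_sq
  have h := Complex.hasSum_im (hf z)
  rw [hq] at h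
  refine h.unique ?_
  convert! hasSum_zero using 1
  ext m
  rw [← Complex.ofReal_pow, ← Complex.ofReal_ratCast, ← Complex.ofReal_mul, Complex.ofReal_im]

/-- With qᴺ taken out, the series is dominated for Im z ≥ 1 by the sum of its absolute values at z =
i. -/
lemma HasQSeries.exists_bound {N : ℕ} (hf : HasQSeries f P) (hP : PowerSeries.X ^ N ∣ P) :
    ∃ C, ∀ z : ℍ, 1 ≤ z.im → ‖f z‖ ≤ C * Real.exp (-(2 * Real.pi * N) * z.im) := by
  have hnorm : ∀ z : ℍ, ‖Complex.exp (2 * Real.pi * Complex.I * z)‖ =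
      Real.exp (-(2 * Real.pi) * z.im) := fun z => by
    rw [Complex.norm_exp]; congr 1; simp
  have hsum := (hf UpperHalfPlane.I).summable.norm
  rw [← summable_nat_add_iff N] at hsum
  set r := Real.exp (-(2 * Real.pi)) with hr
  have hr0 : 0 < r := Real.exp_pos _
  refine ⟨(∑' m, ‖((PowerSeries.coeff (m + N) P : ℚ) : ℂ) *
    Complex.exp (2 * Real.pi * Complex.I * UpperHalfPlane.I) ^ (m + N)‖) * (r ^ N)⁻¹,
    fun z hz => ?_⟩
  have h1 := (hf z).summable.norm
  have h0 : ∑ i ∈ Finset.range N, ((PowerSeries.coeff i P : ℚ) : ℂ) *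
      Complex.exp (2 * Real.pi * Complex.I * z) ^ i = 0 :=
    Finset.sum_eq_zero fun i hi => by
      rw [PowerSeries.X_pow_dvd_iff.1 hP i (Finset.mem_range.1 hi)]; simp
  have h2 := (hasSum_nat_add_iff' N).2 (hf z)
  rw [h0, sub_zero] at h2
  rw [← h2.tsum_eq]
  have h3 := (summable_nat_add_iff N).2 h1
  refine (norm_tsum_le_tsum_norm h3).trans ?_
  rw [← tsum_mul_right, ← tsum_mul_right]
  refine h3.tsum_le_tsum (fun m => ?_) ((hsum.mul_right _).mul_right _)
  rw [norm_mul, norm_mul, norm_pow, norm_pow, hnorm, hnorm, UpperHalfPlane.I_im, mul_one, ← hr,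
    pow_add, pow_add]
  have e1 : Real.exp (-(2 * Real.pi) * z.im) ^ N = Real.exp (-(2 * Real.pi * N) * z.im) := by
    rw [← Real.exp_nat_mul]; congr 1; ring
  have e2 : Real.exp (-(2 * Real.pi) * z.im) ≤ r := by
    rw [hr]; gcongr; nlinarith [Real.pi_pos]
  rw [e1]
  have e3 : ‖((PowerSeries.coeff (m + N) P : ℚ) : ℂ)‖ * (r ^ m * r ^ N) * (r ^ N)⁻¹ =
      ‖((PowerSeries.coeff (m + N) P : ℚ) : ℂ)‖ * r ^ m := by field_simp
  rw [e3, ← mul_assoc]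
  gcongr

lemma hasQSeries_of_E {k : ℕ} (hk : 3 ≤ k) (hk2 : Even k) {c : ℚ}
    (hc : -(2 * k / bernoulli k) = c) :
    HasQSeries (ModularForm.E hk) (eisensteinQ c (k - 1)) := fun z => by
  have h := ModularForm.hasSum_qExpansion (ModularForm.E hk) one_pos one_mem_strictPeriods_SL z
  refine h.congr_fun fun m => ?_
  rw [EisensteinSeries.E_qExpansion_coeff hk hk2, eisensteinQ, PowerSeries.coeff_mk,
    Function.Periodic.qParam, ← hc]
  split_ifs with h0 <;> simp [h0]

lemma hasQSeries_E4 : HasQSeries E₄ E4q :=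
  hasQSeries_of_E (k := 4) (by norm_num) ⟨2, rfl⟩
    (by rw [show bernoulli 4 = -1 / 30 by decide +kernel]; norm_num)

lemma hasQSeries_E6 : HasQSeries E₆ E6q :=
  hasQSeries_of_E (k := 6) (by norm_num) ⟨3, rfl⟩
    (by rw [show bernoulli 6 = 1 / 42 by decide +kernel]; norm_num)

lemma hasQSeries_E2 : HasQSeries EisensteinSeries.E2 E2q := fun z => by
  refine (EisensteinSeries.hasSum_qExpansion_E2 z).congr_fun fun m => ?_
  rw [E2q, eisensteinQ, PowerSeries.coeff_mk]
  split_ifs with h0 <;> simp [h0]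

lemma hasQSeries_levelOne (A : MvPolynomial (Fin 2) ℚ) :
    HasQSeries (levelOne A) (MvPolynomial.aeval ![E4q, E6q] A) := by
  induction A using MvPolynomial.induction_on with
  | C a => 
    convert! hasQSeries_C a using 1
    · ext z; simp [levelOne]
    · simp
  | add p q hp hq =>
    convert! hp.add hq using 1
    · ext z; simp [levelOne]
    · simp
  | mul_X p i hp =>
    fin_cases i
    · convert! hp.mul hasQSeries_E4 using 1
      · ext z; simp [levelOne]
      · simp
    · convert! hp.mul hasQSeries_E6 using 1
      · ext z; simp [levelOne]
      · simp

lemma hasQSeries_discriminant : HasQSeries discriminant deltaq := by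
  convert! ((hasQSeries_E4.pow 3).sub (hasQSeries_E6.pow 2)).const_mul (1 / 1728) using 1
  ext z
  rw [ModularForm.discriminant_eq_E₄_cube_sub_E₆_sq]
  push_cast
  ring

lemma exists_bound_inv_discriminant : ∃ C Y : ℝ, 0 ≤ C ∧ ∀ z : ℍ, Y ≤ z.im →
    ‖(discriminant z)⁻¹‖ ≤ C * Real.exp (2 * Real.pi * z.im) := by
  obtain ⟨C, hC0, hC⟩ := ModularForm.exp_isBigO_discriminant.exists_pos
  obtain ⟨Y, hY⟩ := (UpperHalfPlane.atImInfty_mem _).1 hC.bound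
  refine ⟨C, Y, hC0.le, fun z hz => ?_⟩
  have h := hY z hz
  have h' : Real.exp (-2 * Real.pi * z.im) ≤ C * ‖discriminant z‖ := by
    simpa [abs_of_pos (Real.exp_pos _)] using h
  rw [norm_inv, inv_le_comm₀ (norm_pos_iff.2 (discriminant_ne_zero z)) (by positivity),
    mul_inv, ← Real.exp_neg, inv_mul_le_iff₀ hC0]
  convert! h' using 2
  ring

/-- Division by a power of the discriminant. -/
lemma HasQSeries.stripDecay_div {n N : ℕ} (hf : HasQSeries f P)
    (hP : PowerSeries.X ^ (n + N) ∣ P) :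
    StripDecay (2 * Real.pi * N) fun z => f (ofComplex z) / discriminant (ofComplex z) ^ n := by
  obtain ⟨C, hC⟩ := hf.exists_bound hP
  obtain ⟨D, Y, hD0, hD⟩ := exists_bound_inv_discriminant
  refine ⟨C * D ^ n, max Y 1, fun z _ hz => ?_⟩
  have h1 : 1 ≤ z.im := (le_max_right _ _).trans hz
  have h0 : 0 < z.im := by linarith
  simp only [ofComplex_apply_of_im_pos h0]
  have a1 := hC ⟨z, h0⟩ h1
  have a2 := hD ⟨z, h0⟩ ((le_max_left _ _).trans hz)
  rw [div_eq_mul_inv, norm_mul, ← inv_pow, norm_pow]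
  calc _ ≤ (C * Real.exp (-(2 * Real.pi * (n + N : ℕ)) * z.im)) *
      (D * Real.exp (2 * Real.pi * z.im)) ^ n := by gcongr; exacts [(norm_nonneg _).trans a1, a1, a2]
    _ = C * D ^ n * (Real.exp (-(2 * Real.pi * (n + N : ℕ)) * z.im) *
      Real.exp (2 * Real.pi * z.im) ^ n) := by rw [mul_pow]; ring
    _ = _ := by
      rw [← Real.exp_nat_mul, ← Real.exp_add]
      congr 2
      push_cast
      ring

/-- The principal part of a weakly holomorphic quotient. -/
lemma HasQSeries.stripDecay_sub_principalPart {n : ℕ} {δ : PowerSeries ℚ}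
    (hδ : deltaq = PowerSeries.X * δ) (hf : HasQSeries f (P * δ ^ n)) :
    StripDecay (2 * Real.pi) fun z => f (ofComplex z) / discriminant (ofComplex z) ^ n -
      ∑ m ∈ Finset.range (n + 1), ((PowerSeries.coeff (n - m) P : ℚ) : ℂ) *
        Complex.exp (-(2 * Real.pi * Complex.I * m * z)) := by
  -- As f/Δⁿ corresponds to P/qⁿ, the terms of P of degree at most n give its powers q⁻ⁿ, …, q⁰.
  -- Below, everything is multiplied by qⁿ so as to stay among power series.
  set T : PowerSeries ℚ := ∑ m ∈ Finset.range (n + 1),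
    PowerSeries.C (PowerSeries.coeff (n - m) P) * PowerSeries.X ^ (n - m) with hT
  have hq : HasQSeries (fun z => f z * Complex.exp (2 * Real.pi * Complex.I * z) ^ n -
      (∑ m ∈ Finset.range (n + 1), ((PowerSeries.coeff (n - m) P : ℚ) : ℂ) *
        Complex.exp (2 * Real.pi * Complex.I * z) ^ (n - m)) * discriminant z ^ n)
      (P * δ ^ n * PowerSeries.X ^ n - T * deltaq ^ n) :=
    (hf.mul (hasQSeries_X.pow n)).sub ((HasQSeries.sum _ fun m =>
      (hasQSeries_X.pow (n - m)).const_mul _).mul (hasQSeries_discriminant.pow n))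
  have hPT : PowerSeries.X ^ (n + 1) ∣ P - T := by
    rw [PowerSeries.X_pow_dvd_iff]
    intro i hi
    rw [map_sub, hT, map_sum, Finset.sum_eq_single (n - i), sub_eq_zero,
      PowerSeries.coeff_C_mul_X_pow, if_pos (by omega)]
    · congr 2; omega
    · intro m hm hne
      have := Finset.mem_range.1 hm
      rw [PowerSeries.coeff_C_mul_X_pow, if_neg (by omega)]
    · intro h
      exact absurd (Finset.mem_range.2 (by omega)) h
  have hdvd : PowerSeries.X ^ (n + (n + 1)) ∣ P * δ ^ n * PowerSeries.X ^ n - T * deltaq ^ n := by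
    rw [pow_add, show P * δ ^ n * PowerSeries.X ^ n - T * deltaq ^ n =
      PowerSeries.X ^ n * ((P - T) * δ ^ n) by rw [hδ]; ring]
    exact mul_dvd_mul_left _ (hPT.mul_right _)
  obtain ⟨C, Y, hC⟩ := hq.stripDecay_div hdvd
  refine ⟨C, max Y 1, fun z hz hz' => ?_⟩
  have h0 : 0 < z.im := lt_of_lt_of_le one_pos ((le_max_right _ _).trans hz')
  have h1 := hC z hz ((le_max_left _ _).trans hz')
  simp only [ofComplex_apply_of_im_pos h0] at h1 ⊢
  set Q := Complex.exp (2 * Real.pi * Complex.I * z) with hQ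
  have hQ0 : Q ≠ 0 := Complex.exp_ne_zero _
  have hQm : ∀ m ∈ Finset.range (n + 1), ((PowerSeries.coeff (n - m) P : ℚ) : ℂ) *
      Complex.exp (-(2 * Real.pi * Complex.I * m * z)) =
      ((PowerSeries.coeff (n - m) P : ℚ) : ℂ) * Q ^ (n - m) * (Q ^ n)⁻¹ := fun m hm => by
    have hmn := Nat.lt_succ_iff.1 (Finset.mem_range.1 hm)
    have e : Complex.exp (-(2 * Real.pi * Complex.I * m * z)) = (Q ^ m)⁻¹ := by
      rw [hQ, ← Complex.exp_nat_mul, ← Complex.exp_neg]; congr 1; ring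
    have e2 : Q ^ n = Q ^ (n - m) * Q ^ m := by rw [← pow_add]; congr 1; omega
    rw [e, e2]
    field_simp
  have hD := discriminant_ne_zero ⟨z, h0⟩
  rw [Finset.sum_congr rfl hQm, ← Finset.sum_mul]
  set S := ∑ m ∈ Finset.range (n + 1), ((PowerSeries.coeff (n - m) P : ℚ) : ℂ) * Q ^ (n - m)
  have key : f ⟨z, h0⟩ / discriminant ⟨z, h0⟩ ^ n - S * (Q ^ n)⁻¹ =
      (f ⟨z, h0⟩ * Q ^ n - S * discriminant ⟨z, h0⟩ ^ n) / discriminant ⟨z, h0⟩ ^ n * (Q ^ n)⁻¹ := by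
    field_simp
  have hQn : ‖(Q ^ n)⁻¹‖ = Real.exp (2 * Real.pi * n * z.im) := by
    rw [norm_inv, norm_pow, hQ, Complex.norm_exp, ← Real.exp_nat_mul, ← Real.exp_neg]
    congr 1
    simp
    ring
  rw [key, norm_mul, hQn]
  calc _ ≤ C * Real.exp (-(2 * Real.pi * (n + 1 : ℕ)) * z.im) * Real.exp (2 * Real.pi * n * z.im) :=
        by gcongr
    _ = _ := by
      rw [mul_assoc, ← Real.exp_add]
      congr 2
      push_cast
      ring

end QSeries

/-! ### The quasimodular kernel φ. -/

section PlusKernel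

lemma E2_S_smul (z : ℍ) : EisensteinSeries.E2 (ModularGroup.S • z) =
    (z : ℂ) ^ 2 * EisensteinSeries.E2 z - 6 * Complex.I / Real.pi * z := by
  have h := congrFun (EisensteinSeries.E2_slash_action ModularGroup.S) z
  rw [ModularForm.SL_slash_apply, ModularGroup.denom_S, Pi.sub_apply, Pi.smul_apply,
    EisensteinSeries.D2_S, riemannZeta_two] at h
  have hz : (z : ℂ) ≠ 0 := ne_zero z
  have hπ := pi_ne_zero'
  have e : EisensteinSeries.E2 (ModularGroup.S • z) =
      (EisensteinSeries.E2 (ModularGroup.S • z) * (z : ℂ) ^ (-2 : ℤ)) * (z : ℂ) ^ 2 := by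
    rw [zpow_neg]; field_simp
  rw [e, h, smul_eq_mul]
  field_simp

lemma apply_S_smul_of_slash_eq {f : ℍ → ℂ} {k : ℤ} (h : f ∣[k] ModularGroup.S = f) (z : ℍ) :
    f (ModularGroup.S • z) = (z : ℂ) ^ k * f z := by
  have h := congrFun h z
  rw [ModularForm.SL_slash_apply, ModularGroup.denom_S] at h
  rw [← h, mul_left_comm, ← zpow_add₀ (ne_zero z), add_neg_cancel, zpow_zero, mul_one]

lemma discriminant_S_smul (z : ℍ) :
    discriminant (ModularGroup.S • z) = (z : ℂ) ^ (12 : ℤ) * discriminant z :=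
  apply_S_smul_of_slash_eq discriminant_S_invariant z

lemma E4_S_smul (z : ℍ) : E₄ (ModularGroup.S • z) = (z : ℂ) ^ (4 : ℤ) * E₄ z :=
  apply_S_smul_of_slash_eq (SlashInvariantFormClass.slash_action_eq E₄ _ ⟨ModularGroup.S, rfl⟩) z

lemma E6_S_smul (z : ℍ) : E₆ (ModularGroup.S • z) = (z : ℂ) ^ (6 : ℤ) * E₆ z :=
  apply_S_smul_of_slash_eq (SlashInvariantFormClass.slash_action_eq E₆ _ ⟨ModularGroup.S, rfl⟩) z

/-- Evaluation of an isobaric polynomial at rescaled points. -/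
lemma aeval_weighted_smul {P : MvPolynomial (Fin 2) ℚ} {w : Fin 2 → ℤ} {k : ℤ}
    (hP : P.IsWeightedHomogeneous w k) {t : ℂ} (ht : t ≠ 0) (x y : ℂ) :
    MvPolynomial.aeval ![t ^ w 0 * x, t ^ w 1 * y] P = t ^ k * MvPolynomial.aeval ![x, y] P := by
  rw [MvPolynomial.aeval_def, MvPolynomial.aeval_def, MvPolynomial.eval₂_eq',
    MvPolynomial.eval₂_eq', Finset.mul_sum]
  refine Finset.sum_congr rfl fun m hm => ?_
  have h := hP (MvPolynomial.mem_support_iff.1 hm)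
  rw [Finsupp.weight_apply, Finsupp.sum_fintype _ _ (by simp)] at h
  simp only [Fin.prod_univ_two, Matrix.cons_val_zero, Matrix.cons_val_one, Fin.sum_univ_two] at h ⊢
  rw [← h, zpow_add₀ ht, mul_pow, mul_pow, nsmul_eq_mul, nsmul_eq_mul, mul_comm (m 0 : ℤ),
    mul_comm (m 1 : ℤ), zpow_mul, zpow_mul, zpow_natCast, zpow_natCast]
  ring

lemma levelOne_S_smul {A : MvPolynomial (Fin 2) ℚ} {k : ℤ} (hA : IsLevelOneWeight A k) (z : ℍ) :
    levelOne A (ModularGroup.S • z) = (z : ℂ) ^ k * levelOne A z := by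
  rw [levelOne, E4_S_smul, E6_S_smul]
  exact aeval_weighted_smul hA (ne_zero z) _ _

/-- The inhomogeneous term of E₂ under inversion, squared with E₂², produces the terms of degree 1
and 0 in z. The term of degree 1 is the source of the values of f. -/
lemma phi_S_smul {l n : ℕ} {A C : MvPolynomial (Fin 2) ℚ} (hl : 1 ≤ l)
    (hA : IsLevelOneWeight A (12 * n - (2 * l : ℕ) + 4))
    (hC : IsLevelOneWeight C (12 * n - (2 * l : ℕ))) (z : ℍ) :
    (z : ℂ) ^ (2 * l - 2) * phi n A 0 C (ModularGroup.S • z) =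
      (z : ℂ) ^ 2 * phi n A 0 C z +
      6 / Real.pi * (-Complex.I * z) * (2 * levelOne C z * EisensteinSeries.E2 z /
        discriminant z ^ n) - 36 / Real.pi ^ 2 * (levelOne C z / discriminant z ^ n) := by
  have hz : (z : ℂ) ≠ 0 := ne_zero z
  have hπ := pi_ne_zero'
  have hD := discriminant_ne_zero z
  have h0 : ∀ w, levelOne 0 w = 0 := fun w => by simp [levelOne]
  obtain ⟨j, rfl⟩ : ∃ j, l = j + 1 := ⟨l - 1, by omega⟩
  rw [phi, phi, h0, h0, levelOne_S_smul hA, levelOne_S_smul hC, E2_S_smul, discriminant_S_smul]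
  have e1 : (z : ℂ) ^ (12 * n - (2 * (j + 1) : ℕ) : ℤ) =
      (z : ℂ) ^ (12 * n) / (z : ℂ) ^ (2 * (j + 1)) := by
    rw [zpow_sub₀ hz, zpow_natCast]; norm_cast
  have e2 : (z : ℂ) ^ (12 : ℤ) = (z : ℂ) ^ 12 := by norm_cast
  have e3 : (z : ℂ) ^ (4 : ℤ) = (z : ℂ) ^ 4 := by norm_cast
  rw [zpow_add₀ hz, e1, e2, e3, mul_pow, ← pow_mul, show 2 * (j + 1) - 2 = 2 * j by omega]
  field_simp
  ring_nf
  simp only [Complex.I_sq]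
  ring

lemma S_smul_eq_ofComplex {z : ℂ} (hz : 0 < z.im) :
    ModularGroup.S • (⟨z, hz⟩ : ℍ) = ofComplex (-1 / z) := by
  rw [ofComplex_apply_of_im_pos (ModularKernel.neg_inv_im_pos hz), modular_S_smul]
  apply UpperHalfPlane.ext
  show (-z)⁻¹ = -1 / z
  rw [neg_div, one_div, inv_neg]

lemma differentiableOn_levelOne (A : MvPolynomial (Fin 2) ℚ) :
    DifferentiableOn ℂ (fun z => levelOne A (ofComplex z)) {z | 0 < z.im} := by
  have h4 : DifferentiableOn ℂ (fun z => E₄ (ofComplex z)) {z | 0 < z.im} :=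
    UpperHalfPlane.mdifferentiable_iff.1 (ModularFormClass.holo E₄)
  have h6 : DifferentiableOn ℂ (fun z => E₆ (ofComplex z)) {z | 0 < z.im} :=
    UpperHalfPlane.mdifferentiable_iff.1 (ModularFormClass.holo E₆)
  induction A using MvPolynomial.induction_on with
  | C a => simp [levelOne]
  | add p q hp hq =>
    refine (hp.add hq).congr fun z _ => ?_
    simp [levelOne]
  | mul_X p i hp =>
    fin_cases i
    · refine (hp.mul h4).congr fun z _ => ?_
      simp [levelOne]
    · refine (hp.mul h6).congr fun z _ => ?_
      simp [levelOne]

lemma differentiableOn_discriminant :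
    DifferentiableOn ℂ (fun z => discriminant (ofComplex z)) {z | 0 < z.im} := by
  have h4 : DifferentiableOn ℂ (fun z => E₄ (ofComplex z)) {z | 0 < z.im} :=
    UpperHalfPlane.mdifferentiable_iff.1 (ModularFormClass.holo E₄)
  have h6 : DifferentiableOn ℂ (fun z => E₆ (ofComplex z)) {z | 0 < z.im} :=
    UpperHalfPlane.mdifferentiable_iff.1 (ModularFormClass.holo E₆)
  simp only [ModularForm.discriminant_eq_E₄_cube_sub_E₆_sq]
  exact ((h4.pow 3).sub (h6.pow 2)).div_const _

lemma HasQSeries.ofComplex_add_one {f : ℍ → ℂ} {P : PowerSeries ℚ} (hf : HasQSeries f P) {z : ℂ}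
    (hz : 0 < z.im) : f (ofComplex (z + 1)) = f (ofComplex z) := by
  have hz1 : 0 < (z + 1).im := by simpa using hz
  apply hf.unique
  rw [ofComplex_apply_of_im_pos hz, ofComplex_apply_of_im_pos hz1]
  rw [mul_add, Complex.exp_add, mul_one, Complex.exp_two_pi_mul_I, mul_one]

/-- In the strip |z| ≤ 1 + Im z, which any loss c - c' > 0 in the exponent absorbs. -/
lemma StripDecay.mul_id {c c' : ℝ} {p : ℂ → ℂ} (hp : StripDecay c p) (h : c' < c) :
    StripDecay c' fun z => z * p z := by
  obtain ⟨C, Y, hC⟩ := hp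
  have hδ : 0 < c - c' := by linarith
  refine ⟨(2 + (c - c')⁻¹) * C, max Y 0, fun z hz hz' => ?_⟩
  have h0 : 0 ≤ z.im := (le_max_right _ _).trans hz'
  have h1 := hC z hz ((le_max_left _ _).trans hz')
  have hz1 : ‖z‖ ≤ 1 + z.im := by
    refine (Complex.norm_le_abs_re_add_abs_im z).trans ?_
    rw [abs_of_nonneg h0]; linarith
  have h2 : 1 + z.im ≤ (2 + (c - c')⁻¹) * Real.exp ((c - c') * z.im) := by
    have := Real.add_one_le_exp ((c - c') * z.im)
    have h2 : z.im = (c - c')⁻¹ * ((c - c') * z.im) := by field_simp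
    have h3 : 0 < (c - c')⁻¹ := inv_pos.2 hδ
    have h4 : 0 ≤ (c - c') * z.im := by positivity
    calc 1 + z.im = 1 + (c - c')⁻¹ * ((c - c') * z.im) := by rw [← h2]
      _ ≤ Real.exp ((c - c') * z.im) + (c - c')⁻¹ * Real.exp ((c - c') * z.im) := by
          gcongr <;> linarith
      _ ≤ _ := by nlinarith [Real.exp_pos ((c - c') * z.im)]
  rw [norm_mul]
  calc _ ≤ (2 + (c - c')⁻¹) * Real.exp ((c - c') * z.im) * (C * Real.exp (-c * z.im)) := by
        gcongr
        exact hz1.trans h2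
    _ = (2 + (c - c')⁻¹) * C * (Real.exp ((c - c') * z.im) * Real.exp (-c * z.im)) := by ring
    _ = _ := by rw [← Real.exp_add]; congr 2; ring

lemma StripDecay.const_mul {c : ℝ} {p : ℂ → ℂ} (hp : StripDecay c p) (r : ℂ) :
    StripDecay c fun z => r * p z := by
  obtain ⟨C, Y, hC⟩ := hp
  refine ⟨‖r‖ * C, Y, fun z hz hz' => ?_⟩
  rw [norm_mul, mul_assoc]
  gcongr
  exact hC z hz hz'

lemma StripDecay.congr {c : ℝ} {p q : ℂ → ℂ} (hp : StripDecay c p)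
    (h : ∀ z, 0 < z.im → q z = p z) : StripDecay c q := by
  obtain ⟨C, Y, hC⟩ := hp
  refine ⟨C, max Y 1, fun z hz hz' => ?_⟩
  rw [h z (lt_of_lt_of_le one_pos ((le_max_right _ _).trans hz'))]
  exact hC z hz ((le_max_left _ _).trans hz')

variable {l n : ℕ} {A C : MvPolynomial (Fin 2) ℚ}

lemma hasQSeries_phi_num (A C : MvPolynomial (Fin 2) ℚ) :
    HasQSeries (fun z => levelOne A z + levelOne 0 z * EisensteinSeries.E2 z
      + levelOne C z * EisensteinSeries.E2 z ^ 2)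
      (MvPolynomial.aeval ![E4q, E6q] A + MvPolynomial.aeval ![E4q, E6q] C * E2q ^ 2) := by
  convert! ((hasQSeries_levelOne A).add ((hasQSeries_levelOne 0).mul hasQSeries_E2)).add
    ((hasQSeries_levelOne C).mul (hasQSeries_E2.pow 2)) using 1
  simp

lemma stripDecay_phi (h : PowerSeries.X ^ (n + 1) ∣ MvPolynomial.aeval ![E4q, E6q] A +
    MvPolynomial.aeval ![E4q, E6q] C * E2q ^ 2) :
    StripDecay (2 * Real.pi) fun z => phi n A 0 C (ofComplex z) := by
  have := (hasQSeries_phi_num A C).stripDecay_div (n := n) (N := 1) h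
  rwa [Nat.cast_one, mul_one] at this

/-- The function `z ↦ z^κ φ(-1/z)`. -/
def invertedPhi (l n : ℕ) (A C : MvPolynomial (Fin 2) ℚ) (z : ℂ) : ℂ :=
  1 * z ^ (2 * l - 2) * phi n A 0 C (ofComplex (-1 / z))

lemma invertedPhi_eq (hl : 1 ≤ l) (hA : IsLevelOneWeight A (12 * n - (2 * l : ℕ) + 4))
    (hC : IsLevelOneWeight C (12 * n - (2 * l : ℕ))) {z : ℂ} (hz : 0 < z.im) :
    invertedPhi l n A C z = z ^ 2 * phi n A 0 C (ofComplex z) +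
      6 / Real.pi * (-Complex.I * z) * (2 * levelOne C (ofComplex z) *
        EisensteinSeries.E2 (ofComplex z) / discriminant (ofComplex z) ^ n) -
      36 / Real.pi ^ 2 * (levelOne C (ofComplex z) / discriminant (ofComplex z) ^ n) := by
  have := phi_S_smul hl hA hC ⟨z, hz⟩
  rw [S_smul_eq_ofComplex hz] at this
  rw [invertedPhi, one_mul, ofComplex_apply_of_im_pos hz]
  exact this

lemma phi_ofComplex_add_one {z : ℂ} (hz : 0 < z.im) :
    phi n A 0 C (ofComplex (z + 1)) = phi n A 0 C (ofComplex z) := by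
  rw [phi, phi, (hasQSeries_phi_num A C).ofComplex_add_one hz,
    hasQSeries_discriminant.ofComplex_add_one hz]

/-- By `invertedPhi_eq`, g is z²φ plus terms of degree at most 1 in z, all with 1-periodic
coefficients. The second difference sends z² to 2 and kills the rest. -/
lemma modularKernel_phi (hl : 1 ≤ l) (hA : IsLevelOneWeight A (12 * n - (2 * l : ℕ) + 4))
    (hC : IsLevelOneWeight C (12 * n - (2 * l : ℕ)))
    (h : PowerSeries.X ^ (n + 1) ∣ MvPolynomial.aeval ![E4q, E6q] A +
      MvPolynomial.aeval ![E4q, E6q] C * E2q ^ 2) :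
    ModularKernel (2 * l - 2) 1 Real.pi (fun z => phi n A 0 C (ofComplex z))
      (invertedPhi l n A C) where
  even := ⟨l - 1, by omega⟩
  sq := one_pow 2
  pos := Real.pi_pos
  hol := by
    have hE : DifferentiableOn ℂ (fun z => EisensteinSeries.E2 (ofComplex z)) {z | 0 < z.im} :=
      UpperHalfPlane.mdifferentiable_iff.1 E2_mdifferentiable
    refine DifferentiableOn.div ?_ (differentiableOn_discriminant.pow n)
      fun z _ => pow_ne_zero _ (discriminant_ne_zero _)
    exact ((differentiableOn_levelOne A).add ((differentiableOn_levelOne 0).mul hE)).add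
      ((differentiableOn_levelOne C).mul (hE.pow 2))
  per z hz := by rw [one_mul, phi_ofComplex_add_one hz]
  decay := (stripDecay_phi h).mono (by linarith [Real.pi_pos])
  -- The factor `1` in `invertedPhi` is ε, so this holds by definition.
  eq_inv z hz := rfl
  diff_two z hz := by
    have hz1 : 0 < (z + 1).im := by simpa using hz
    have hz2 : 0 < (z - 1).im := by simpa using hz
    have p1 := phi_ofComplex_add_one (n := n) (A := A) (C := C) hz
    have p2 := phi_ofComplex_add_one (n := n) (A := A) (C := C) hz2
    have c1 := (hasQSeries_levelOne C).ofComplex_add_one hz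
    have c2 := (hasQSeries_levelOne C).ofComplex_add_one hz2
    have e1 := hasQSeries_E2.ofComplex_add_one hz
    have e2 := hasQSeries_E2.ofComplex_add_one hz2
    have d1 := hasQSeries_discriminant.ofComplex_add_one hz
    have d2 := hasQSeries_discriminant.ofComplex_add_one hz2
    rw [sub_add_cancel] at p2 c2 e2 d2
    rw [invertedPhi_eq hl hA hC hz, invertedPhi_eq hl hA hC hz1, invertedPhi_eq hl hA hC hz2,
      p1, ← p2, c1, ← c2, e1, ← e2, d1, ← d2]
    ring

lemma invertedPhi_real {t : ℝ} (ht : 0 < t) : (invertedPhi l n A C (t * Complex.I)).im = 0 := by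
  have hz : 0 < (t * Complex.I : ℂ).im := by simpa using ht
  have hi := ModularKernel.neg_inv_im_pos hz
  have hre : (⟨_, hi⟩ : ℍ).re = 0 := by
    show (-1 / (t * Complex.I : ℂ)).re = 0
    rw [neg_div, one_div, mul_inv, Complex.inv_I, ← Complex.ofReal_inv]
    simp
  have h1 := (hasQSeries_phi_num A C).im_eq_zero hre
  have h2 := hasQSeries_discriminant.im_eq_zero hre
  have real : ∀ {w : ℂ}, w.im = 0 → w = (w.re : ℂ) := fun h => Complex.ext rfl (by simp [h])
  have e : (t * Complex.I : ℂ) ^ (2 * l - 2) = (((-t ^ 2) ^ (l - 1) : ℝ) : ℂ) := by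
    rw [show 2 * l - 2 = 2 * (l - 1) by omega, pow_mul, mul_pow, Complex.I_sq]
    push_cast
    ring
  rw [invertedPhi, ofComplex_apply_of_im_pos hi, one_mul, phi, real h1, real h2, e,
    ← Complex.ofReal_pow, ← Complex.ofReal_div, ← Complex.ofReal_mul, Complex.ofReal_im]

/-- The principal part of `z^κ φ(-1/z)`. -/
lemma stripDecay_invertedPhi (hl : 1 ≤ l) (hA : IsLevelOneWeight A (12 * n - (2 * l : ℕ) + 4))
    (hC : IsLevelOneWeight C (12 * n - (2 * l : ℕ)))
    (h : PowerSeries.X ^ (n + 1) ∣ MvPolynomial.aeval ![E4q, E6q] A +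
      MvPolynomial.aeval ![E4q, E6q] C * E2q ^ 2) {δ P₁ P₂ : PowerSeries ℚ}
    (hδ : deltaq = PowerSeries.X * δ)
    (h₁ : 2 * MvPolynomial.aeval ![E4q, E6q] C * E2q = P₁ * δ ^ n)
    (h₂ : MvPolynomial.aeval ![E4q, E6q] C = P₂ * δ ^ n) :
    StripDecay Real.pi fun z => invertedPhi l n A C z - principalPart n
      (fun m => 6 / Real.pi * ((PowerSeries.coeff (n - m) P₁ : ℚ) : ℂ))
      (fun m => -(36 / Real.pi ^ 2) * ((PowerSeries.coeff (n - m) P₂ : ℚ) : ℂ)) z := by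
  have hπ := Real.pi_pos
  have q1 : HasQSeries (fun z => 2 * levelOne C z * EisensteinSeries.E2 z) (P₁ * δ ^ n) := by
    rw [← h₁]
    convert! ((hasQSeries_levelOne C).const_mul 2).mul hasQSeries_E2 using 1
  have q2 : HasQSeries (fun z => levelOne C z) (P₂ * δ ^ n) := h₂ ▸ hasQSeries_levelOne C
  -- φ decays with exponent 2π, and each multiplication by z costs π/2.
  have s0 := (((stripDecay_phi h).mul_id (c' := 3 / 2 * Real.pi) (by linarith)).mul_id
    (c' := Real.pi) (by linarith))
  have s1 := ((q1.stripDecay_sub_principalPart hδ).mul_id (c' := Real.pi) (by linarith)).const_mul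
    (6 / Real.pi * -Complex.I)
  have s2 := ((q2.stripDecay_sub_principalPart hδ).mono (c' := Real.pi) (by linarith)).const_mul
    (-(36 / Real.pi ^ 2))
  refine ((s0.add s1).add s2).congr fun z hz => ?_
  rw [invertedPhi_eq hl hA hC hz]
  have e : principalPart n
      (fun m => 6 / Real.pi * ((PowerSeries.coeff (n - m) P₁ : ℚ) : ℂ))
      (fun m => -(36 / Real.pi ^ 2) * ((PowerSeries.coeff (n - m) P₂ : ℚ) : ℂ)) z =
      6 / Real.pi * -Complex.I * (z * ∑ m ∈ Finset.range (n + 1),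
        ((PowerSeries.coeff (n - m) P₁ : ℚ) : ℂ) *
          Complex.exp (-(2 * Real.pi * Complex.I * m * z))) +
      -(36 / Real.pi ^ 2) * ∑ m ∈ Finset.range (n + 1),
        ((PowerSeries.coeff (n - m) P₂ : ℚ) : ℂ) *
          Complex.exp (-(2 * Real.pi * Complex.I * m * z)) := by
    rw [principalPart, Finset.mul_sum, Finset.mul_sum, Finset.mul_sum, ← Finset.sum_add_distrib]
    exact Finset.sum_congr rfl fun m _ => by ring
  rw [e]
  ring

end PlusKernel

/-! ### Theta functions and Jacobi's identity. -/

section Theta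

/-- The function `U = θ₃⁴`. -/
def thetaU (z : ℍ) : ℂ := jacobiTheta₂ 0 z ^ 4

lemma theta4_eq (z : ℍ) : theta4 z = jacobiTheta₂ (1 / 2) z := by
  refine tsum_congr fun n => ?_
  rw [jacobiTheta₂_term, Complex.exp_add, show (2 * Real.pi * Complex.I * n * (1 / 2) : ℂ) =
    n * (Real.pi * Complex.I) by ring, Complex.exp_int_mul, Complex.exp_pi_mul_I]

lemma theta2_eq (z : ℍ) :
    theta2 z = Complex.exp (Real.pi * Complex.I * z / 4) * jacobiTheta₂ (z / 2) z := by
  rw [theta2, jacobiTheta₂, ← tsum_mul_left]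
  refine tsum_congr fun n => ?_
  rw [jacobiTheta₂_term, ← Complex.exp_add]
  congr 1; ring

lemma exp_pi_sq_mul_I (n : ℤ) : Complex.exp (Real.pi * Complex.I * (n : ℂ) ^ 2) = (-1) ^ n := by
  rw [show (Real.pi * Complex.I * (n : ℂ) ^ 2 : ℂ) = ((n ^ 2 : ℤ) : ℂ) * (Real.pi * Complex.I) by
    push_cast; ring, Complex.exp_int_mul, Complex.exp_pi_mul_I]
  rcases Int.even_or_odd n with h | h
  · rw [h.neg_one_zpow, (h.pow_of_ne_zero two_ne_zero).neg_one_zpow]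
  · rw [h.neg_one_zpow, (h.pow).neg_one_zpow]

lemma theta4_T_smul (z : ℍ) : theta4 (ModularGroup.T • z) = jacobiTheta₂ 0 z := by
  rw [theta4_eq, jacobiTheta₂, jacobiTheta₂, modular_T_smul, coe_vadd]
  refine tsum_congr fun n => ?_
  rw [jacobiTheta₂_term, jacobiTheta₂_term]
  have e : (2 * Real.pi * Complex.I * n * (1 / 2) +
      Real.pi * Complex.I * n ^ 2 * ((1 : ℝ) + (z : ℂ)) : ℂ) = n * (Real.pi * Complex.I) +
      (Real.pi * Complex.I * n ^ 2 + (2 * Real.pi * Complex.I * n * 0 +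
        Real.pi * Complex.I * n ^ 2 * z)) := by push_cast; ring
  rw [e, Complex.exp_add, Complex.exp_add, exp_pi_sq_mul_I, Complex.exp_int_mul,
    Complex.exp_pi_mul_I, ← mul_assoc, ← mul_zpow]
  simp

lemma jacobiTheta₂_zero_T_smul (z : ℍ) :
    jacobiTheta₂ 0 (ModularGroup.T • z : ℍ) = theta4 z := by
  rw [theta4_eq, jacobiTheta₂, jacobiTheta₂, modular_T_smul, coe_vadd]
  refine tsum_congr fun n => ?_
  rw [jacobiTheta₂_term, jacobiTheta₂_term]
  have e : (2 * Real.pi * Complex.I * n * 0 +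
      Real.pi * Complex.I * n ^ 2 * ((1 : ℝ) + (z : ℂ)) : ℂ) = 
      Real.pi * Complex.I * n ^ 2 + Real.pi * Complex.I * n ^ 2 * z := by push_cast; ring
  have e' : (2 * Real.pi * Complex.I * n * (1 / 2) + Real.pi * Complex.I * n ^ 2 * z : ℂ) =
      n * (Real.pi * Complex.I) + Real.pi * Complex.I * n ^ 2 * z := by ring
  rw [e, e', Complex.exp_add, Complex.exp_add, exp_pi_sq_mul_I, Complex.exp_int_mul,
    Complex.exp_pi_mul_I]

lemma theta2_T_smul (z : ℍ) :
    theta2 (ModularGroup.T • z) = Complex.exp (Real.pi * Complex.I / 4) * theta2 z := by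
  rw [theta2, theta2, ← tsum_mul_left, modular_T_smul, coe_vadd]
  refine tsum_congr fun n => ?_
  have e : (Real.pi * Complex.I * ((n : ℂ) + 1 / 2) ^ 2 * ((1 : ℝ) + (z : ℂ)) : ℂ) =
      (Real.pi * Complex.I * (n : ℂ) ^ 2 + n * (Real.pi * Complex.I)) +
      (Real.pi * Complex.I / 4 + Real.pi * Complex.I * ((n : ℂ) + 1 / 2) ^ 2 * z) := by
    push_cast; ring
  rw [e, Complex.exp_add, Complex.exp_add, exp_pi_sq_mul_I, Complex.exp_int_mul,
    Complex.exp_pi_mul_I, ← mul_zpow, Complex.exp_add]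
  simp

lemma thetaV_T_smul (z : ℍ) : thetaV (ModularGroup.T • z) = -thetaV z := by
  rw [thetaV, theta2_T_smul, mul_pow, ← Complex.exp_nat_mul,
    show ((4 : ℕ) * (Real.pi * Complex.I / 4) : ℂ) = Real.pi * Complex.I by push_cast; ring,
    Complex.exp_pi_mul_I, neg_one_mul, thetaV]

lemma thetaW_T_smul (z : ℍ) : thetaW (ModularGroup.T • z) = thetaU z := by
  rw [thetaW, theta4_T_smul, thetaU]

lemma thetaU_T_smul (z : ℍ) : thetaU (ModularGroup.T • z) = thetaW z := by
  rw [thetaU, jacobiTheta₂_zero_T_smul, thetaW]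

lemma coe_S_smul (z : ℍ) : ((ModularGroup.S • z : ℍ) : ℂ) = -1 / z := by
  rw [modular_S_smul]
  show (-(z : ℂ))⁻¹ = -1 / z
  rw [neg_div, one_div, inv_neg]

/-- Fourth powers of theta functions remove the branch of the square root in the functional
equation. -/
lemma sqrt_factor_pow_four (z : ℍ) :
    (1 / (-Complex.I * (z : ℂ)) ^ (1 / 2 : ℂ)) ^ 4 = -1 / (z : ℂ) ^ 2 := by
  rw [div_pow, one_pow, ← Complex.cpow_nat_mul,
    show ((4 : ℕ) * (1 / 2) : ℂ) = (2 : ℕ) by norm_num, Complex.cpow_natCast, mul_pow, neg_sq,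
    Complex.I_sq]
  ring

lemma thetaU_S_smul (z : ℍ) : thetaU (ModularGroup.S • z) = -(z : ℂ) ^ 2 * thetaU z := by
  have hz : (z : ℂ) ≠ 0 := ne_zero z
  have h : thetaU z = -1 / (z : ℂ) ^ 2 * thetaU (ModularGroup.S • z) := by
    rw [thetaU, jacobiTheta₂_functional_equation, thetaU, coe_S_smul, mul_pow, mul_pow,
      sqrt_factor_pow_four]
    simp
  rw [h]; field_simp

lemma thetaV_S_smul (z : ℍ) : thetaV (ModularGroup.S • z) = -(z : ℂ) ^ 2 * thetaW z := by
  have hz : (z : ℂ) ≠ 0 := ne_zero z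
  have h : thetaW z = -1 / (z : ℂ) ^ 2 * thetaV (ModularGroup.S • z) := by
    rw [thetaW, theta4_eq, jacobiTheta₂_functional_equation, thetaV, theta2_eq, coe_S_smul, mul_pow,
      mul_pow, sqrt_factor_pow_four, mul_pow, mul_assoc]
    congr 3
    · congr 1; field_simp; ring
    · rw [← jacobiTheta₂_neg_left]; congr 1; field_simp
  rw [h]; field_simp

lemma thetaW_S_smul (z : ℍ) : thetaW (ModularGroup.S • z) = -(z : ℂ) ^ 2 * thetaV z := by
  have hz : (z : ℂ) ≠ 0 := ne_zero z
  have h := thetaV_S_smul (ModularGroup.S • z)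
  have hS : ModularGroup.S • ModularGroup.S • z = z := by
    apply UpperHalfPlane.ext
    rw [coe_S_smul, coe_S_smul]
    field_simp
  rw [hS, coe_S_smul] at h
  rw [h]; field_simp

lemma differentiableOn_thetaV :
    DifferentiableOn ℂ (fun z => thetaV (ofComplex z)) {z | 0 < z.im} := by
  have h : DifferentiableOn ℂ (fun z : ℂ => (Complex.exp (Real.pi * Complex.I * z / 4) *
      jacobiTheta₂ (z / 2) z) ^ 4) {z | 0 < z.im} := by
    intro z hz
    have h1 : DifferentiableAt ℂ (fun z : ℂ => jacobiTheta₂ (z / 2) z) z :=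
      (hasFDerivAt_jacobiTheta₂ (z / 2) hz).differentiableAt.comp z
        (f := fun z : ℂ => (z / 2, z)) (by fun_prop)
    exact ((DifferentiableAt.mul (by fun_prop) h1).pow 4).differentiableWithinAt
  refine h.congr fun z hz => ?_
  rw [thetaV, theta2_eq, ofComplex_apply_of_im_pos hz]

lemma differentiableOn_thetaW :
    DifferentiableOn ℂ (fun z => thetaW (ofComplex z)) {z | 0 < z.im} := by
  have h : DifferentiableOn ℂ (fun z : ℂ => jacobiTheta₂ (1 / 2) z ^ 4) {z | 0 < z.im} :=
    fun z hz => ((differentiableAt_jacobiTheta₂_snd _ hz).pow 4).differentiableWithinAt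
  refine h.congr fun z hz => ?_
  rw [thetaW, theta4_eq, ofComplex_apply_of_im_pos hz]

lemma differentiableOn_thetaU :
    DifferentiableOn ℂ (fun z => thetaU (ofComplex z)) {z | 0 < z.im} := by
  have h : DifferentiableOn ℂ (fun z : ℂ => jacobiTheta₂ 0 z ^ 4) {z | 0 < z.im} :=
    fun z hz => ((differentiableAt_jacobiTheta₂_snd _ hz).pow 4).differentiableWithinAt
  refine h.congr fun z hz => ?_
  rw [thetaU, ofComplex_apply_of_im_pos hz]

/-- The n-th term of jacobiTheta₂(z/2, z) has absolute value e^{-π(n² + n) Im z} with n² + n ≥ 0, so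
for Im z ≥ 1 it is at most its value at i. The decay comes from the prefactor e^{πiz/4}. -/
lemma exists_bound_theta2 : ∃ K, ∀ z : ℍ, 1 ≤ z.im →
    ‖theta2 z‖ ≤ K * Real.exp (-(Real.pi / 4) * z.im) := by
  have hs : ∀ τ : ℍ, Summable fun n : ℤ => ‖jacobiTheta₂_term n (τ / 2) τ‖ := fun τ =>
    ((summable_jacobiTheta₂_term_iff _ _).2 τ.im_pos).norm
  refine ⟨∑' n : ℤ, ‖jacobiTheta₂_term n (UpperHalfPlane.I / 2) UpperHalfPlane.I‖, fun z hz => ?_⟩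
  rw [theta2_eq, norm_mul, mul_comm]
  have h1 : ‖Complex.exp (Real.pi * Complex.I * z / 4)‖ = Real.exp (-(Real.pi / 4) * z.im) := by
    rw [Complex.norm_exp]; congr 1
    simp
    ring
  rw [h1]
  gcongr
  refine (norm_tsum_le_tsum_norm (hs z)).trans ((hs z).tsum_le_tsum (fun n => ?_)
    (hs UpperHalfPlane.I))
  rw [norm_jacobiTheta₂_term, norm_jacobiTheta₂_term]
  have hn : (0 : ℝ) ≤ n ^ 2 + n := by
    have : 0 ≤ n ^ 2 + n := by nlinarith [sq_nonneg (2 * n + 1)]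
    exact_mod_cast this
  have e : ∀ τ : ℍ, ((τ : ℂ) / 2).im = τ.im / 2 := fun τ => by simp
  rw [e, e, UpperHalfPlane.coe_im, UpperHalfPlane.coe_im, UpperHalfPlane.I_im]
  refine Real.exp_le_exp.2 ?_
  have := mul_nonneg hn (mul_nonneg Real.pi_pos.le (sub_nonneg.2 hz))
  nlinarith

lemma exists_bound_thetaV : ∃ K, ∀ z : ℍ, 1 ≤ z.im →
    ‖thetaV z‖ ≤ K * Real.exp (-Real.pi * z.im) := by
  obtain ⟨K, hK⟩ := exists_bound_theta2
  refine ⟨K ^ 4, fun z hz => ?_⟩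
  rw [thetaV, norm_pow]
  calc _ ≤ (K * Real.exp (-(Real.pi / 4) * z.im)) ^ 4 := by gcongr; exact hK z hz
    _ = _ := by
      rw [mul_pow, ← Real.exp_nat_mul]; congr 2; push_cast; ring

lemma tendsto_exp_neg_pi_im : Tendsto (fun z : ℍ => Real.exp (-Real.pi * z.im)) atImInfty (𝓝 0) := by
  have h : Tendsto (fun y : ℝ => Real.exp (-Real.pi * y)) atTop (𝓝 0) := by
    refine Real.tendsto_exp_atBot.comp ?_
    exact tendsto_id.const_mul_atTop_of_neg (neg_neg_of_pos Real.pi_pos)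
  exact h.comp tendsto_comap

lemma tendsto_thetaV : Tendsto thetaV atImInfty (𝓝 0) := by
  obtain ⟨K, hK⟩ := exists_bound_thetaV
  refine squeeze_zero_norm' ?_ (by simpa using tendsto_exp_neg_pi_im.const_mul K)
  filter_upwards [(atImInfty_mem _).2 ⟨1, fun z hz => hz⟩] with z hz
  simpa using hK z hz

lemma T_slash_apply (f : ℍ → ℂ) (k : ℤ) (z : ℍ) :
    (f ∣[k] ModularGroup.T) z = f (ModularGroup.T • z) := by
  have h : denom (Matrix.SpecialLinearGroup.toGL
      ((Matrix.SpecialLinearGroup.map (Int.castRingHom ℝ)) ModularGroup.T)) (z : ℂ) = 1 := by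
    rw [ModularGroup.denom_apply]
    simp [ModularGroup.T]
  rw [ModularForm.SL_slash_apply, h, one_zpow, mul_one]

lemma S_slash_apply (f : ℍ → ℂ) (k : ℤ) (z : ℍ) :
    (f ∣[k] ModularGroup.S) z = f (ModularGroup.S • z) * (z : ℂ) ^ (-k) := by
  rw [ModularForm.SL_slash_apply, ModularGroup.denom_S]

lemma tendsto_jacobiTheta₂_zero :
    Tendsto (fun z : ℍ => jacobiTheta₂ 0 (z : ℂ)) atImInfty (𝓝 1) := by
  have h : Tendsto (fun y : ℝ => 2 / (1 - Real.exp (-Real.pi * y)) * Real.exp (-Real.pi * y))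
      atTop (𝓝 (2 / (1 - 0) * 0)) := by
    have h : Tendsto (fun y : ℝ => Real.exp (-Real.pi * y)) atTop (𝓝 0) :=
      Real.tendsto_exp_atBot.comp (tendsto_id.const_mul_atTop_of_neg (neg_neg_of_pos Real.pi_pos))
    exact (tendsto_const_nhds.div (tendsto_const_nhds.sub h) (by norm_num)).mul h
  rw [mul_zero] at h
  rw [tendsto_iff_norm_sub_tendsto_zero]
  refine squeeze_zero (fun _ => norm_nonneg _) (fun z => ?_) (h.comp tendsto_comap)
  rw [← jacobiTheta_eq_jacobiTheta₂]
  exact norm_jacobiTheta_sub_one_le z.im_pos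

lemma tendsto_thetaU : Tendsto thetaU atImInfty (𝓝 1) := by
  have := tendsto_jacobiTheta₂_zero.pow 4
  rwa [one_pow] at this

lemma tendsto_T_smul : Tendsto (fun z : ℍ => ModularGroup.T • z) atImInfty atImInfty := by
  rw [atImInfty, tendsto_comap_iff]
  refine tendsto_comap.congr fun z => ?_
  rw [Function.comp_apply, modular_T_smul, vadd_im]

lemma tendsto_thetaW : Tendsto thetaW atImInfty (𝓝 1) := by
  refine (tendsto_thetaU.comp tendsto_T_smul).congr fun z => ?_
  exact thetaU_T_smul z

/-- Jacobi's identity. -/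
theorem thetaU_eq (z : ℍ) : thetaU z = thetaV z + thetaW z := by
  -- U - V - W changes sign under T and acquires the factor -z² under S. Its square is thus a level
  -- one form of weight 4, vanishing at i∞ since 1 - 0 - 1 = 0, and there is no nonzero cusp form of
  -- that weight.
  set J : ℍ → ℂ := fun z => (thetaU z - thetaV z - thetaW z) ^ 2 with hJ
  have hS : J ∣[(4 : ℤ)] ModularGroup.S = J := by
    ext z
    have hz : (z : ℂ) ≠ 0 := ne_zero z
    rw [S_slash_apply, hJ]
    simp only [thetaU_S_smul, thetaV_S_smul, thetaW_S_smul]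
    rw [zpow_neg, ← div_eq_mul_inv, div_eq_iff (zpow_ne_zero _ hz)]
    norm_cast
    ring
  have hT : J ∣[(4 : ℤ)] ModularGroup.T = J := by
    ext z
    rw [T_slash_apply, hJ]
    simp only [thetaU_T_smul, thetaV_T_smul, thetaW_T_smul]
    ring
  have hhol : DifferentiableOn ℂ (J ∘ ofComplex) {z | 0 < z.im} :=
    ((differentiableOn_thetaU.sub differentiableOn_thetaV).sub differentiableOn_thetaW).pow 2
  have hzero : IsZeroAtImInfty J := by
    have := ((tendsto_thetaU.sub tendsto_thetaV).sub tendsto_thetaW).pow 2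
    simpa [IsZeroAtImInfty, ZeroAtFilter] using this
  let F : CuspForm 𝒮ℒ 4 :=
    { toFun := J
      slash_action_eq' := fun A hA => by
        obtain ⟨A, rfl⟩ := hA
        exact SlashInvariantForm.slash_action_generators_SL2Z hS hT A
      holo' := UpperHalfPlane.mdifferentiable_iff.2 hhol
      zero_at_cusps' := fun hc => by
        rw [Subgroup.IsArithmetic.isCusp_iff_isCusp_SL2Z] at hc
        rw [OnePoint.isZeroAt_iff_forall_SL2Z hc]
        intro γ _
        rw [SlashInvariantForm.slash_action_generators_SL2Z hS hT]
        exact hzero }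
  have hF : F = 0 := rank_zero_iff_forall_zero.1
    (CuspForm.rank_eq_zero_of_weight_lt_twelve (k := 4) (by norm_num)) F
  have h0 : J z = 0 := congrFun (congrArg DFunLike.coe hF) z
  have := pow_eq_zero_iff (two_ne_zero) |>.1 h0
  linear_combination this

end Theta

/-! ### The level two kernel ψ. -/

section MinusKernel

/-- Induction on N: after the constant term is subtracted, division by q leaves a periodic
holomorphic function that is again bounded at i∞. -/
lemma exists_fourier_expansion (N : ℕ) : ∀ F : ℂ → ℂ, Function.Periodic F (1 : ℝ) →
    DifferentiableOn ℂ F {z | 0 < z.im} → BoundedAtFilter (comap Complex.im atTop) F →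
    ∃ β : ℕ → ℂ, Tendsto F (comap Complex.im atTop) (𝓝 (β 0)) ∧
      (fun z => F z - ∑ i ∈ Finset.range (N + 1), β i *
        Complex.exp (2 * Real.pi * Complex.I * z) ^ i) =O[comap Complex.im atTop]
        fun z => Real.exp (-(2 * Real.pi * (N + 1)) * z.im) := by
  have hopen : IsOpen {z : ℂ | 0 < z.im} := isOpen_lt continuous_const Complex.continuous_im
  induction N with
  | zero =>
    intro F hF hd hb
    have hd' : ∀ᶠ z in comap Complex.im atTop, DifferentiableAt ℂ F z :=
      (tendsto_comap.eventually (eventually_gt_atTop 0)).mono fun z hz =>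
        hd.differentiableAt (hopen.mem_nhds hz)
    refine ⟨fun _ => Function.Periodic.cuspFunction 1 F 0,
      Function.Periodic.tendsto_at_I_inf one_pos hF hd' hb, ?_⟩
    simpa using Function.Periodic.exp_decay_sub_of_bounded_at_inf one_pos hF hd' hb
  | succ N ih =>
    intro F hF hd hb
    have hd' : ∀ᶠ z in comap Complex.im atTop, DifferentiableAt ℂ F z :=
      (tendsto_comap.eventually (eventually_gt_atTop 0)).mono fun z hz =>
        hd.differentiableAt (hopen.mem_nhds hz)
    set L := Function.Periodic.cuspFunction 1 F 0 with hL
    have h0 := Function.Periodic.exp_decay_sub_of_bounded_at_inf one_pos hF hd' hb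
    set q : ℂ → ℂ := fun z => Complex.exp (2 * Real.pi * Complex.I * z) with hq
    have hq0 : ∀ z, q z ≠ 0 := fun z => Complex.exp_ne_zero _
    have hqn : ∀ z, ‖q z‖ = Real.exp (-2 * Real.pi * z.im) := fun z => by
      rw [hq, Complex.norm_exp]; congr 1; simp
    have hqp : ∀ z, q (z + 1) = q z := fun z => by
      simp only [hq]
      rw [mul_add, Complex.exp_add, mul_one, Complex.exp_two_pi_mul_I, mul_one]
    obtain ⟨β, -, hβ⟩ := ih (fun z => (F z - L) / q z) (fun z => by
        have := hF z
        simp only [Complex.ofReal_one] at this ⊢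
        rw [this, hqp])
      ((hd.sub_const L).div (by fun_prop) fun z _ => hq0 z) (by
        rw [BoundedAtFilter]
        have h2 : (fun z => (q z)⁻¹) =O[comap Complex.im atTop]
            fun z => Real.exp (2 * Real.pi * z.im) := by
          refine Asymptotics.IsBigO.of_norm_le fun z => ?_
          rw [norm_inv, hqn, ← Real.exp_neg]
          exact le_of_eq (by congr 1; ring)
        refine (h0.mul h2).congr (fun z => (div_eq_mul_inv _ _).symm) fun z => ?_
        rw [← Real.exp_add, div_one, Pi.one_apply, ← Real.exp_zero]
        congr 1; ring)
    refine ⟨fun i => Nat.casesOn i L β,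
      Function.Periodic.tendsto_at_I_inf one_pos hF hd' hb, ?_⟩
    have h2 : q =O[comap Complex.im atTop] fun z => Real.exp (-2 * Real.pi * z.im) :=
      Asymptotics.IsBigO.of_norm_le fun z => (hqn z).le
    refine (h2.mul hβ).congr (fun z => ?_) fun z => ?_
    · have hqz := hq0 z
      rw [Finset.sum_range_succ' _ (N + 1)]
      have : ∑ i ∈ Finset.range (N + 1), β i * q z ^ (i + 1) =
          q z * ∑ i ∈ Finset.range (N + 1), β i * q z ^ i := by
        rw [Finset.mul_sum]
        exact Finset.sum_congr rfl fun i _ => by ring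
      simp only [pow_zero, mul_one]
      change q z * ((F z - L) / q z - ∑ i ∈ Finset.range (N + 1), β i * q z ^ i) =
        F z - (∑ i ∈ Finset.range (N + 1), β i * q z ^ (i + 1) + L)
      rw [this, mul_sub]
      field_simp
      ring
    · rw [← Real.exp_add]; congr 1; push_cast; ring

lemma stripDecay_of_isBigO {F : ℂ → ℂ} {c : ℝ}
    (h : F =O[comap Complex.im atTop] fun z => Real.exp (-c * z.im)) : StripDecay c F := by
  obtain ⟨C, hC⟩ := h.bound
  obtain ⟨Y, hY⟩ := eventually_atTop.1 (eventually_comap.1 hC)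
  refine ⟨C, Y, fun z _ hz => ?_⟩
  have := hY z.im hz z rfl
  rwa [Real.norm_of_nonneg (Real.exp_pos _).le] at this

variable {l n : ℕ} {R : MvPolynomial (Fin 2) ℚ}

/-- The numerator of `ψ|T` is `R(-V, V + W)`. -/
lemma psi_T_smul (z : ℍ) : psi n R (ModularGroup.T • z) =
    MvPolynomial.aeval ![-thetaV z, thetaV z + thetaW z] R / discriminant z ^ n := by
  rw [psi, thetaV_T_smul, thetaW_T_smul, thetaU_eq, ← T_slash_apply discriminant 12,
    discriminant_T_invariant]

lemma psi_S_slash (hR : IsLevelTwoWeight R (12 * n - (2 * l : ℕ) + 2)) (z : ℍ) :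
    (psi n R ∣[(2 - (2 * l : ℕ) : ℤ)] ModularGroup.S) z =
      MvPolynomial.aeval ![-thetaW z, -thetaV z] R / discriminant z ^ n := by
  have hz : (z : ℂ) ≠ 0 := ne_zero z
  have hD := discriminant_ne_zero z
  have h := aeval_weighted_smul hR hz (-thetaW z) (-thetaV z)
  have e2 : (z : ℂ) ^ (2 : ℤ) = (z : ℂ) ^ 2 := by norm_cast
  simp only [Matrix.cons_val_zero, Matrix.cons_val_one, mul_neg, e2] at h
  rw [S_slash_apply, psi, thetaV_S_smul, thetaW_S_smul, discriminant_S_smul, neg_mul, neg_mul, h,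
    mul_pow, ← zpow_natCast ((z : ℂ) ^ (12 : ℤ)) n, ← zpow_mul, zpow_add₀ hz, zpow_sub₀ hz,
    neg_sub, zpow_sub₀ hz]
  have := zpow_ne_zero (12 * n : ℤ) hz
  have h3 : (z : ℂ) ^ ((2 * l : ℕ) : ℤ) ≠ 0 := zpow_ne_zero _ hz
  field_simp

lemma psi_S_smul (hR : IsLevelTwoWeight R (12 * n - (2 * l : ℕ) + 2)) (z : ℍ) :
    psi n R (ModularGroup.S • z) = (z : ℂ) ^ (2 - (2 * l : ℕ) : ℤ) *
      (MvPolynomial.aeval ![-thetaW z, -thetaV z] R / discriminant z ^ n) := by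
  have hz : (z : ℂ) ≠ 0 := ne_zero z
  rw [← psi_S_slash hR, S_slash_apply, mul_left_comm, ← zpow_add₀ hz, add_neg_cancel, zpow_zero,
    mul_one]

lemma psi_eq_slash_add_slash (hR : IsLevelTwoWeight R (12 * n - (2 * l : ℕ) + 2))
    (hrel : ∀ v w : ℂ, MvPolynomial.aeval ![v, w] R =
      MvPolynomial.aeval ![-v, v + w] R + MvPolynomial.aeval ![-w, -v] R) :
    psi n R = psi n R ∣[(2 - (2 * l : ℕ) : ℤ)] ModularGroup.T +
      psi n R ∣[(2 - (2 * l : ℕ) : ℤ)] ModularGroup.S := by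
  ext z
  rw [Pi.add_apply, psi_S_slash hR, T_slash_apply, psi_T_smul, psi, hrel, add_div]

/-- The function `ψ|S`. -/
def slashedPsi (n : ℕ) (R : MvPolynomial (Fin 2) ℚ) (z : ℍ) : ℂ :=
  MvPolynomial.aeval ![-thetaW z, -thetaV z] R / discriminant z ^ n

/-- V^{2n+1} is of size e^{-π(2n+1) Im z} and 1/Δⁿ of size e^{2πn Im z}, which leaves e^{-π Im z}.
-/
lemma exists_bound_slashedPsi {K : ℝ} (hK : ∀ v w : ℂ, ‖v‖ ≤ 1 / 4 → ‖w - 1‖ ≤ 1 / 4 →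
      ‖MvPolynomial.aeval ![-w, -v] R‖ ≤ K * ‖v‖ ^ (2 * n + 1)) :
    ∃ C Y : ℝ, ∀ z : ℍ, Y ≤ z.im → ‖slashedPsi n R z‖ ≤ C * Real.exp (-Real.pi * z.im) := by
  obtain ⟨D, Y, hD0, hD⟩ := exists_bound_inv_discriminant
  obtain ⟨M, hM⟩ := exists_bound_thetaV
  have h1 : ∀ᶠ z in atImInfty, ‖thetaV z‖ ≤ 1 / 4 := by
    have := tendsto_thetaV.norm
    rw [norm_zero] at this
    exact this.eventually (eventually_le_nhds (by norm_num))
  have h2 : ∀ᶠ z in atImInfty, ‖thetaW z - 1‖ ≤ 1 / 4 := by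
    have := (tendsto_thetaW.sub_const 1).norm
    rw [sub_self, norm_zero] at this
    exact this.eventually (eventually_le_nhds (by norm_num))
  obtain ⟨Y', hY'⟩ := (atImInfty_mem _).1 (h1.and h2)
  have hM0 : 0 ≤ M := nonneg_of_mul_nonneg_left ((norm_nonneg _).trans (hM UpperHalfPlane.I (by simp)))
    (Real.exp_pos _)
  have hK0 : 0 ≤ K * (1 / 4) ^ (2 * n + 1) := by
    have := (norm_nonneg _).trans (hK (1 / 4) 1 (by simp) (by simp))
    simpa using this
  have hK0 : 0 ≤ K := nonneg_of_mul_nonneg_left hK0 (by positivity)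
  refine ⟨K * M ^ (2 * n + 1) * D ^ n, max 1 (max Y Y'), fun z hz => ?_⟩
  have a1 : 1 ≤ z.im := (le_max_left _ _).trans hz
  have a2 := (le_max_right _ _).trans hz
  obtain ⟨b1, b2⟩ := hY' z ((le_max_right _ _).trans a2)
  rw [slashedPsi, div_eq_mul_inv, norm_mul, ← inv_pow, norm_pow]
  calc _ ≤ K * (M * Real.exp (-Real.pi * z.im)) ^ (2 * n + 1) *
        (D * Real.exp (2 * Real.pi * z.im)) ^ n := by
        gcongr
        · exact (hK _ _ b1 b2).trans (by gcongr; exact hM z a1)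
        · exact hD z ((le_max_left _ _).trans a2)
    _ = K * M ^ (2 * n + 1) * D ^ n * (Real.exp (-Real.pi * z.im) ^ (2 * n + 1) *
        Real.exp (2 * Real.pi * z.im) ^ n) := by rw [mul_pow, mul_pow]; ring
    _ = _ := by
      rw [← Real.exp_nat_mul, ← Real.exp_nat_mul, ← Real.exp_add]
      congr 2; push_cast; ring

lemma T_smul_eq_ofComplex {z : ℂ} (hz : 0 < z.im) :
    ofComplex (z + 1) = ModularGroup.T • ofComplex z := by
  have hz1 : 0 < (z + 1).im := by simpa using hz
  rw [ofComplex_apply_of_im_pos hz, ofComplex_apply_of_im_pos hz1, modular_T_smul]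
  apply UpperHalfPlane.ext
  rw [coe_vadd]
  simp [add_comm]

lemma differentiableOn_aeval_theta {f g : ℂ → ℂ} {s : Set ℂ} (hf : DifferentiableOn ℂ f s)
    (hg : DifferentiableOn ℂ g s) (R : MvPolynomial (Fin 2) ℚ) :
    DifferentiableOn ℂ (fun z => MvPolynomial.aeval ![f z, g z] R) s := by
  induction R using MvPolynomial.induction_on with
  | C a => simp
  | add p q hp hq => refine (hp.add hq).congr fun z _ => by simp
  | mul_X p i hp =>
    fin_cases i
    · refine (hp.mul hf).congr fun z _ => by simp
    · refine (hp.mul hg).congr fun z _ => by simp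

lemma differentiableOn_slashedPsi :
    DifferentiableOn ℂ (fun z => slashedPsi n R (ofComplex z)) {z | 0 < z.im} :=
  (differentiableOn_aeval_theta differentiableOn_thetaW.neg differentiableOn_thetaV.neg R).div
    (differentiableOn_discriminant.pow n) fun _ _ => pow_ne_zero _ (discriminant_ne_zero _)

lemma differentiableOn_psi :
    DifferentiableOn ℂ (fun z => psi n R (ofComplex z)) {z | 0 < z.im} :=
  (differentiableOn_aeval_theta differentiableOn_thetaV differentiableOn_thetaW R).div
    (differentiableOn_discriminant.pow n) fun _ _ => pow_ne_zero _ (discriminant_ne_zero _)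

lemma psi_T_eq (hrel : ∀ v w : ℂ, MvPolynomial.aeval ![v, w] R =
      MvPolynomial.aeval ![-v, v + w] R + MvPolynomial.aeval ![-w, -v] R) (z : ℍ) :
    psi n R (ModularGroup.T • z) = psi n R z - slashedPsi n R z := by
  rw [psi_T_smul, psi, slashedPsi, hrel (thetaV z)]
  ring

lemma psi_T_T_eq (z : ℍ) :
    psi n R (ModularGroup.T • ModularGroup.T • z) = psi n R z := by
  rw [psi_T_smul, thetaV_T_smul, thetaW_T_smul, ← T_slash_apply discriminant 12,
    discriminant_T_invariant, thetaU_eq, psi]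
  simp

/-- Apply ψ|T = ψ - ψ|S twice and use that ψ is invariant under T². -/
lemma slashedPsi_T_smul (hrel : ∀ v w : ℂ, MvPolynomial.aeval ![v, w] R =
      MvPolynomial.aeval ![-v, v + w] R + MvPolynomial.aeval ![-w, -v] R) (z : ℍ) :
    slashedPsi n R (ModularGroup.T • z) = -slashedPsi n R z := by
  have h1 := psi_T_eq (n := n) hrel (ModularGroup.T • z)
  rw [psi_T_T_eq, psi_T_eq hrel] at h1
  linear_combination h1

lemma stripDecay_slashedPsi {K : ℝ} (hK : ∀ v w : ℂ, ‖v‖ ≤ 1 / 4 → ‖w - 1‖ ≤ 1 / 4 →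
      ‖MvPolynomial.aeval ![-w, -v] R‖ ≤ K * ‖v‖ ^ (2 * n + 1)) :
    StripDecay Real.pi fun z => slashedPsi n R (ofComplex z) := by
  obtain ⟨C, Y, hC⟩ := exists_bound_slashedPsi hK
  refine ⟨C, max Y 1, fun z _ hz => ?_⟩
  have h0 : 0 < z.im := lt_of_lt_of_le one_pos ((le_max_right _ _).trans hz)
  simp only [ofComplex_apply_of_im_pos h0]
  exact hC ⟨z, h0⟩ ((le_max_left _ _).trans hz)

/-- Here h = -ψ|S. As ψ(z - 1) = ψ(z + 1), the second difference is 2(ψ(z + 1) - ψ(z)) = -2(ψ|S)(z).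
-/
lemma modularKernel_psi (hl : 1 ≤ l) (hR : IsLevelTwoWeight R (12 * n - (2 * l : ℕ) + 2))
    (hrel : ∀ v w : ℂ, MvPolynomial.aeval ![v, w] R =
      MvPolynomial.aeval ![-v, v + w] R + MvPolynomial.aeval ![-w, -v] R) {K : ℝ}
    (hK : ∀ v w : ℂ, ‖v‖ ≤ 1 / 4 → ‖w - 1‖ ≤ 1 / 4 →
      ‖MvPolynomial.aeval ![-w, -v] R‖ ≤ K * ‖v‖ ^ (2 * n + 1)) :
    ModularKernel (2 * l - 2) (-1) Real.pi (fun z => -1 * slashedPsi n R (ofComplex z))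
      (fun z => psi n R (ofComplex z)) where
  even := ⟨l - 1, by omega⟩
  sq := by norm_num
  pos := Real.pi_pos
  hol := differentiableOn_slashedPsi.const_mul _
  per z hz := by rw [T_smul_eq_ofComplex hz, slashedPsi_T_smul hrel]; ring
  decay := (stripDecay_slashedPsi hK).const_mul _
  eq_inv z hz := by
    have hi := ModularKernel.neg_inv_im_pos hz
    have hz0 := ModularKernel.ne_zero_of_im_pos hz
    have h := psi_S_smul hR ⟨_, hi⟩
    have hzz : -1 / (-1 / z) = z := by field_simp
    rw [S_smul_eq_ofComplex hi, hzz] at h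
    have e : ((-1 / z : ℂ)) ^ (2 - (2 * l : ℕ) : ℤ) = z ^ (2 * l - 2) := by
      rw [show (2 - (2 * l : ℕ) : ℤ) = -((2 * l - 2 : ℕ) : ℤ) by omega, zpow_neg, zpow_natCast,
        neg_div, Even.neg_pow ⟨l - 1, by omega⟩, one_div, inv_pow, inv_inv]
    rw [h, ofComplex_apply_of_im_pos hi, slashedPsi]
    show (-1 / z : ℂ) ^ (2 - (2 * l : ℕ) : ℤ) * _ = _
    rw [e]
    ring
  diff_two z hz := by
    have hz2 : 0 < (z - 1).im := by simpa using hz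
    have e := T_smul_eq_ofComplex hz2
    rw [sub_add_cancel] at e
    have h1 : psi n R (ofComplex (z - 1)) = psi n R (ofComplex (z + 1)) := by
      rw [T_smul_eq_ofComplex hz, e, psi_T_T_eq]
    rw [h1, T_smul_eq_ofComplex hz, psi_T_eq hrel]
    ring

/-- The `T`-invariant part of `ψ`, multiplied by `qⁿ`. -/
def regularizedPsi (n : ℕ) (R : MvPolynomial (Fin 2) ℚ) (z : ℂ) : ℂ :=
  (psi n R (ofComplex z) - slashedPsi n R (ofComplex z) / 2) *
    Complex.exp (2 * Real.pi * Complex.I * z) ^ n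

lemma differentiableOn_regularizedPsi :
    DifferentiableOn ℂ (regularizedPsi n R) {z | 0 < z.im} :=
  (differentiableOn_psi.sub (differentiableOn_slashedPsi.div_const 2)).mul (by fun_prop)

/-- T sends ψ to ψ - ψ|S and changes the sign of ψ|S, so ψ - (ψ|S)/2 is invariant. Off the
half-plane `ofComplex` is constant, hence periodicity on all of ℂ. -/
lemma periodic_regularizedPsi (hrel : ∀ v w : ℂ, MvPolynomial.aeval ![v, w] R =
      MvPolynomial.aeval ![-v, v + w] R + MvPolynomial.aeval ![-w, -v] R) :
    Function.Periodic (regularizedPsi n R) (1 : ℝ) := by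
  intro z
  have hq : Complex.exp (2 * Real.pi * Complex.I * (z + 1)) =
      Complex.exp (2 * Real.pi * Complex.I * z) := by
    rw [mul_add, Complex.exp_add, mul_one, Complex.exp_two_pi_mul_I, mul_one]
  rw [Complex.ofReal_one, regularizedPsi, regularizedPsi, hq]
  by_cases hz : 0 < z.im
  · rw [T_smul_eq_ofComplex hz, psi_T_eq hrel, slashedPsi_T_smul hrel]
    ring
  · have hz1 : ¬ 0 < (z + 1).im := by simpa using hz
    rw [ofComplex_apply_of_im_nonpos (not_lt.1 hz), ofComplex_apply_of_im_nonpos (not_lt.1 hz1)]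

lemma tendsto_exp_div_discriminant :
    Tendsto (fun z : ℍ => Complex.exp (2 * Real.pi * Complex.I * z) / discriminant z)
      atImInfty (𝓝 1) := by
  obtain ⟨δ, hδ, hδ'⟩ := exists_deltaq_eq
  have hdvd : PowerSeries.X ^ 2 ∣ deltaq - PowerSeries.X := by
    rw [PowerSeries.X_pow_dvd_iff]
    intro m hm
    rw [hδ']
    interval_cases m
    · simp
    · rw [map_sub, ← zero_add 1, PowerSeries.coeff_succ_X_mul]
      simp [hδ]
  obtain ⟨C, hC⟩ := (hasQSeries_discriminant.sub hasQSeries_X).exists_bound hdvd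
  obtain ⟨D, Y, hD0, hD⟩ := exists_bound_inv_discriminant
  rw [tendsto_iff_norm_sub_tendsto_zero]
  refine squeeze_zero' (Eventually.of_forall fun _ => norm_nonneg _) ?_
    (by simpa using tendsto_exp_neg_pi_im.const_mul (C * D))
  filter_upwards [(atImInfty_mem {z | max Y 1 ≤ z.im}).2 ⟨max Y 1, fun z hz => hz⟩] with z hz
  have h1 : ‖discriminant z - Complex.exp (2 * Real.pi * Complex.I * z)‖ ≤
      C * Real.exp (-(2 * Real.pi * (2 : ℕ)) * z.im) := hC z ((le_max_right _ _).trans hz)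
  have h2 := hD z ((le_max_left _ _).trans hz)
  have hz1 : 1 ≤ z.im := (le_max_right _ _).trans hz
  have hd := discriminant_ne_zero z
  have hC0 : 0 ≤ C := nonneg_of_mul_nonneg_left ((norm_nonneg _).trans h1) (Real.exp_pos _)
  have e : Complex.exp (2 * Real.pi * Complex.I * z) / discriminant z - 1 =
      -((discriminant z - Complex.exp (2 * Real.pi * Complex.I * z)) * (discriminant z)⁻¹) := by
    field_simp
    ring
  rw [e, norm_neg, norm_mul]
  refine (mul_le_mul h1 h2 (norm_nonneg _) ((norm_nonneg _).trans h1)).trans ?_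
  rw [mul_mul_mul_comm, ← Real.exp_add]
  refine mul_le_mul_of_nonneg_left (Real.exp_le_exp.2 ?_) (mul_nonneg hC0 hD0)
  have := mul_pos Real.pi_pos z.im_pos
  push_cast
  linarith

lemma tendsto_aeval_pair {α : Type*} {F : Filter α} {f g : α → ℂ} {a b : ℂ}
    (hf : Tendsto f F (𝓝 a)) (hg : Tendsto g F (𝓝 b)) (R : MvPolynomial (Fin 2) ℚ) :
    Tendsto (fun z => MvPolynomial.aeval ![f z, g z] R) F (𝓝 (MvPolynomial.aeval ![a, b] R)) := by
  induction R using MvPolynomial.induction_on with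
  | C c => simpa using tendsto_const_nhds
  | add p q hp hq => simpa using hp.add hq
  | mul_X p i hp =>
    fin_cases i
    · simpa using hp.mul hf
    · simpa using hp.mul hg

/-- At the cusp V → 0, W → 1 and q/Δ → 1, while R(-1, 0) = 0 by the bound at v = 0. -/
lemma tendsto_regularizedPsi {K : ℝ} (hK : ∀ v w : ℂ, ‖v‖ ≤ 1 / 4 → ‖w - 1‖ ≤ 1 / 4 →
      ‖MvPolynomial.aeval ![-w, -v] R‖ ≤ K * ‖v‖ ^ (2 * n + 1)) :
    Tendsto (regularizedPsi n R) (comap Complex.im atTop)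
      (𝓝 (MvPolynomial.aeval ![(0 : ℂ), 1] R)) := by
  have h0 : MvPolynomial.aeval ![(-1 : ℂ), -0] R = 0 := by
    have := hK 0 1 (by simp) (by simp)
    rw [norm_zero, zero_pow (by omega), mul_zero] at this
    exact norm_le_zero_iff.1 this
  have h1 : Tendsto (fun z : ℍ => (MvPolynomial.aeval ![thetaV z, thetaW z] R -
      MvPolynomial.aeval ![-thetaW z, -thetaV z] R / 2) *
      (Complex.exp (2 * Real.pi * Complex.I * z) / discriminant z) ^ n) atImInfty
      (𝓝 (MvPolynomial.aeval ![(0 : ℂ), 1] R)) := by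
    have := ((tendsto_aeval_pair tendsto_thetaV tendsto_thetaW R).sub
      ((tendsto_aeval_pair tendsto_thetaW.neg tendsto_thetaV.neg R).div_const 2)).mul
      (tendsto_exp_div_discriminant.pow n)
    rwa [h0, zero_div, sub_zero, one_pow, mul_one] at this
  refine (h1.comp tendsto_comap_im_ofComplex).congr' ?_
  filter_upwards [tendsto_comap.eventually (eventually_gt_atTop 0)] with z hz
  have hz' : 0 < z.im := hz
  rw [Function.comp_apply, regularizedPsi, ofComplex_apply_of_im_pos hz', psi, slashedPsi, div_pow]
  show _ * (Complex.exp (2 * Real.pi * Complex.I * z) ^ n / _) = _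
  ring

/-- Up to (ψ|S)/2, which decays, ψ is periodic with a pole of order at most n in q. Its principal
part therefore has no term linear in z, which is why f₋ vanishes at all √(2m). -/
lemma exists_principalPart_psi (hrel : ∀ v w : ℂ, MvPolynomial.aeval ![v, w] R =
      MvPolynomial.aeval ![-v, v + w] R + MvPolynomial.aeval ![-w, -v] R) {K : ℝ}
    (hK : ∀ v w : ℂ, ‖v‖ ≤ 1 / 4 → ‖w - 1‖ ≤ 1 / 4 →
      ‖MvPolynomial.aeval ![-w, -v] R‖ ≤ K * ‖v‖ ^ (2 * n + 1)) :
    ∃ b : ℕ → ℂ, b n = MvPolynomial.aeval ![(0 : ℂ), 1] R ∧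
      StripDecay Real.pi fun z => psi n R (ofComplex z) - principalPart n (fun _ => 0) b z := by
  have hlim := tendsto_regularizedPsi hK
  obtain ⟨β, hβ0, hβ⟩ := exists_fourier_expansion n (regularizedPsi n R)
    (periodic_regularizedPsi hrel) differentiableOn_regularizedPsi (hlim.isBigO_one ℝ)
  have hne : (comap Complex.im atTop).NeBot :=
    atTop_neBot.comap_of_surj fun y => ⟨y * Complex.I, by simp⟩
  refine ⟨fun m => β (n - m), ?_, ?_⟩
  · simpa using tendsto_nhds_unique hβ0 hlim
  have hinv : (fun z : ℂ => (Complex.exp (2 * Real.pi * Complex.I * z) ^ n)⁻¹)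
      =O[comap Complex.im atTop] fun z => Real.exp (2 * Real.pi * n * z.im) := by
    refine Asymptotics.IsBigO.of_norm_le fun z => ?_
    rw [norm_inv, norm_pow, Complex.norm_exp, ← Real.exp_nat_mul, ← Real.exp_neg]
    refine le_of_eq ?_
    congr 1
    simp
    ring
  have h1 := stripDecay_of_isBigO (c := 2 * Real.pi) ((hβ.mul hinv).congr_right fun z => by
    rw [← Real.exp_add]; congr 1; ring)
  refine ((h1.mono (by linarith [Real.pi_pos])).add
    ((stripDecay_slashedPsi hK).const_mul (1 / 2))).congr fun z hz => ?_
  have e : principalPart n (fun _ => 0) (fun m => β (n - m)) z =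
      (∑ i ∈ Finset.range (n + 1), β i * Complex.exp (2 * Real.pi * Complex.I * z) ^ i) *
        (Complex.exp (2 * Real.pi * Complex.I * z) ^ n)⁻¹ := by
    rw [← Finset.sum_range_reflect, principalPart, Finset.sum_mul]
    refine Finset.sum_congr rfl fun m hm => ?_
    have hmn := Nat.lt_succ_iff.1 (Finset.mem_range.1 hm)
    rw [Nat.add_sub_cancel, zero_mul, zero_add, mul_assoc (β (n - m)), ← Complex.exp_nat_mul,
      ← Complex.exp_nat_mul, ← Complex.exp_neg, ← Complex.exp_add]
    congr 2
    rw [Nat.cast_sub hmn]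
    ring
  rw [e, regularizedPsi]
  have := pow_ne_zero n (Complex.exp_ne_zero (2 * Real.pi * Complex.I * z))
  field_simp
  ring

lemma aeval_theta_ofReal (v w : ℝ) : MvPolynomial.aeval ![(v : ℂ), (w : ℂ)] R =
    ((MvPolynomial.aeval ![v, w] R : ℝ) : ℂ) := by
  have := MvPolynomial.aeval_algebraMap_apply ℂ ![v, w] R
  rw [← Complex.coe_algebraMap, ← this]
  congr 2
  ext i
  fin_cases i <;> simp

lemma psi_real {t : ℝ} (ht : 0 < t) : (psi n R (ofComplex (t * Complex.I))).im = 0 := by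
  have hz : 0 < (t * Complex.I : ℂ).im := by simpa using ht
  rw [ofComplex_apply_of_im_pos hz]
  have hre : (⟨_, hz⟩ : ℍ).re = 0 := by
    show (t * Complex.I : ℂ).re = 0
    simp
  have h2 := hasQSeries_discriminant.im_eq_zero hre
  have real : ∀ {w : ℂ}, w.im = 0 → w = (w.re : ℂ) := fun h => Complex.ext rfl (by simp [h])
  have h4 : ∃ x : ℝ, theta4 ⟨_, hz⟩ = x := by
    refine ⟨∑' n : ℤ, (-1) ^ n * Real.exp (-(Real.pi * n ^ 2 * t)), ?_⟩
    rw [theta4, Complex.ofReal_tsum]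
    refine tsum_congr fun n => ?_
    push_cast
    congr 2
    show Real.pi * Complex.I * (n : ℂ) ^ 2 * (t * Complex.I) = _
    linear_combination (Real.pi * (n : ℂ) ^ 2 * t) * Complex.I_sq
  have h5 : ∃ x : ℝ, theta2 ⟨_, hz⟩ = x := by
    refine ⟨∑' n : ℤ, Real.exp (-(Real.pi * (n + 1 / 2) ^ 2 * t)), ?_⟩
    rw [theta2, Complex.ofReal_tsum]
    refine tsum_congr fun n => ?_
    push_cast
    congr 1
    show Real.pi * Complex.I * ((n : ℂ) + 1 / 2) ^ 2 * (t * Complex.I) = _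
    linear_combination (Real.pi * ((n : ℂ) + 1 / 2) ^ 2 * t) * Complex.I_sq
  obtain ⟨x, hx⟩ := h4
  obtain ⟨y, hy⟩ := h5
  rw [psi, thetaV, thetaW, hx, hy, ← Complex.ofReal_pow, ← Complex.ofReal_pow, aeval_theta_ofReal,
    real h2, ← Complex.ofReal_pow, ← Complex.ofReal_div, Complex.ofReal_im]

end MinusKernel

/-! ### Real eigenfunctions, radial derivatives and coefficients. -/

section Assembly

/-- The numerator is P δⁿ and the denominator qⁿ δⁿ, so the quotient is P shifted by n. -/
lemma coeff_valueSeries {n m : ℕ} {B C : MvPolynomial (Fin 2) ℚ} {δ P : PowerSeries ℚ}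
    (hδ : deltaq = PowerSeries.X * δ) (hδ0 : δ ≠ 0)
    (hP : MvPolynomial.aeval ![E4q, E6q] B + 2 * MvPolynomial.aeval ![E4q, E6q] C * E2q =
      P * δ ^ n) (hm : m ≤ n) :
    (valueSeries n B C).coeff (-(m : ℤ)) = PowerSeries.coeff (n - m) P := by
  have hδ' : HahnSeries.ofPowerSeries ℤ ℚ deltaq ^ n ≠ 0 := by
    rw [hδ]
    refine pow_ne_zero _ fun h => mul_ne_zero PowerSeries.X_ne_zero hδ0 ?_
    exact HahnSeries.ofPowerSeries_injective (h.trans (map_zero _).symm)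
  have e : valueSeries n B C =
      HahnSeries.ofPowerSeries ℤ ℚ P * HahnSeries.single (-(n : ℤ)) (1 : ℚ) := by
    rw [valueSeries, div_eq_iff hδ', hP, hδ, ← map_pow, mul_pow, map_mul, map_mul,
      HahnSeries.ofPowerSeries_X_pow]
    have : HahnSeries.single (-(n : ℤ)) (1 : ℚ) * HahnSeries.single (n : ℤ) (1 : ℚ) = 1 := by
      rw [HahnSeries.single_mul_single]; simp
    linear_combination -(HahnSeries.ofPowerSeries ℤ ℚ P *
      HahnSeries.ofPowerSeries ℤ ℚ (δ ^ n)) * this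
  have hm' : -(m : ℤ) = ((n - m : ℕ) : ℤ) + -(n : ℤ) := by omega
  rw [e, hm', HahnSeries.coeff_mul_single_add, mul_one]
  exact LaurentSeries.coeff_coe_powerSeries _ _

/-- The eigenfunction built from a modular kernel which is real on the imaginary axis is real. -/
lemma ModularKernel.exists_real_eigenfunction {κ n : ℕ} {ε : ℂ} {c : ℝ} {h g : ℂ → ℂ}
    {a b : ℕ → ℂ} {E : Type*} [NormedAddCommGroup E] [InnerProductSpace ℝ E]
    [FiniteDimensional ℝ E] [MeasurableSpace E] [BorelSpace E]
    (H : ModularKernel κ ε c h g) (hg : StripDecay c fun z => g z - principalPart n a b z)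
    (hreal : ∀ t : ℝ, 0 < t → (g (t * Complex.I)).im = 0)
    (hE : Module.finrank ℝ E = 2 * (κ + 2)) (r : ℝ) :
    ∃ f : 𝓢(E, ℝ), (∀ x, (f x : ℂ) = r * profile κ ε h ((‖x‖ ^ 2 : ℝ) : ℂ)) ∧
      ∀ y, 𝓕 (fun x => (f x : ℂ)) y = ε * Complex.I ^ (κ + 2) * f y := by
  obtain ⟨F, hF, hF'⟩ := H.exists_eigenfunction hE
  have hre : ∀ x, (((r • F.postcompCLM Complex.reCLM : 𝓢(E, ℝ)) x : ℝ) : ℂ) = r * F x := by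
    intro x
    have him : (F x).im = 0 := by
      rw [hF]; exact H.profile_real hg hreal (sq_nonneg _)
    have : ((F x).re : ℂ) = F x := Complex.ext rfl (by simp [him])
    rw [← this]
    simp [SchwartzMap.postcompCLM_apply]
  refine ⟨r • F.postcompCLM Complex.reCLM, fun x => by rw [hre, hF], fun y => ?_⟩
  simp_rw [hre]
  have : (fun x => (r : ℂ) * F x) = ⇑((r : ℂ) • F) := by ext; simp
  rw [this, ← SchwartzMap.fourier_coe, FourierTransform.fourier_smul, smul_apply,
    SchwartzMap.fourier_coe, hF', smul_eq_mul]
  ring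

lemma fourier_ofReal_add {E : Type*} [NormedAddCommGroup E] [InnerProductSpace ℝ E]
    [FiniteDimensional ℝ E] [MeasurableSpace E] [BorelSpace E] (f g : 𝓢(E, ℝ)) (y : E) :
    𝓕 (fun x => (((f + g) x : ℝ) : ℂ)) y =
      𝓕 (fun x => (f x : ℂ)) y + 𝓕 (fun x => (g x : ℂ)) y := by
  have key : ∀ u : 𝓢(E, ℝ), (fun x => (u x : ℂ)) = ⇑(u.postcompCLM Complex.ofRealCLM) :=
    fun u => rfl
  rw [key, key f, key g, ← SchwartzMap.fourier_coe, ← SchwartzMap.fourier_coe,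
    ← SchwartzMap.fourier_coe, map_add, FourierTransform.fourier_add, add_apply]

/-- The chain rule for s = r² supplies the factor 2√(2m). -/
lemma deriv_radial {E : Type*} [NormedAddCommGroup E] [NormedSpace ℝ E] {f : E → ℝ} {P : ℂ → ℂ}
    {D : ℂ} {m : ℕ} (hf : ∀ x, (f x : ℂ) = P ((‖x‖ ^ 2 : ℝ) : ℂ))
    (hP : HasDerivAt P D (2 * m)) {e : E} (he : ‖e‖ = 1) :
    deriv (fun r : ℝ => f (r • e)) √(2 * m) = (D * (2 * (√(2 * m) : ℝ))).re := by
  have hs : (((√(2 * m) : ℝ) : ℂ)) ^ 2 = 2 * m := by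
    rw [← Complex.ofReal_pow, Real.sq_sqrt (by positivity)]; simp
  have h1 : HasDerivAt (fun z : ℂ => P (z ^ 2)) (D * (2 * (√(2 * m) : ℝ)))
      ((√(2 * m) : ℝ) : ℂ) := by
    have h0 : HasDerivAt P D ((fun z : ℂ => z ^ 2) ((√(2 * m) : ℝ) : ℂ)) := by
      simpa only [hs] using hP
    simpa [Function.comp_def] using
      h0.comp ((√(2 * m) : ℝ) : ℂ) (hasDerivAt_pow 2 ((√(2 * m) : ℝ) : ℂ))
  have h2 : (fun r : ℝ => f (r • e)) = fun r : ℝ => (P ((r : ℂ) ^ 2)).re := by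
    ext r
    have := hf (r • e)
    rw [norm_smul, he, mul_one, Real.norm_eq_abs, sq_abs, Complex.ofReal_pow] at this
    rw [← this, Complex.ofReal_re]
  rw [h2]
  exact h1.real_of_complex.deriv

lemma isZeroAtImInfty_of_bound {f : ℍ → ℂ} {c C Y : ℝ} (hc : Real.pi ≤ c)
    (h : ∀ z : ℍ, Y ≤ z.im → ‖f z‖ ≤ C * Real.exp (-c * z.im)) : IsZeroAtImInfty f := by
  refine squeeze_zero_norm' ?_ (by simpa using tendsto_exp_neg_pi_im.const_mul |C|)
  filter_upwards [(atImInfty_mem {z | Y ≤ z.im}).2 ⟨Y, fun z hz => hz⟩] with z hz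
  refine (h z hz).trans (mul_le_mul (le_abs_self C) (Real.exp_le_exp.2 ?_) (Real.exp_nonneg _)
    (abs_nonneg _))
  linarith [mul_le_mul_of_nonneg_right hc z.im_pos.le]

lemma isZeroAtImInfty_phi {n : ℕ} {A C : MvPolynomial (Fin 2) ℚ}
    (h : PowerSeries.X ^ (n + 1) ∣ MvPolynomial.aeval ![E4q, E6q] A +
      MvPolynomial.aeval ![E4q, E6q] C * E2q ^ 2) : IsZeroAtImInfty (phi n A 0 C) := by
  obtain ⟨K, hK⟩ := (hasQSeries_phi_num A C).exists_bound h
  obtain ⟨D, Y, hD0, hD⟩ := exists_bound_inv_discriminant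
  refine isZeroAtImInfty_of_bound (c := 2 * Real.pi) (C := K * D ^ n) (Y := max Y 1)
    (by linarith [Real.pi_pos]) fun z hz => ?_
  have h1 := hK z ((le_max_right _ _).trans hz)
  have h2 := pow_le_pow_left₀ (norm_nonneg _) (hD z ((le_max_left _ _).trans hz)) n
  rw [phi, div_eq_mul_inv, norm_mul, ← inv_pow, norm_pow]
  refine (mul_le_mul h1 h2 (by positivity) ((norm_nonneg _).trans h1)).trans (le_of_eq ?_)
  rw [mul_pow, mul_mul_mul_comm, ← Real.exp_nat_mul, ← Real.exp_add]
  congr 2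
  push_cast
  ring

lemma I_pow_eq_neg_I_zpow (l : ℕ) :
    Complex.I ^ (2 * l) = (-Complex.I) ^ (-((2 * l : ℕ) : ℤ)) := by
  rw [zpow_neg, zpow_natCast, Even.neg_pow ⟨l, by omega⟩, pow_mul, Complex.I_sq, ← inv_pow]
  norm_num

end Assembly

/-! ### The integral representations outside radius √(2n). -/

section Integrals

variable {E : Type*} [NormedAddCommGroup E]

lemma plus_laplace {l n : ℕ} {A C : MvPolynomial (Fin 2) ℚ} {a b : ℕ → ℂ} {f : E → ℝ}
    (H : ModularKernel (2 * l - 2) 1 Real.pi (fun z => phi n A 0 C (ofComplex z))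
      (invertedPhi l n A C))
    (hg : StripDecay Real.pi fun z => invertedPhi l n A C z - principalPart n a b z) {r : ℝ}
    (hf : ∀ x, (f x : ℂ) = r * profile (2 * l - 2) 1 (fun z => phi n A 0 C (ofComplex z))
      ((‖x‖ ^ 2 : ℝ) : ℂ)) {d : ℕ} (hd : d / 2 = 2 * l) (x : E) (hx : √(2 * n) < ‖x‖) :
    IntegrableOn (plusIntegrand d (phi n A 0 C) ‖x‖) (Ioi 0) ∧
      (f x : ℂ) = r * Real.sin (Real.pi * ‖x‖ ^ 2 / 2) ^ 2 *
        ∫ t in Ioi (0 : ℝ), plusIntegrand d (phi n A 0 C) ‖x‖ t := by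
  have hs : 2 * (n : ℝ) < ‖x‖ ^ 2 := (Real.sqrt_lt (by positivity) (norm_nonneg _)).1 hx
  obtain ⟨c', hc', hc⟩ := stripDecay_growth Real.pi_pos hg hs
  obtain ⟨h1, h2⟩ := H.profile_eq_laplace (sq_nonneg _) hc' hc
  have e : (fun t : ℝ => invertedPhi l n A C (t * Complex.I) *
      Real.exp (-Real.pi * ‖x‖ ^ 2 * t)) = plusIntegrand d (phi n A 0 C) ‖x‖ := by
    ext t
    have : -1 / ((t : ℂ) * Complex.I) = Complex.I / t := by
      rw [← div_div, div_eq_mul_inv _ Complex.I, Complex.inv_I]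
      ring
    rw [invertedPhi, plusIntegrand, hd, this, one_mul, mul_comm (t : ℂ) Complex.I]
    ring
  rw [e] at h1 h2
  refine ⟨h1, ?_⟩
  rw [hf, h2]
  push_cast
  ring

lemma minus_laplace {κ n : ℕ} {R : MvPolynomial (Fin 2) ℚ} {b : ℕ → ℂ} {f : E → ℝ} {h : ℂ → ℂ}
    (H : ModularKernel κ (-1) Real.pi h (fun z => psi n R (ofComplex z)))
    (hg : StripDecay Real.pi fun z =>
      psi n R (ofComplex z) - principalPart n (fun _ => 0) b z)
    (hf : ∀ x, (f x : ℂ) = (1 : ℝ) * profile κ (-1) h ((‖x‖ ^ 2 : ℝ) : ℂ))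
    (x : E) (hx : √(2 * n) < ‖x‖) :
    IntegrableOn (minusIntegrand (psi n R) ‖x‖) (Ioi 0) ∧
      (f x : ℂ) = Real.sin (Real.pi * ‖x‖ ^ 2 / 2) ^ 2 *
        ∫ t in Ioi (0 : ℝ), minusIntegrand (psi n R) ‖x‖ t := by
  have hs : 2 * (n : ℝ) < ‖x‖ ^ 2 := (Real.sqrt_lt (by positivity) (norm_nonneg _)).1 hx
  obtain ⟨c', hc', hc⟩ := stripDecay_growth Real.pi_pos hg hs
  obtain ⟨h1, h2⟩ := H.profile_eq_laplace (sq_nonneg _) hc' hc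
  have e : (fun t : ℝ => psi n R (ofComplex (t * Complex.I)) *
      Real.exp (-Real.pi * ‖x‖ ^ 2 * t)) = minusIntegrand (psi n R) ‖x‖ := by
    ext t
    rw [minusIntegrand, mul_comm (t : ℂ) Complex.I]
  rw [e] at h1 h2
  refine ⟨h1, ?_⟩
  rw [hf, h2]
  push_cast
  ring

end Integrals

end ModularSchwartz

end

/-! ### The main theorem. -/

open ModularSchwartz in
theorem theorem1 (d : ℕ) (hd : 0 < d) (hd4 : 4 ∣ d) :
    ∃ (n : ℕ) (f fp fm : 𝓢(EuclideanSpace ℝ (Fin d), ℝ)),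
      -- radial Schwartz functions
      IsRadial f ∧ IsRadial fp ∧ IsRadial fm ∧ fp ≠ 0 ∧ fm ≠ 0 ∧
      -- decomposition, and behaviour under the Fourier transform
      f = fp + fm ∧
      (∀ y, 𝓕 (fun x => (fp x : ℂ)) y = (-Complex.I) ^ (-((d / 2 : ℕ) : ℤ)) * (fp y : ℂ)) ∧
      (∀ y, 𝓕 (fun x => (fm x : ℂ)) y = -((-Complex.I) ^ (-((d / 2 : ℕ) : ℤ)) * (fm y : ℂ))) ∧
      (∀ y, 𝓕 (fun x => (f x : ℂ)) y =
        (-Complex.I) ^ (-((d / 2 : ℕ) : ℤ)) * ((fp y : ℂ) - (fm y : ℂ))) ∧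
      -- simple zero at radius `√(2n)`
      (∀ e : EuclideanSpace ℝ (Fin d), ‖e‖ = 1 →
        f (√(2 * n) • e) = 0 ∧ deriv (fun r : ℝ => f (r • e)) √(2 * n) ≠ 0) ∧
      -- double zeros at the radii `√(2m)`, `m > n`
      (∀ m : ℕ, n < m → ∀ e : EuclideanSpace ℝ (Fin d), ‖e‖ = 1 →
        f (√(2 * m) • e) = 0 ∧ deriv (fun r : ℝ => f (r • e)) √(2 * m) = 0) ∧
      -- `fp`, `fm` come from (quasi)modular forms with rational coefficients, and these
      -- coefficients give the values of `f` at the radii `√(2m)`, `m < n`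
      ∃ A B C R : MvPolynomial (Fin 2) ℚ,
        C ≠ 0 ∧
        IsLevelOneWeight A (12 * n - (d / 2 : ℕ) + 4) ∧
        IsLevelOneWeight B (12 * n - (d / 2 : ℕ) + 2) ∧
        IsLevelOneWeight C (12 * n - (d / 2 : ℕ)) ∧
        IsLevelTwoWeight R (12 * n - (d / 2 : ℕ) + 2) ∧
        IsZeroAtImInfty (phi n A B C) ∧
        psi n R = psi n R ∣[(2 - (d / 2 : ℕ) : ℤ)] ModularGroup.T
          + psi n R ∣[(2 - (d / 2 : ℕ) : ℤ)] ModularGroup.S ∧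
        IsZeroAtImInfty (psi n R ∣[(2 - (d / 2 : ℕ) : ℤ)] ModularGroup.S) ∧
        (∀ x : EuclideanSpace ℝ (Fin d), √(2 * n) < ‖x‖ →
          MeasureTheory.IntegrableOn (plusIntegrand d (phi n A B C) ‖x‖) (Set.Ioi 0) ∧
          (fp x : ℂ) = 2 * Real.pi / 3 * Real.sin (Real.pi * ‖x‖ ^ 2 / 2) ^ 2 *
            ∫ t in Set.Ioi (0 : ℝ), plusIntegrand d (phi n A B C) ‖x‖ t) ∧
        (∀ x : EuclideanSpace ℝ (Fin d), √(2 * n) < ‖x‖ →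
          MeasureTheory.IntegrableOn (minusIntegrand (psi n R) ‖x‖) (Set.Ioi 0) ∧
          (fm x : ℂ) = Real.sin (Real.pi * ‖x‖ ^ 2 / 2) ^ 2 *
            ∫ t in Set.Ioi (0 : ℝ), minusIntegrand (psi n R) ‖x‖ t) ∧
        (∀ m : ℕ, m < n → ∀ x : EuclideanSpace ℝ (Fin d), ‖x‖ = √(2 * m) →
          f x = (((valueSeries n B C).coeff (-(m : ℤ)) : ℚ) : ℝ)) := by
  obtain ⟨l, rfl⟩ := hd4
  have hl : 1 ≤ l := by omega
  have hd2 : 4 * l / 2 = 2 * l := by omega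
  -- The level two form fixes n; the level one construction then works for any n ≥ 4l + 1.
  obtain ⟨n, hn, R, hR, hrel, hR0, K, hK⟩ := exists_levelTwo l
  obtain ⟨A, C, hA, hC, hdvd, j, hj1, hjn, T, hT, hCT⟩ := exists_levelOne_pair hn
  obtain ⟨δ, hδ1, hδ⟩ := exists_deltaq_eq
  have hδ0 : δ ≠ 0 := by
    rintro rfl
    simp at hδ1
  have hδn : (δ⁻¹) ^ n * δ ^ n = 1 := by
    rw [← mul_pow, mul_comm, PowerSeries.mul_inv_cancel _ (by simp [hδ1]), one_pow]
  -- X^j Q₁ is the series of qⁿ · 2CE₂/Δⁿ. As j ≥ 1 there is no term q⁻ⁿ, and the coefficient of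
  -- q^{j-n} is not zero.
  set Q₁ : PowerSeries ℚ := 2 * T * E2q * (δ⁻¹) ^ n with hQ₁
  have hP₁ : 2 * MvPolynomial.aeval ![E4q, E6q] C * E2q = PowerSeries.X ^ j * Q₁ * δ ^ n := by
    rw [hCT, hQ₁]
    linear_combination -(2 * PowerSeries.X ^ j * T * E2q) * hδn
  have hP₂ : MvPolynomial.aeval ![E4q, E6q] C =
      PowerSeries.X ^ j * (T * (δ⁻¹) ^ n) * δ ^ n := by
    rw [hCT]
    linear_combination -(PowerSeries.X ^ j * T) * hδn
  have hcoeff0 : ∀ Q : PowerSeries ℚ, PowerSeries.coeff 0 (PowerSeries.X ^ j * Q) = 0 := fun Q => by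
    rw [PowerSeries.coeff_X_pow_mul', if_neg (by omega)]
  have hcoeffj : PowerSeries.coeff j (PowerSeries.X ^ j * Q₁) ≠ 0 := by
    rw [PowerSeries.coeff_X_pow_mul', if_pos le_rfl, Nat.sub_self,
      PowerSeries.coeff_zero_eq_constantCoeff_apply, hQ₁]
    have h2 : PowerSeries.constantCoeff (2 : PowerSeries ℚ) = 2 := map_ofNat _ 2
    simp [hT, hδ1, h2, E2q, constantCoeff_eisensteinQ]
  have hC0 : C ≠ 0 := by
    rintro rfl
    rw [map_zero] at hCT
    have : T ≠ 0 := by rintro rfl; simp at hT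
    exact mul_ne_zero (pow_ne_zero _ PowerSeries.X_ne_zero) this hCT.symm
  have hE : Module.finrank ℝ (EuclideanSpace ℝ (Fin (4 * l))) = 2 * (2 * l - 2 + 2) := by
    rw [finrank_euclideanSpace_fin]; omega
  have Hp := modularKernel_phi hl hA hC hdvd
  have gp := stripDecay_invertedPhi hl hA hC hdvd hδ hP₁ hP₂
  have Hm := modularKernel_psi hl hR hrel hK
  obtain ⟨b, hb, gm⟩ := exists_principalPart_psi hrel hK
  -- The constant 2π/3 is the inverse of (6/π)/4, so that the values are exactly the coefficients.
  obtain ⟨fp, hfp, hfp'⟩ := Hp.exists_real_eigenfunction gp (fun t ht => invertedPhi_real ht) hE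
    (2 * Real.pi / 3)
  obtain ⟨fm, hfm, hfm'⟩ := Hm.exists_real_eigenfunction gm (fun t ht => psi_real ht) hE 1
  rw [show 2 * l - 2 + 2 = 2 * l by omega, I_pow_eq_neg_I_zpow] at hfp' hfm'
  have hfpm : ∀ m : ℕ, ∀ x : EuclideanSpace ℝ (Fin (4 * l)), ‖x‖ = √(2 * m) →
      fp x = if m ≤ n then ((PowerSeries.coeff (n - m) (PowerSeries.X ^ j * Q₁) : ℚ) : ℝ) else 0 := by
    intro m x hx
    apply Complex.ofReal_injective
    rw [hfp, hx, Real.sq_sqrt (by positivity)]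
    have := Hp.profile_two_mul gp m
    push_cast at this ⊢
    rw [this]
    have := pi_ne_zero'
    split_ifs
    · field_simp
      norm_num
    · simp
  have hfmm : ∀ m : ℕ, ∀ x : EuclideanSpace ℝ (Fin (4 * l)), ‖x‖ = √(2 * m) → fm x = 0 := by
    intro m x hx
    apply Complex.ofReal_injective
    rw [hfm, hx, Real.sq_sqrt (by positivity)]
    have := Hm.profile_two_mul gm m
    push_cast at this ⊢
    rw [this]
    simp
  have norm_smul_sqrt : ∀ m : ℕ, ∀ e : EuclideanSpace ℝ (Fin (4 * l)), ‖e‖ = 1 →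
      ‖√(2 * m) • e‖ = √(2 * m) := fun m e he => by
    rw [norm_smul, he, mul_one, Real.norm_of_nonneg (Real.sqrt_nonneg _)]
  have hsum : ∀ x, (((fp + fm) x : ℝ) : ℂ) = (fun s : ℂ =>
      ((2 * Real.pi / 3 : ℝ) : ℂ) * profile (2 * l - 2) 1
        (fun z => phi n A 0 C (UpperHalfPlane.ofComplex z)) s +
      ((1 : ℝ) : ℂ) * profile (2 * l - 2) (-1)
        (fun z => -1 * slashedPsi n R (UpperHalfPlane.ofComplex z)) s) ((‖x‖ ^ 2 : ℝ) : ℂ) := by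
    intro x
    rw [add_apply, Complex.ofReal_add, hfp, hfm]
  -- At s = 2n both principal coefficients of the φ part vanish, so the derivative comes from ψ
  -- alone.
  have hderiv : ∀ m : ℕ, n ≤ m → ∀ e : EuclideanSpace ℝ (Fin (4 * l)), ‖e‖ = 1 →
      deriv (fun r : ℝ => (fp + fm) (r • e)) √(2 * m) =
        ((if m ≤ n then b m * (Real.pi / 4) else 0) * (2 * (√(2 * m) : ℝ)) : ℂ).re := by
    intro m hm e he
    have hp := Hp.hasDerivAt_profile_two_mul gp (M := m) fun h => by
      rw [le_antisymm h hm, Nat.sub_self, hcoeff0]; simp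
    have hm' := Hm.hasDerivAt_profile_two_mul gm (M := m) fun h => rfl
    rw [deriv_radial hsum ((hp.const_mul _).add (hm'.const_mul _)) he]
    congr 2
    split_ifs with h
    · rw [le_antisymm h hm, Nat.sub_self, hcoeff0]; simp
    · simp
  obtain ⟨e₀, he₀⟩ : ∃ e : EuclideanSpace ℝ (Fin (4 * l)), ‖e‖ = 1 :=
    ⟨EuclideanSpace.single ⟨0, hd⟩ 1, by simp⟩
  have hsimple : ∀ e : EuclideanSpace ℝ (Fin (4 * l)), ‖e‖ = 1 →
      deriv (fun r : ℝ => (fp + fm) (r • e)) √(2 * n) ≠ 0 := by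
    intro e he
    have h01 := aeval_theta_ofReal (R := R) 0 1
    rw [Complex.ofReal_zero, Complex.ofReal_one] at h01
    rw [hderiv n le_rfl e he, if_pos le_rfl, hb, h01]
    rw [h01] at hR0
    have h2 : (0 : ℝ) < √(2 * n) := by
      have : (0 : ℝ) < n := by exact_mod_cast (show 0 < n by omega)
      positivity
    have h3 : MvPolynomial.aeval ![(0 : ℝ), 1] R ≠ 0 := by exact_mod_cast hR0
    rw [show (((MvPolynomial.aeval ![(0 : ℝ), 1] R : ℝ) : ℂ) * (Real.pi / 4) *
      (2 * (√(2 * n) : ℝ)) : ℂ) = ((MvPolynomial.aeval ![(0 : ℝ), 1] R * (Real.pi / 4) *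
      (2 * √(2 * n)) : ℝ) : ℂ) by push_cast; ring, Complex.ofReal_re]
    have := Real.pi_pos
    positivity
  -- The nonzero coefficient of q^{j-n} is the value of f₊ at √(2(n - j)).
  have hfp0 : fp ≠ 0 := by
    rintro rfl
    have := hfpm (n - j) _ (norm_smul_sqrt (n - j) e₀ he₀)
    rw [if_pos (Nat.sub_le _ _), Nat.sub_sub_self hjn] at this
    rw [zero_apply] at this
    exact hcoeffj (by exact_mod_cast this.symm)
  -- The nonzero derivative of f at √(2n) equals that of f₋.
  have hfm0 : fm ≠ 0 := by
    intro h
    have hm' := Hm.hasDerivAt_profile_two_mul gm (M := n) fun h => rfl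
    have h1 := deriv_radial (f := fm) (fun x => (hfm x).trans
      (by rw [Complex.ofReal_one, one_mul])) hm' he₀
    refine hsimple e₀ he₀ ((hderiv n le_rfl e₀ he₀).trans (h1.symm.trans ?_))
    simp [h]
  rw [hd2]
  refine ⟨n, fp + fm, fp, fm, fun x y h => Complex.ofReal_injective (by rw [hsum, hsum, h]),
    fun x y h => Complex.ofReal_injective (by rw [hfp, hfp, h]),
    fun x y h => Complex.ofReal_injective (by rw [hfm, hfm, h]), hfp0, hfm0, rfl, ?_, ?_,
    ?_, ?_, ?_, A, 0, C, R, hC0, hA, MvPolynomial.isWeightedHomogeneous_zero _ _ _, hC, hR,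
    isZeroAtImInfty_phi hdvd, psi_eq_slash_add_slash hR hrel, ?_, ?_,
    minus_laplace Hm gm hfm, ?_⟩
  · intro y
    rw [hfp', one_mul]
  · intro y
    rw [hfm']
    ring
  · intro y
    rw [fourier_ofReal_add, hfp', hfm']
    ring
  · refine fun e he => ⟨?_, hsimple e he⟩
    rw [add_apply, hfpm n _ (norm_smul_sqrt n e he),
      hfmm n _ (norm_smul_sqrt n e he), if_pos le_rfl, Nat.sub_self, hcoeff0]
    simp
  · refine fun m hm e he => ⟨?_, ?_⟩
    · rw [add_apply, hfpm m _ (norm_smul_sqrt m e he),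
        hfmm m _ (norm_smul_sqrt m e he), if_neg (by omega), add_zero]
    · rw [hderiv m hm.le e he, if_neg (by omega)]
      simp
  · obtain ⟨D, Y, hD⟩ := exists_bound_slashedPsi hK
    refine isZeroAtImInfty_of_bound (C := D) (Y := Y) le_rfl fun z hz => ?_
    rw [psi_S_slash hR]
    exact hD z hz
  · intro x hx
    have := plus_laplace Hp gp hfp hd2 x hx
    push_cast at this ⊢
    exact this
  · intro m hm x hx
    rw [add_apply, hfpm m x hx, hfmm m x hx, if_pos hm.le, add_zero,
      coeff_valueSeries hδ hδ0 (by rw [map_zero, zero_add, hP₁]) hm.le]
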